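/- Consider second-order evolution equations $\mathcal L$: $u_t=H(t,x,u,u_x,u_{xx})$, where $H$ is a smooth real function on an open subset of $\mathbb R^5$ and $H_{u_{xx}}\neq 0$ there. Let $D_t,D_x$ be the total derivatives on the space of infinite jets $(t,x,u_{ij})$, $u_{ij}=\partial_t^i\partial_x^ju$; differential functions are functions that locally are smooth functions of finitely many jet coordinates. A conserved vector of $\mathcal L$ over a set $D$ of jets is a pair $(F,G)$ of differential functions on $D$ with $D_tF+D_xG=0$ at all jets of $D$ that satisfy $\mathcal L$ and its differential consequences ("solution jets"); it is trivial if locally, at solution jets, $(F,G)=(D_x\Phi,-D_t\Phi)$ for some differential function $\Phi$. Conservation laws of $\mathcal L$ over $D$ are the elements of the quotient space of conserved vectors by trivial ones. A conservation law has characteristic $\lambda$ if it contains a conserved vector with $D_tF+D_xG=\lambda\,(u_t-H)$ identically on $D$. A (local) contact transformation is $\tilde t=T(t)$, $\tilde x=X(t,x,u,u_x)$, $\tilde u=U(t,x,u,u_x)$ with smooth $T,X,U$, $T_t\ne0$, $\operatorname{rank}\begin{pmatrix}X_x&X_u&X_{u_x}\\U_x&U_u&U_{u_x}\end{pmatrix}=2$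 and $(U_x+U_uu_x)X_{u_x}=(X_x+X_uu_x)U_{u_x}$, such that $\tilde u_{\tilde x}=V(t,x,u,u_x)$ is defined, where $V=U_{u_x}/X_{u_x}$ or $V=(U_x+U_uu_x)/(X_x+X_uu_x)$, and $(t,x,u,u_x)\mapsto(T,X,U,V)$ is injective; where $D_xX\ne0$ it is prolonged to jets in the usual way. It is a point transformation if $X,U$ depend only on $(t,x,u)$. It maps a pair $(\mathcal L,\mathcal F)$ of an equation and a conservation law to $(\tilde{\mathcal L},\tilde{\mathcal F})$ if, at prolonged points, $\tilde H=\frac{U_u-X_uV}{T_t}H+\frac{U_t-X_tV}{T_t}$ and some conserved vectors $(F,G)\in\mathcal F$, $(\tilde F,\tilde G)\in\tilde{\mathcal F}$ satisfy $\tilde F=\frac{F}{D_xX}$, $\tilde G=\frac{G}{T_t}+\frac{D_tX}{D_xX}\frac{F}{T_t}$. **Statement.** Let $\mathcal L$ be an equation of this class and $\mathcal F$ a nonzero conservation law of $\mathcal L$ over an open set $D$ of jets. Then there is an open set $D_1\subseteq D$ containing solution jets of $\mathcal L$ on which the pair $(\mathcal L,\mathcal F|_{D_1})$ is mapped by a contact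 transformation to a pair $(\tilde{\mathcal L},\tilde{\mathcal F})$, where $\tilde{\mathcal L}$ is an equation of the same class and $\tilde{\mathcal F}$ is a conservation law of $\tilde{\mathcal L}$ (over an open set of jets containing the image of $D_1$) with characteristic $1$. If moreover $\mathcal L$ is quasi-linear ($H_{u_{xx}u_{xx}}=0$), then this can be achieved with a point transformation and with $\tilde{\mathcal L}$ again quasi-linear. -/

import Mathlib

open scoped ContDiff Topology

namespace EvolCL

/-! ### Jets of functions `u(t, x)` and total derivatives -/

/-- Infinite jets: `(t, x, u)` where `u i j` stands for the derivative `∂ₜⁱ ∂ₓʲ u`.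
The product topology is the one generated by the open sets of the finite-order jet spaces. -/
abbrev Jet := ℝ × ℝ × (ℕ → ℕ → ℝ)

/-- The variables `(t, x, u, u_x)`. -/
abbrev J1 := ℝ × ℝ × ℝ × ℝ

/-- The variables `(t, x, u, u_x, u_xx)`. -/
abbrev J2 := ℝ × ℝ × ℝ × ℝ × ℝ

/-- The part `(t, x, u, u_x)` of a jet. -/
def toJ1 (w : Jet) : J1 := (w.1, w.2.1, w.2.2 0 0, w.2.2 0 1)

/-- The part `(t, x, u, u_x, u_xx)` of a jet. -/
def toJ2 (w : Jet) : J2 := (w.1, w.2.1, w.2.2 0 0, w.2.2 0 1, w.2.2 0 2)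

/-- The part of a jet consisting of `t`, `x` and the `u i j` with `i, j < n`. -/
def trunc (n : ℕ) (w : Jet) : ℝ × ℝ × (Fin n → Fin n → ℝ) :=
  (w.1, w.2.1, fun i j => w.2.2 i j)

/-- Smooth differential functions on a set `D` of jets: near each point of `D` the function is
a smooth function of finitely many jet coordinates. -/
def SmoothOn (f : Jet → ℝ) (D : Set Jet) : Prop :=
  ∀ z ∈ D, ∃ (n : ℕ) (g : ℝ × ℝ × (Fin n → Fin n → ℝ) → ℝ)
    (W : Set (ℝ × ℝ × (Fin n → Fin n → ℝ))),
    IsOpen W ∧ trunc n z ∈ W ∧ ContDiffOn ℝ ∞ g W ∧ ∀ w, trunc n w ∈ W → f w = g (trunc n w)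

/-- The vector field `D_t = ∂_t + ∑ u_{i+1,j} ∂_{u_{ij}}` on jets. -/
def vecT (w : Jet) : Jet := (1, 0, fun i j => w.2.2 (i + 1) j)

/-- The vector field `D_x = ∂_x + ∑ u_{i,j+1} ∂_{u_{ij}}` on jets. -/
def vecX (w : Jet) : Jet := (0, 1, fun i j => w.2.2 i (j + 1))

/-- The total derivative `D_t f` (the derivative of `f` along the vector field `D_t`). -/
noncomputable def Dt (f : Jet → ℝ) (w : Jet) : ℝ := lineDeriv ℝ f w (vecT w)

/-- The total derivative `D_x f` (the derivative of `f` along the vector field `D_x`). -/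
noncomputable def Dx (f : Jet → ℝ) (w : Jet) : ℝ := lineDeriv ℝ f w (vecX w)

/-! ### Basic facts needed for the vector-space structure on conserved vectors -/

/-- Truncation as a linear map. -/
def truncLin (n : ℕ) : Jet →ₗ[ℝ] ℝ × ℝ × (Fin n → Fin n → ℝ) where
  toFun := trunc n
  map_add' _ _ := rfl
  map_smul' _ _ := rfl

theorem SmoothOn.mono {f : Jet → ℝ} {D D' : Set Jet} (hf : SmoothOn f D) (h : D' ⊆ D) :
    SmoothOn f D' := fun z hz => hf z (h hz)

/-- The order of a local representation can be raised. -/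
theorem exists_rep_of_le {f : Jet → ℝ} {z : Jet} {n m : ℕ} (hnm : n ≤ m)
    (hf : ∃ (g : ℝ × ℝ × (Fin n → Fin n → ℝ) → ℝ) (W : Set (ℝ × ℝ × (Fin n → Fin n → ℝ))),
      IsOpen W ∧ trunc n z ∈ W ∧ ContDiffOn ℝ ∞ g W ∧
        ∀ w, trunc n w ∈ W → f w = g (trunc n w)) :
    ∃ (g : ℝ × ℝ × (Fin m → Fin m → ℝ) → ℝ) (W : Set (ℝ × ℝ × (Fin m → Fin m → ℝ))),
      IsOpen W ∧ trunc m z ∈ W ∧ ContDiffOn ℝ ∞ g W ∧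
        ∀ w, trunc m w ∈ W → f w = g (trunc m w) := by
  obtain ⟨g, W, hW, hz, hg, hfg⟩ := hf
  let r : ℝ × ℝ × (Fin m → Fin m → ℝ) → ℝ × ℝ × (Fin n → Fin n → ℝ) :=
    fun y => (y.1, y.2.1, fun i j => y.2.2 (Fin.castLE hnm i) (Fin.castLE hnm j))
  have hr : ContDiff ℝ ∞ r := by
    refine contDiff_fst.prodMk ((contDiff_fst.comp contDiff_snd).prodMk ?_)
    refine contDiff_pi.2 fun i => contDiff_pi.2 fun j => ?_
    exact contDiff_pi.1 (contDiff_pi.1 (contDiff_snd.comp contDiff_snd) _) _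
  have hrt : ∀ w, r (trunc m w) = trunc n w := fun w => rfl
  refine ⟨g ∘ r, r ⁻¹' W, hW.preimage hr.continuous, ?_, ?_, ?_⟩
  · exact hz
  · exact hg.comp hr.contDiffOn fun y hy => hy
  · intro w hw
    exact hfg w hw

theorem SmoothOn.zero (D : Set Jet) : SmoothOn (0 : Jet → ℝ) D := fun _ _ =>
  ⟨0, 0, Set.univ, isOpen_univ, trivial, contDiffOn_const, fun _ _ => rfl⟩

theorem SmoothOn.const_smul {f : Jet → ℝ} {D : Set Jet} (c : ℝ) (hf : SmoothOn f D) :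
    SmoothOn (c • f) D := by
  intro z hz
  obtain ⟨n, g, W, hW, hzW, hg, hfg⟩ := hf z hz
  refine ⟨n, c • g, W, hW, hzW, contDiffOn_const.smul hg, fun w hw => ?_⟩
  simp [hfg w hw]

theorem SmoothOn.add {f g : Jet → ℝ} {D : Set Jet} (hf : SmoothOn f D) (hg : SmoothOn g D) :
    SmoothOn (f + g) D := by
  intro z hz
  obtain ⟨n₁, h₁⟩ := hf z hz
  obtain ⟨n₂, h₂⟩ := hg z hz
  obtain ⟨g₁, W₁, hW₁, hz₁, hg₁, hf₁⟩ := exists_rep_of_le (le_max_left n₁ n₂) h₁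
  obtain ⟨g₂, W₂, hW₂, hz₂, hg₂, hf₂⟩ := exists_rep_of_le (le_max_right n₁ n₂) h₂
  refine ⟨max n₁ n₂, g₁ + g₂, W₁ ∩ W₂, hW₁.inter hW₂, ⟨hz₁, hz₂⟩,
    (hg₁.mono Set.inter_subset_left).add (hg₂.mono Set.inter_subset_right), fun w hw => ?_⟩
  simp [hf₁ w hw.1, hf₂ w hw.2]

/-- Smooth differential functions have derivatives in all directions. -/
theorem SmoothOn.lineDifferentiableAt {f : Jet → ℝ} {D : Set Jet} (hf : SmoothOn f D)
    {z : Jet} (hz : z ∈ D) (v : Jet) : LineDifferentiableAt ℝ f z v := by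
  obtain ⟨n, g, W, hW, hzW, hg, hfg⟩ := hf z hz
  have hgd : DifferentiableAt ℝ g (trunc n z) :=
    (hg.contDiffAt (hW.mem_nhds hzW)).differentiableAt (by simp)
  have hl : DifferentiableAt ℝ (fun s : ℝ => g (trunc n z + s • trunc n v)) 0 := by
    have hlin : DifferentiableAt ℝ (fun s : ℝ => trunc n z + s • trunc n v) 0 := by fun_prop
    have hgd' : DifferentiableAt ℝ g (trunc n z + (0 : ℝ) • trunc n v) := by simpa using hgd
    exact DifferentiableAt.comp (0 : ℝ) hgd' hlin
  have htr : ∀ s : ℝ, trunc n (z + s • v) = trunc n z + s • trunc n v := fun s => rfl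
  refine hl.congr_of_eventuallyEq ?_
  have hc : Continuous fun s : ℝ => trunc n z + s • trunc n v := by fun_prop
  have hW0 : ∀ᶠ s in 𝓝 (0 : ℝ), trunc n z + s • trunc n v ∈ W :=
    hc.continuousAt.preimage_mem_nhds (hW.mem_nhds (by simpa using hzW))
  filter_upwards [hW0] with s hs
  rw [hfg _ (by rw [htr]; exact hs), htr]

theorem lineDeriv_add_of {f g : Jet → ℝ} {z v : Jet} (hf : LineDifferentiableAt ℝ f z v)
    (hg : LineDifferentiableAt ℝ g z v) :
    lineDeriv ℝ (f + g) z v = lineDeriv ℝ f z v + lineDeriv ℝ g z v :=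
  deriv_add hf hg

theorem lineDeriv_smul_of {f : Jet → ℝ} {z v : Jet} (c : ℝ) :
    lineDeriv ℝ (c • f) z v = c * lineDeriv ℝ f z v :=
  deriv_const_smul_field c (f := fun s : ℝ => f (z + s • v))

/-! ### Second-order evolution equations -/

/-- An equation `u_t = H(t, x, u, u_x, u_xx)` with `H` smooth on an open set and
`H_{u_xx} ≠ 0` there. -/
structure Equation where
  dom : Set J2
  isOpen_dom : IsOpen dom
  H : J2 → ℝ
  smooth : ContDiffOn ℝ ∞ H dom
  nondeg : ∀ y ∈ dom, fderiv ℝ H y (0, 0, 0, 0, 1) ≠ 0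

namespace Equation

/-- The differential function `u_t - H`. -/
def defect (L : Equation) (w : Jet) : ℝ := w.2.2 1 0 - L.H (toJ2 w)

/-- The jets satisfying the equation and all its differential consequences. -/
def sol (L : Equation) : Set Jet :=
  {w | toJ2 w ∈ L.dom ∧ ∀ i j : ℕ, (Dt^[i] (Dx^[j] L.defect)) w = 0}

/-- Quasi-linear equations: `H_{u_xx u_xx} = 0`. -/
def IsQuasiLinear (L : Equation) : Prop :=
  ∀ y ∈ L.dom,
    fderiv ℝ (fun y' => fderiv ℝ L.H y' (0, 0, 0, 0, 1)) y (0, 0, 0, 0, 1) = 0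

end Equation

/-! ### Conserved vectors and conservation laws -/

/-- The space of conserved vectors of `L` over `D`: pairs `(F, G)` of smooth differential
functions with `D_t F + D_x G = 0` on the solutions of `L`. -/
def CV (L : Equation) (D : Set Jet) : Submodule ℝ ((Jet → ℝ) × (Jet → ℝ)) where
  carrier := {P | SmoothOn P.1 D ∧ SmoothOn P.2 D ∧
    ∀ w ∈ D ∩ L.sol, Dt P.1 w + Dx P.2 w = 0}
  zero_mem' := ⟨SmoothOn.zero D, SmoothOn.zero D, fun w _ => by simp [Dt, Dx, lineDeriv]⟩
  add_mem' := by
    rintro P Q ⟨hP1, hP2, hP⟩ ⟨hQ1, hQ2, hQ⟩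
    refine ⟨hP1.add hQ1, hP2.add hQ2, fun w hw => ?_⟩
    have h1 := lineDeriv_add_of (hP1.lineDifferentiableAt hw.1 (vecT w))
      (hQ1.lineDifferentiableAt hw.1 (vecT w))
    have h2 := lineDeriv_add_of (hP2.lineDifferentiableAt hw.1 (vecX w))
      (hQ2.lineDifferentiableAt hw.1 (vecX w))
    have e1 := hP w hw
    have e2 := hQ w hw
    simp only [Dt, Dx, Prod.fst_add, Prod.snd_add] at e1 e2 ⊢
    rw [h1, h2]
    linarith
  smul_mem' := by
    rintro c P ⟨hP1, hP2, hP⟩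
    refine ⟨hP1.const_smul c, hP2.const_smul c, fun w hw => ?_⟩
    have e1 := hP w hw
    simp only [Dt, Dx, Prod.smul_fst, Prod.smul_snd, lineDeriv_smul_of] at e1 ⊢
    rw [← mul_add, e1, mul_zero]

/-- Trivial pairs: near each solution jet in `D` the pair coincides, on the solutions of `L`,
with a null divergence `(D_x Φ, -D_t Φ)`; that is, it is the sum of a pair vanishing on the
solutions and a null divergence. -/
def CV0 (L : Equation) (D : Set Jet) : Submodule ℝ ((Jet → ℝ) × (Jet → ℝ)) where
  carrier := {P | ∀ z ∈ D ∩ L.sol, ∃ (W : Set Jet) (Φ : Jet → ℝ), IsOpen W ∧ z ∈ W ∧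
    SmoothOn Φ W ∧ ∀ w ∈ W ∩ L.sol, P.1 w = Dx Φ w ∧ P.2 w = -Dt Φ w}
  zero_mem' := fun z _ => ⟨Set.univ, 0, isOpen_univ, trivial, SmoothOn.zero _,
    fun w _ => by simp [Dt, Dx, lineDeriv]⟩
  add_mem' := by
    intro P Q hP hQ z hz
    obtain ⟨W₁, Φ₁, hW₁, hz₁, hs₁, h₁⟩ := hP z hz
    obtain ⟨W₂, Φ₂, hW₂, hz₂, hs₂, h₂⟩ := hQ z hz
    refine ⟨W₁ ∩ W₂, Φ₁ + Φ₂, hW₁.inter hW₂, ⟨hz₁, hz₂⟩,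
      (hs₁.mono Set.inter_subset_left).add (hs₂.mono Set.inter_subset_right), ?_⟩
    rintro w ⟨⟨hw₁, hw₂⟩, hw⟩
    have a := lineDeriv_add_of (hs₁.lineDifferentiableAt hw₁ (vecT w))
      (hs₂.lineDifferentiableAt hw₂ (vecT w))
    have b := lineDeriv_add_of (hs₁.lineDifferentiableAt hw₁ (vecX w))
      (hs₂.lineDifferentiableAt hw₂ (vecX w))
    have c := h₁ w ⟨hw₁, hw⟩
    have d := h₂ w ⟨hw₂, hw⟩
    simp only [Dt, Dx, Prod.fst_add, Prod.snd_add, Pi.add_apply] at c d ⊢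
    rw [a, b, c.1, c.2, d.1, d.2]
    exact ⟨rfl, by ring⟩
  smul_mem' := by
    intro c P hP z hz
    obtain ⟨W, Φ, hW, hzW, hs, h⟩ := hP z hz
    refine ⟨W, c • Φ, hW, hzW, hs.const_smul c, fun w hw => ?_⟩
    have d := h w hw
    simp only [Dt, Dx, Prod.smul_fst, Prod.smul_snd, Pi.smul_apply, smul_eq_mul,
      lineDeriv_smul_of] at d ⊢
    rw [d.1, d.2]
    exact ⟨rfl, by ring⟩

/-- The space of local conservation laws of `L` over `D`: conserved vectors modulo trivial
ones. -/
abbrev CL (L : Equation) (D : Set Jet) : Type :=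
  CV L D ⧸ (CV0 L D).comap (CV L D).subtype

/-- The conservation law containing a conserved vector. -/
abbrev CL.mk {L : Equation} {D : Set Jet} (P : CV L D) : CL L D := Submodule.Quotient.mk P

theorem CV_mono (L : Equation) {D D' : Set Jet} (h : D' ⊆ D) : CV L D ≤ CV L D' :=
  fun _ hP => ⟨hP.1.mono h, hP.2.1.mono h, fun w hw => hP.2.2 w ⟨h hw.1, hw.2⟩⟩

/-- Restriction of conservation laws to a smaller set of jets. -/
def CL.restrict {L : Equation} {D D' : Set Jet} (h : D' ⊆ D) : CL L D →ₗ[ℝ] CL L D' :=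
  Submodule.mapQ _ _ (Submodule.inclusion (CV_mono L h))
    (fun _ hP z hz => hP z ⟨h hz.1, hz.2⟩)

/-- The conservation law `ℱ` has the characteristic `chi`: it contains a conserved vector
`(F, G)` with `D_t F + D_x G = chi * (u_t - H)` identically in all jet variables. -/
def CL.HasCharacteristic {L : Equation} {D : Set Jet} (ℱ : CL L D) (chi : Jet → ℝ) : Prop :=
  SmoothOn chi D ∧ ∃ P : CV L D, CL.mk P = ℱ ∧
    ∀ w ∈ D, Dt P.1.1 w + Dx P.1.2 w = chi w * L.defect w

/-! ### Contact and point transformations -/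

/-- The partial derivative with respect to `t` of a function of `(t, x, u, u_x)`. -/
noncomputable def pt (f : J1 → ℝ) (y : J1) : ℝ := fderiv ℝ f y (1, 0, 0, 0)

/-- The partial derivative with respect to `x` of a function of `(t, x, u, u_x)`. -/
noncomputable def px (f : J1 → ℝ) (y : J1) : ℝ := fderiv ℝ f y (0, 1, 0, 0)

/-- The partial derivative with respect to `u` of a function of `(t, x, u, u_x)`. -/
noncomputable def pu (f : J1 → ℝ) (y : J1) : ℝ := fderiv ℝ f y (0, 0, 1, 0)

/-- The partial derivative with respect to `u_x` of a function of `(t, x, u, u_x)`. -/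
noncomputable def pp (f : J1 → ℝ) (y : J1) : ℝ := fderiv ℝ f y (0, 0, 0, 1)

/-- The transformed derivative `V` of `u` with respect to `x`. -/
noncomputable def contactV (X U : J1 → ℝ) (y : J1) : ℝ :=
  open Classical in
  if pp X y ≠ 0 then pp U y / pp X y
  else (px U y + pu U y * y.2.2.2) / (px X y + pu X y * y.2.2.2)

/-- A (local) contact transformation `t̃ = T(t)`, `x̃ = X(t, x, u, u_x)`,
`ũ = U(t, x, u, u_x)`, with `ũ_x̃ = V(t, x, u, u_x)`. -/
structure ContactTransformation where
  dom : Set J1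
  isOpen_dom : IsOpen dom
  T : ℝ → ℝ
  X : J1 → ℝ
  U : J1 → ℝ
  smooth_T : ContDiffOn ℝ ∞ T (Prod.fst '' dom)
  smooth_X : ContDiffOn ℝ ∞ X dom
  smooth_U : ContDiffOn ℝ ∞ U dom
  deriv_T_ne : ∀ y ∈ dom, deriv T y.1 ≠ 0
  rank_eq_two : ∀ y ∈ dom,
    (!![px X y, pu X y, pp X y; px U y, pu U y, pp U y] : Matrix (Fin 2) (Fin 3) ℝ).rank = 2
  contact : ∀ y ∈ dom,
    (px U y + pu U y * y.2.2.2) * pp X y = (px X y + pu X y * y.2.2.2) * pp U y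
  /-- one of the two expressions for `V` makes sense -/
  regular : ∀ y ∈ dom, px X y + pu X y * y.2.2.2 ≠ 0 ∨ pp X y ≠ 0
  injOn : Set.InjOn (fun y : J1 => ((T y.1, X y, U y, contactV X U y) : J1)) dom

namespace ContactTransformation

/-- The transformation is (the prolongation of) a point transformation: `X` and `U` are
functions of `(t, x, u)` only. -/
def IsPoint (𝒯 : ContactTransformation) : Prop :=
  ∃ X₀ U₀ : ℝ × ℝ × ℝ → ℝ, ∀ y ∈ 𝒯.dom,
    𝒯.X y = X₀ (y.1, y.2.1, y.2.2.1) ∧ 𝒯.U y = U₀ (y.1, y.2.1, y.2.2.1)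

/-- `X` as a differential function. -/
def jetX (𝒯 : ContactTransformation) (w : Jet) : ℝ := 𝒯.X (toJ1 w)

/-- `U` as a differential function. -/
def jetU (𝒯 : ContactTransformation) (w : Jet) : ℝ := 𝒯.U (toJ1 w)

/-- The total derivative with respect to `x̃` in the old coordinates. -/
noncomputable def newDx (𝒯 : ContactTransformation) (f : Jet → ℝ) (w : Jet) : ℝ :=
  Dx f w / Dx 𝒯.jetX w

/-- The total derivative with respect to `t̃` in the old coordinates. -/
noncomputable def newDt (𝒯 : ContactTransformation) (f : Jet → ℝ) (w : Jet) : ℝ :=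
  (Dt f w - Dt 𝒯.jetX w / Dx 𝒯.jetX w * Dx f w) / deriv 𝒯.T w.1

/-- The prolongation of the transformation to all derivatives of `u` (meaningful where
`D_x X ≠ 0`). -/
noncomputable def prolong (𝒯 : ContactTransformation) (w : Jet) : Jet :=
  (𝒯.T w.1, 𝒯.jetX w, fun i j => (𝒯.newDt^[i] (𝒯.newDx^[j] 𝒯.jetU)) w)

/-- The transformation `𝒯`, prolonged to jets in `D`, maps the pair `(L, ℱ)`, with a
conservation law `ℱ` of `L` over `D`, to the pair `(L', ℱ')`, with a conservation law `ℱ'` of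
`L'` over `D'`. -/
structure MapsPair (𝒯 : ContactTransformation) {L L' : Equation} {D D' : Set Jet}
    (ℱ : CL L D) (ℱ' : CL L' D') : Prop where
  source : ∀ w ∈ D, toJ2 w ∈ L.dom ∧ toJ1 w ∈ 𝒯.dom ∧ Dx 𝒯.jetX w ≠ 0
  target : ∀ w ∈ D', toJ2 w ∈ L'.dom
  mapsTo : Set.MapsTo 𝒯.prolong D D'
  /-- the right-hand side of the transformed equation -/
  rhs : ∀ w ∈ D, L'.H (toJ2 (𝒯.prolong w)) =
    (pu 𝒯.U (toJ1 w) - pu 𝒯.X (toJ1 w) * contactV 𝒯.X 𝒯.U (toJ1 w)) / deriv 𝒯.T w.1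
        * L.H (toJ2 w)
      + (pt 𝒯.U (toJ1 w) - pt 𝒯.X (toJ1 w) * contactV 𝒯.X 𝒯.U (toJ1 w)) / deriv 𝒯.T w.1
  /-- conserved vectors `(F, G)` of `ℱ` and `(F', G')` of `ℱ'` correspond to each other:
  `F' = F / D_x X` and `G' = G / T_t + (D_t X / D_x X) F / T_t` -/
  law : ∃ (P : CV L D) (P' : CV L' D'), CL.mk P = ℱ ∧ CL.mk P' = ℱ' ∧
    ∀ w ∈ D, P'.1.1 (𝒯.prolong w) = P.1.1 w / Dx 𝒯.jetX w ∧
      P'.1.2 (𝒯.prolong w) = P.1.2 w / deriv 𝒯.T w.1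
        + Dt 𝒯.jetX w / Dx 𝒯.jetX w * (P.1.1 w / deriv 𝒯.T w.1)

end ContactTransformation

end EvolCL

/-!
Near a solution jet every conservation law can be transformed to one with the characteristic `1`
by a contact transformation which is read off from a Lagrangian in one independent variable.

*Normal form.* The solution jets are parametrised by `t`, `x` and the `u_{0j}`
(`Equation.solMap_mem_sol`, `Equation.solMap_eq_self`), and on them `D_t` becomes a derivative
along an evolutionary vector field. Comparing the highest derivatives in `D_t F + D_x G = 0` shows
that the density `F` is affine in its highest derivative as long as its order is at least two;
hence its order is lowered by subtracting a total derivative `D_x Φ`. In the end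
`(F, G) = (f, k - f_p H) + (D_x Φ, -D_t Φ)` on the solution jets, where `f` and `k` are functions of
`(t, x, u, p)`, `p = u_x`, with
`f_t + (f_u - D_x f_p) H + D_x k = 0` (`Equation.exists_normal_form`, `NormalFormAt`).

*Darboux coordinates.* For fixed `t` consider the Poincaré–Cartan form `(f - p f_p) dx + f_p du`
of the Lagrangian `f`, and suppose that it is written as `dΦ + U dX` (`DarbouxOn`). Its exterior
derivative shows that `(X, U)` satisfies the contact condition and that
`f_u - D_x f_p = (U_u - V X_u) D_x X`. Together with the identity for `k` this means that
`(f, k - f_p H)` is equivalent to `(U D_x X, g - U D_t X)` with `D_x g = -H̃ D_x X`, where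
`H̃` is the transformed right-hand side (`DarbouxOn.tdx_flux`). The new conserved vector is
`(ũ, g)`, and its divergence is `ũ_t̃ - H̃`: the characteristic is `1`
(`ContactOn.exists_mapsPair`).

*Existence of Darboux coordinates.* If `f_pp ≠ 0` at some point, `f` is a regular Lagrangian. Then
`X` and `U` are the initial values of `u` and `f_p` on its extremals, transported by the
flow, and `Φ` is the action (`exists_darboux_of_regular`). If `f_pp` vanishes identically,
`X = x` and `Φ`, `U` are functions of `(t, x, u)`, which gives a point transformation
(`exists_darboux_of_affine`) unless `U_u` vanishes identically; in this exceptional case the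
conserved vector is trivial (`DarbouxOn.exists_potential`). For a quasi-linear equation the second
derivative of the identity for `k` with respect to `u_xx` shows that always `f_pp = 0`
(`NormalFormAt.affine_of_isQuasiLinear`).

Mathlib has the inverse function theorem but not the smooth dependence of flows on initial
values; the latter is deduced from the former in a space of curves (`exists_smooth_flow`).
-/

namespace EvolCL

/-! ### Smooth inverses, superposition operators and flows -/

/-- The inverse function theorem for maps smooth on an open set. A single local inverse is smooth
on its whole domain, although the neighbourhoods on which a `ContDiffAt ℝ ∞` function is `C^n` may
shrink with `n`. -/
theorem exists_local_smooth_inverse {E F : Type*} [NormedAddCommGroup E] [NormedSpace ℝ E]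
    [CompleteSpace E] [NormedAddCommGroup F] [NormedSpace ℝ F] {f : E → F} {U : Set E} {a : E}
    (hU : IsOpen U) (ha : a ∈ U) (hf : ContDiffOn ℝ ∞ f U) (f' : E ≃L[ℝ] F)
    (hf' : HasFDerivAt f (f' : E →L[ℝ] F) a) :
    ∃ e : OpenPartialHomeomorph E F, a ∈ e.source ∧ e.source ⊆ U ∧ (∀ x, e x = f x) ∧
      ContDiffOn ℝ ∞ e.symm e.target := by
  have hfa : ContDiffAt ℝ ∞ f a := hf.contDiffAt (hU.mem_nhds ha)
  have hne : (∞ : WithTop ℕ∞) ≠ 0 := by simp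
  let e₀ := hfa.toOpenPartialHomeomorph f hf' hne
  have hcont : ContinuousOn (fderiv ℝ f) U := hf.continuousOn_fderiv_of_isOpen hU (by simp)
  let s : Set E := U ∩ fderiv ℝ f ⁻¹' Set.range ((↑) : (E ≃L[ℝ] F) → (E →L[ℝ] F))
  have hs : IsOpen s := hcont.isOpen_inter_preimage hU ContinuousLinearEquiv.isOpen
  have has : a ∈ s := ⟨ha, f', hf'.fderiv.symm⟩
  refine ⟨e₀.restrOpen s hs, ⟨hfa.mem_toOpenPartialHomeomorph_source hf' hne, has⟩,
    fun x hx => hx.2.1, fun x => rfl, fun y hy => ?_⟩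
  have hx := (e₀.restrOpen s hs).map_target hy
  set x := (e₀.restrOpen s hs).symm y with hxdef
  obtain ⟨g', hg'⟩ := hx.2.2
  have hfx : ContDiffAt ℝ ∞ f x := hf.contDiffAt (hU.mem_nhds hx.2.1)
  refine ((e₀.restrOpen s hs).contDiffAt_symm (f₀' := g') hy ?_ ?_).contDiffWithinAt
  · rw [hg']
    exact (hfx.differentiableAt (by simp)).hasFDerivAt
  · exact hfx

/-- A locally defined smooth function has, near a given point, the same values as a smooth
function with compact support. -/
theorem exists_contDiff_eventuallyEq {E F : Type*} [NormedAddCommGroup E] [NormedSpace ℝ E]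
    [FiniteDimensional ℝ E] [NormedAddCommGroup F] [NormedSpace ℝ F] {f : E → F} {U : Set E}
    {a : E} (hU : IsOpen U) (ha : a ∈ U) (hf : ContDiffOn ℝ ∞ f U) :
    ∃ g : E → F, ContDiff ℝ ∞ g ∧ HasCompactSupport g ∧ g =ᶠ[𝓝 a] f := by
  obtain ⟨r, hr, hrU⟩ := Metric.isOpen_iff.1 hU a ha
  let b : ContDiffBump a := ⟨r / 4, r / 2, by positivity, by linarith⟩
  refine ⟨fun x => b x • f x, ?_, ?_, ?_⟩
  · rw [contDiff_iff_contDiffAt]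
    intro x
    by_cases hx : x ∈ U
    · exact b.contDiff.contDiffAt.smul (hf.contDiffAt (hU.mem_nhds hx))
    · have hxs : x ∉ tsupport b := by
        rw [b.tsupport_eq]
        intro h
        apply hx (hrU _)
        have h' := Metric.mem_closedBall.1 h
        have : b.rOut = r / 2 := rfl
        rw [Metric.mem_ball]
        linarith
      have h0 : (fun x => b x • f x) =ᶠ[𝓝 x] fun _ => 0 := by
        filter_upwards [(isClosed_tsupport _).isOpen_compl.mem_nhds hxs] with y hy
        rw [image_eq_zero_of_notMem_tsupport hy, zero_smul]
      exact contDiffAt_const.congr_of_eventuallyEq h0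
  · exact b.hasCompactSupport.smul_right
  · filter_upwards [b.eventuallyEq_one] with x hx
    simp [hx]

section Superposition

variable {K : Type*} [TopologicalSpace K] [CompactSpace K]

/-- The superposition operator `γ ↦ v ∘ γ` on spaces of continuous functions. -/
def superposition {E F : Type*} [TopologicalSpace E] [TopologicalSpace F] {v : E → F}
    (hv : Continuous v) (γ : C(K, E)) : C(K, F) :=
  (⟨v, hv⟩ : C(E, F)).comp γ

variable {E F : Type} [NormedAddCommGroup E] [NormedSpace ℝ E] [NormedAddCommGroup F]
  [NormedSpace ℝ F]

/-- Pointwise application of a continuous family of linear maps to a continuous family of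
vectors. -/
noncomputable def pointwiseApply : C(K, E →L[ℝ] F) →L[ℝ] C(K, E) →L[ℝ] C(K, F) :=
  LinearMap.mkContinuous₂
    (LinearMap.mk₂ ℝ (fun (A : C(K, E →L[ℝ] F)) (h : C(K, E)) =>
        (⟨fun k => A k (h k), by fun_prop⟩ : C(K, F)))
      (fun A A' h => by ext; simp) (fun c A h => by ext; simp)
      (fun A h h' => by ext; simp) (fun c A h => by ext; simp)) 1
    (fun A h => by
      rw [ContinuousMap.norm_le _ (by positivity)]
      intro k
      simp only [one_mul]
      exact ((A k).le_opNorm (h k)).trans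
        (mul_le_mul (A.norm_coe_le_norm k) (h.norm_coe_le_norm k) (norm_nonneg (h k))
          (norm_nonneg A)))

/-- A `C¹` function defines a differentiable superposition operator. The remainder is estimated
uniformly in the point of `K` because the superposition operator of the derivative is continuous;
this continuity is tested on perturbations of `γ` by constants. -/
theorem hasFDerivAt_superposition {v : E → F} (hv : ContDiff ℝ 1 v) (γ : C(K, E)) :
    HasFDerivAt (superposition hv.continuous : C(K, E) → C(K, F))
      (pointwiseApply (superposition (hv.continuous_fderiv (by simp)) γ)) γ := by
  rw [hasFDerivAt_iff_isLittleO_nhds_zero, Asymptotics.isLittleO_iff]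
  intro ε hε
  have hc : Continuous
      (superposition (hv.continuous_fderiv (by simp)) : C(K, E) → C(K, E →L[ℝ] F)) :=
    ContinuousMap.continuous_postcomp _
  have hc' : ContinuousAt
      (superposition (hv.continuous_fderiv (by simp)) : C(K, E) → C(K, E →L[ℝ] F)) γ :=
    hc.continuousAt
  obtain ⟨δ, hδ, hδε⟩ := (Metric.continuousAt_iff (α := C(K, E)) (β := C(K, E →L[ℝ] F))).1 hc' ε hε
  filter_upwards [Metric.ball_mem_nhds (0 : C(K, E)) hδ] with h hh
  rw [ContinuousMap.norm_le _ (by positivity)]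
  intro k
  have hbound : ∀ y ∈ Metric.ball (γ k) δ, ‖fderiv ℝ v y - fderiv ℝ v (γ k)‖ ≤ ε := by
    intro y hy
    have h1 : dist (γ + ContinuousMap.const K (y - γ k)) γ < δ := by
      rw [dist_eq_norm, add_sub_cancel_left]
      refine lt_of_le_of_lt ((ContinuousMap.norm_le _ (norm_nonneg (y - γ k))).2 fun _ => le_rfl) ?_
      simpa [dist_eq_norm] using hy
    have h2 := hδε h1
    have h3 := (ContinuousMap.dist_apply_le_dist k).trans h2.le
    rw [dist_eq_norm] at h3
    simpa [superposition] using h3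
  have hk : γ k + h k ∈ Metric.ball (γ k) δ := by
    have : ‖h‖ < δ := by simpa using hh
    simpa using (h.norm_coe_le_norm k).trans_lt this
  have := (convex_ball (γ k) δ).norm_image_sub_le_of_norm_hasFDerivWithin_le'
    (f := v) (f' := fderiv ℝ v) (φ := fderiv ℝ v (γ k)) (C := ε)
    (fun y _ => (hv.differentiable (by simp) y).hasFDerivAt.hasFDerivWithinAt) hbound
    (Metric.mem_ball_self hδ) hk
  rw [add_sub_cancel_left] at this
  refine le_trans (le_of_eq ?_) (this.trans (mul_le_mul_of_nonneg_left (h.norm_coe_le_norm k) hε.le))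
  rfl

/-- The induction uses that the derivative of a superposition operator is again a superposition
operator, followed by a continuous linear map. -/
theorem contDiff_superposition_nat (n : ℕ) {F : Type} [NormedAddCommGroup F] [NormedSpace ℝ F]
    {v : E → F} (hv : ContDiff ℝ n v) :
    ContDiff ℝ n (superposition hv.continuous : C(K, E) → C(K, F)) := by
  induction n generalizing F with
  | zero =>
    have : Continuous (superposition hv.continuous : C(K, E) → C(K, F)) :=
      ContinuousMap.continuous_postcomp _
    exact contDiff_zero.2 this
  | succ n ih =>
    have hv1 : ContDiff ℝ 1 v := hv.of_le (by exact_mod_cast Nat.le_add_left 1 n)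
    have hd : ContDiff ℝ n (fderiv ℝ v) := hv.fderiv_right (m := n) (by norm_cast)
    have hA : ContDiff ℝ n (pointwiseApply : C(K, E →L[ℝ] F) →L[ℝ] C(K, E) →L[ℝ] C(K, F)) :=
      ContinuousLinearMap.contDiff _
    refine contDiff_succ_iff_hasFDerivAt.2 ⟨fun γ => pointwiseApply (superposition hd.continuous γ),
      hA.comp (ih hd), fun γ => hasFDerivAt_superposition hv1 γ⟩

theorem contDiff_superposition {v : E → F} (hv : ContDiff ℝ ∞ v) :
    ContDiff ℝ ∞ (superposition hv.continuous : C(K, E) → C(K, F)) :=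
  contDiff_infty.2 fun n => contDiff_superposition_nat n (hv.of_le (by exact_mod_cast le_top))

end Superposition

section Flow

variable {E : Type} [NormedAddCommGroup E]

/-- A curve on `[0, 1]`, extended to the real line by constants. -/
noncomputable def extendCurve (γ : C(unitInterval, E)) (s : ℝ) : E :=
  γ (Set.projIcc 0 1 zero_le_one s)

theorem continuous_extendCurve (γ : C(unitInterval, E)) : Continuous (extendCurve γ) :=
  γ.continuous.comp continuous_projIcc

theorem extendCurve_of_mem (γ : C(unitInterval, E)) {s : ℝ} (hs : s ∈ Set.Icc (0 : ℝ) 1) :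
    extendCurve γ s = γ ⟨s, hs⟩ := by
  rw [extendCurve, Set.projIcc_of_mem]

variable [NormedSpace ℝ E]

/-- The constant curves, as a linear map. -/
noncomputable def constCurve : E →L[ℝ] C(unitInterval, E) :=
  LinearMap.mkContinuous
    { toFun := fun y => ContinuousMap.const unitInterval y
      map_add' := fun _ _ => rfl
      map_smul' := fun _ _ => rfl } 1
    (fun y => by
      rw [one_mul]
      exact (ContinuousMap.norm_le _ (norm_nonneg y)).2 fun _ => le_rfl)

/-- Integration `γ ↦ ∫₀ˢ γ` of curves on `[0, 1]`. -/
noncomputable def volterra : C(unitInterval, E) →L[ℝ] C(unitInterval, E) :=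
  LinearMap.mkContinuous
    { toFun := fun γ => ⟨fun s => ∫ r in (0 : ℝ)..s, extendCurve γ r,
        (intervalIntegral.continuous_primitive
          (fun a b => (continuous_extendCurve γ).intervalIntegrable a b) 0).comp
          continuous_subtype_val⟩
      map_add' := fun γ γ' => by
        ext s
        exact intervalIntegral.integral_add ((continuous_extendCurve γ).intervalIntegrable _ _)
          ((continuous_extendCurve γ').intervalIntegrable _ _)
      map_smul' := fun c γ => by
        ext s
        exact intervalIntegral.integral_smul c _ } 1
    (fun γ => by
      rw [one_mul, ContinuousMap.norm_le _ (norm_nonneg γ)]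
      intro s
      refine (intervalIntegral.norm_integral_le_of_norm_le_const
        (fun r _ => γ.norm_coe_le_norm _)).trans ?_
      rw [sub_zero, abs_of_nonneg s.2.1]
      exact mul_le_of_le_one_right (norm_nonneg _) s.2.2)

theorem norm_volterra_le (γ : C(unitInterval, E)) : ‖volterra γ‖ ≤ ‖γ‖ := by
  have := (volterra (E := E)).le_of_opNorm_le (LinearMap.mkContinuous_norm_le _ zero_le_one _) γ
  simpa using this

/-- Smooth functions have smooth primitives in a given direction `e`: the integral of `f` over the
segment from the hyperplane `φ = 0` to `y`, parametrised by `[0, 1]`, is a superposition operator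
followed by a continuous linear functional. -/
theorem exists_smooth_primitive [FiniteDimensional ℝ E] {f : E → ℝ} {U : Set E} {y₀ : E}
    (hU : IsOpen U) (hy₀ : y₀ ∈ U) (hf : ContDiffOn ℝ ∞ f U) {e : E} {φ : E →L[ℝ] ℝ}
    (he : φ e = 1) :
    ∃ Φ : E → ℝ, ContDiff ℝ ∞ Φ ∧ ∀ᶠ y in 𝓝 y₀, fderiv ℝ Φ y e = f y := by
  obtain ⟨g, hg, -, hgf⟩ := exists_contDiff_eventuallyEq hU hy₀ hf
  let dir : C(unitInterval, E) := ⟨fun s => -(1 - (s : ℝ)) • e, by fun_prop⟩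
  let c : E → C(unitInterval, E) := fun y => constCurve y + φ y • dir
  have hc : ContDiff ℝ ∞ c := constCurve.contDiff.add (φ.contDiff.smul contDiff_const)
  let ev : C(unitInterval, ℝ) →L[ℝ] ℝ := ContinuousMap.evalCLM ℝ (1 : unitInterval)
  have hI : ContDiff ℝ ∞ fun γ : C(unitInterval, ℝ) => ev (volterra γ) :=
    (ev.comp volterra).contDiff
  let Φ : E → ℝ := fun y => φ y * ev (volterra (superposition hg.continuous (c y)))
  have hΦ : ContDiff ℝ ∞ Φ :=
    φ.contDiff.mul (hI.comp ((contDiff_superposition hg).comp hc))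
  refine ⟨Φ, hΦ, hgf.mono fun y hy => ?_⟩
  rw [← hy]
  have key : ∀ τ : ℝ, Φ (y + τ • e) = ∫ σ in (0 : ℝ)..(φ y + τ), g (y - φ y • e + σ • e) := by
    intro τ
    have h1 : ev (volterra (superposition hg.continuous (c (y + τ • e)))) =
        ∫ s in (0 : ℝ)..1, g (y - φ y • e + ((φ y + τ) * s) • e) := by
      change ∫ s in (0 : ℝ)..((1 : unitInterval) : ℝ), _ = _
      refine intervalIntegral.integral_congr fun s hs => ?_
      have hs' : s ∈ Set.Icc (0 : ℝ) 1 := by simpa using hs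
      rw [extendCurve_of_mem _ hs']
      change g (y + τ • e + φ (y + τ • e) • (-(1 - s) • e)) = _
      congr 1
      simp only [map_add, map_smul, he, smul_eq_mul, mul_one]
      module
    change φ (y + τ • e) * _ = _
    rw [h1, ← smul_eq_mul]
    have h2 := intervalIntegral.smul_integral_comp_mul_left (a := 0) (b := 1)
      (fun σ : ℝ => g (y - φ y • e + σ • e)) (φ y + τ)
    rw [mul_zero, mul_one] at h2
    rw [← h2]
    simp [he]
  have hd1 : HasDerivAt (fun τ : ℝ => Φ (y + τ • e)) (fderiv ℝ Φ y e) 0 := by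
    have := (hΦ.differentiable (by simp) y).hasFDerivAt.hasLineDerivAt e
    exact this
  have hcont : Continuous fun σ : ℝ => g (y - φ y • e + σ • e) := by
    have := hg.continuous
    fun_prop
  have hd2 : HasDerivAt (fun τ : ℝ => Φ (y + τ • e)) (g y) 0 := by
    have h3 := (hcont.integral_hasStrictDerivAt 0 (φ y + 0)).hasDerivAt
    have h4 := h3.comp_const_add (φ y) 0
    simp only [add_zero, sub_add_cancel] at h4
    exact h4.congr_of_eventuallyEq (Filter.Eventually.of_forall key)
  exact hd1.unique hd2

set_option maxHeartbeats 1000000 in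
/-- The local flow of a globally Lipschitz smooth vector field. The rescaled equation
`γ = y + s ∫ v ∘ γ` for curves `γ` on `[0, 1]` is solved by the inverse function theorem, and the
flow is `φ (s, y) = γ 1`. -/
theorem exists_smooth_flow_of_lipschitz [CompleteSpace E] {v : E → E} (hv : ContDiff ℝ ∞ v)
    {K : NNReal} (hK : LipschitzWith K v) (y₀ : E) :
    ∃ (φ : ℝ × E → E) (δ : ℝ), 0 < δ ∧ ContDiffOn ℝ ∞ φ (Metric.ball (0, y₀) δ) ∧
      (∀ y, ((0 : ℝ), y) ∈ Metric.ball ((0 : ℝ), y₀) δ → φ (0, y) = y) ∧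
      ∀ s y, (s, y) ∈ Metric.ball ((0 : ℝ), y₀) δ →
        HasDerivAt (fun r => φ (r, y)) (v (φ (s, y))) s := by
  let N : C(unitInterval, E) → C(unitInterval, E) := superposition hv.continuous
  have hN : ContDiff ℝ ∞ N := contDiff_superposition hv
  have hvol : ContDiff ℝ ∞ fun γ : C(unitInterval, E) => volterra γ :=
    ContinuousLinearMap.contDiff _
  let Θ : (ℝ × E) × C(unitInterval, E) → (ℝ × E) × C(unitInterval, E) :=
    fun p => (p.1, p.2 - constCurve p.1.2 - p.1.1 • volterra (N p.2))
  have hΘ : ContDiff ℝ ∞ Θ := by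
    refine contDiff_fst.prodMk ((contDiff_snd.sub (constCurve.contDiff.comp contDiff_fst.snd)).sub
      (contDiff_fst.fst.smul (hvol.comp (hN.comp contDiff_snd))))
  let p₀ : (ℝ × E) × C(unitInterval, E) := ((0, y₀), constCurve y₀)
  let B : (ℝ × E) →L[ℝ] C(unitInterval, E) :=
    -(constCurve.comp (ContinuousLinearMap.snd ℝ ℝ E)) -
      (ContinuousLinearMap.fst ℝ ℝ E).smulRight (volterra (N (constCurve y₀)))
  let Θ' : ((ℝ × E) × C(unitInterval, E)) ≃L[ℝ] ((ℝ × E) × C(unitInterval, E)) :=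
    (ContinuousLinearEquiv.refl ℝ _).skewProd (ContinuousLinearEquiv.refl ℝ _) B
  have hΘ' : HasFDerivAt Θ (Θ' : _ →L[ℝ] _) p₀ := by
    have hV : DifferentiableAt ℝ
        (fun p : (ℝ × E) × C(unitInterval, E) => volterra (N p.2)) p₀ :=
      (hvol.comp (hN.comp contDiff_snd)).differentiable (by simp) p₀
    have h1 : HasFDerivAt (fun p : (ℝ × E) × C(unitInterval, E) => p.1.1)
        ((ContinuousLinearMap.fst ℝ ℝ E).comp (ContinuousLinearMap.fst ℝ _ _)) p₀ :=
      hasFDerivAt_fst.fst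
    have h2 := h1.smul hV.hasFDerivAt
    have h3 : HasFDerivAt (fun p : (ℝ × E) × C(unitInterval, E) => constCurve p.1.2)
        (constCurve.comp ((ContinuousLinearMap.snd ℝ ℝ E).comp (ContinuousLinearMap.fst ℝ _ _)))
        p₀ := (constCurve.comp ((ContinuousLinearMap.snd ℝ ℝ E).comp
          (ContinuousLinearMap.fst ℝ (ℝ × E) C(unitInterval, E)))).hasFDerivAt
    have h4 := hasFDerivAt_fst.prodMk ((hasFDerivAt_snd.sub h3).sub h2)
    refine h4.congr_fderiv ?_
    ext q <;> simp [Θ', B, p₀]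
  obtain ⟨e, he₀, -, heΘ, hes⟩ := exists_local_smooth_inverse isOpen_univ (Set.mem_univ p₀)
    hΘ.contDiffOn Θ' hΘ'
  have hΘp₀ : Θ p₀ = ((0, y₀), 0) := by simp [Θ, p₀]
  have ht₀ : (((0 : ℝ), y₀), (0 : C(unitInterval, E))) ∈ e.target := by
    rw [← hΘp₀, ← heΘ]
    exact e.map_source he₀
  have hopen : IsOpen {a : ℝ × E | (a, (0 : C(unitInterval, E))) ∈ e.target} :=
    e.open_target.preimage (by fun_prop)
  obtain ⟨δ₀, hδ₀, hball⟩ := Metric.isOpen_iff.1 hopen _ ht₀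
  let γ : ℝ × E → C(unitInterval, E) := fun a => (e.symm (a, 0)).2
  -- the integral equation satisfied by the local inverse
  have hγ : ∀ a ∈ Metric.ball ((0 : ℝ), y₀) δ₀,
      γ a = constCurve a.2 + a.1 • volterra (N (γ a)) := by
    intro a ha
    have h1 := e.right_inv (hball ha)
    rw [heΘ] at h1
    have h2 : (e.symm (a, 0)).1 = a := congrArg Prod.fst h1
    have h3 : γ a - constCurve (e.symm (a, 0)).1.2
      - (e.symm (a, 0)).1.1 • volterra (N (γ a)) = 0 := congrArg Prod.snd h1
    rw [h2, sub_sub, sub_eq_zero] at h3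
    exact h3
  have hγs : ContDiffOn ℝ ∞ γ (Metric.ball (0, y₀) δ₀) :=
    contDiff_snd.comp_contDiffOn
      (hes.comp (contDiff_id.prodMk contDiff_const).contDiffOn fun a ha => hball ha)
  let φ : ℝ × E → E := fun a => γ a 1
  let δ : ℝ := min δ₀ (1 / (K + 1))
  have hδ : 0 < δ := lt_min hδ₀ (by positivity)
  have hsub : Metric.ball ((0 : ℝ), y₀) δ ⊆ Metric.ball (0, y₀) δ₀ :=
    Metric.ball_subset_ball (min_le_left _ _)
  have hφs : ContDiffOn ℝ ∞ φ (Metric.ball (0, y₀) δ) :=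
    ((ContinuousLinearMap.contDiff
      (ContinuousMap.evalCLM ℝ (1 : unitInterval) : C(unitInterval, E) →L[ℝ] E)).comp_contDiffOn
        hγs).mono hsub
  have hmem : ∀ {s : ℝ} {y : E}, (s, y) ∈ Metric.ball ((0 : ℝ), y₀) δ ↔ |s| < δ ∧ dist y y₀ < δ := by
    intro s y
    simp [Prod.dist_eq]
  -- the integral equation has at most one solution
  have huniq : ∀ (s : ℝ) (y : E) (γ₁ γ₂ : C(unitInterval, E)), |s| < δ →
      γ₁ = constCurve y + s • volterra (N γ₁) → γ₂ = constCurve y + s • volterra (N γ₂) →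
      γ₁ = γ₂ := by
    intro s y γ₁ γ₂ hs h1 h2
    have h3 : γ₁ - γ₂ = s • volterra (N γ₁ - N γ₂) := by
      rw [map_sub, smul_sub]
      nth_rewrite 1 [h1]
      nth_rewrite 1 [h2]
      abel
    have h4 : ‖N γ₁ - N γ₂‖ ≤ K * ‖γ₁ - γ₂‖ := by
      rw [ContinuousMap.norm_le _ (by positivity)]
      intro k
      have := hK.dist_le_mul (γ₁ k) (γ₂ k)
      rw [dist_eq_norm, dist_eq_norm] at this
      exact this.trans (mul_le_mul_of_nonneg_left ((γ₁ - γ₂).norm_coe_le_norm k) K.2)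
    have h5 : ‖γ₁ - γ₂‖ ≤ |s| * (K * ‖γ₁ - γ₂‖) := by
      nth_rewrite 1 [h3]
      rw [norm_smul, Real.norm_eq_abs]
      exact mul_le_mul_of_nonneg_left ((norm_volterra_le _).trans h4) (abs_nonneg s)
    have h6 : |s| * K < 1 := by
      have h7 : |s| < 1 / (K + 1) := hs.trans_le (min_le_right _ _)
      rw [lt_div_iff₀ (by positivity)] at h7
      nlinarith [abs_nonneg s, K.2]
    have h8 : ‖γ₁ - γ₂‖ = 0 := by
      by_contra hne
      have : 0 < ‖γ₁ - γ₂‖ := lt_of_le_of_ne (norm_nonneg _) (Ne.symm hne)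
      nlinarith
    exact sub_eq_zero.1 (norm_eq_zero.1 h8)
  have hγint : ∀ a ∈ Metric.ball ((0 : ℝ), y₀) δ, ∀ τ : unitInterval,
      γ a τ = a.2 + a.1 • ∫ r in (0 : ℝ)..τ, v (extendCurve (γ a) r) := by
    intro a ha τ
    nth_rewrite 1 [hγ a (hsub ha)]
    rfl
  -- rescaling of the time variable
  have hscale : ∀ s y, (s, y) ∈ Metric.ball ((0 : ℝ), y₀) δ → ∀ τ : unitInterval,
      φ (s * τ, y) = γ (s, y) τ := by
    intro s y hsy τ
    obtain ⟨hs, hy⟩ := hmem.1 hsy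
    have hsτ : |s * τ| < δ := by
      rw [abs_mul, abs_of_nonneg τ.2.1]
      exact (mul_le_of_le_one_right (abs_nonneg s) τ.2.2).trans_lt hs
    have hτy : (s * τ, y) ∈ Metric.ball ((0 : ℝ), y₀) δ := hmem.2 ⟨hsτ, hy⟩
    let γ₁ : C(unitInterval, E) := ⟨fun σ => γ (s, y) (τ * σ), by fun_prop⟩
    have h1 : γ₁ = constCurve y + (s * τ) • volterra (N γ₁) := by
      ext σ
      have h2 := hγint (s, y) hsy (τ * σ)
      change γ (s, y) (τ * σ) = y + (s * τ) • ∫ r in (0 : ℝ)..σ, v (extendCurve γ₁ r)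
      rw [h2, mul_smul]
      congr 2
      have h3 := intervalIntegral.smul_integral_comp_mul_left (a := 0) (b := (σ : ℝ))
        (fun r => v (extendCurve (γ (s, y)) r)) (τ : ℝ)
      rw [mul_zero] at h3
      rw [Set.Icc.coe_mul, ← h3]
      congr 1
      refine intervalIntegral.integral_congr fun r hr => ?_
      have hr' : r ∈ Set.Icc (0 : ℝ) 1 := by
        rw [Set.uIcc_of_le σ.2.1] at hr
        exact ⟨hr.1, hr.2.trans σ.2.2⟩
      have hτr : (τ : ℝ) * r ∈ Set.Icc (0 : ℝ) 1 :=
        ⟨mul_nonneg τ.2.1 hr'.1, mul_le_one₀ τ.2.2 hr'.1 hr'.2⟩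
      rw [extendCurve_of_mem _ hr', extendCurve_of_mem _ hτr]
      rfl
    have h4 := huniq _ _ _ _ hsτ h1 (hγ _ (hsub hτy))
    change γ (s * τ, y) 1 = _
    rw [← h4]
    change γ (s, y) (τ * 1) = _
    rw [mul_one]
  have hint : ∀ s y, (s, y) ∈ Metric.ball ((0 : ℝ), y₀) δ →
      φ (s, y) = y + ∫ r in (0 : ℝ)..s, v (φ (r, y)) := by
    intro s y hsy
    have h1 := hγint (s, y) hsy 1
    change φ (s, y) = _ at h1
    rw [h1]
    congr 1
    have h3 := intervalIntegral.smul_integral_comp_mul_left (a := 0) (b := 1)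
        (fun r => v (φ (r, y))) s
    rw [mul_zero, mul_one] at h3
    rw [← h3]
    congr 1
    refine intervalIntegral.integral_congr fun r hr => ?_
    have hr' : r ∈ Set.Icc (0 : ℝ) 1 := by
      simpa using hr
    rw [extendCurve_of_mem _ hr', ← hscale s y hsy ⟨r, hr'⟩]
  refine ⟨φ, δ, hδ, hφs, fun y hy => ?_, fun s y hsy => ?_⟩
  · rw [hint 0 y hy, intervalIntegral.integral_same, add_zero]
  · obtain ⟨hs, hy⟩ := hmem.1 hsy
    have hon : ContinuousOn (fun r => v (φ (r, y))) (Set.Ioo (-δ) δ) := by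
      refine hv.continuous.comp_continuousOn (hφs.continuousOn.comp (by fun_prop) ?_)
      intro r hr
      exact hmem.2 ⟨abs_lt.2 hr, hy⟩
    have hsI : s ∈ Set.Ioo (-δ) δ := abs_lt.1 hs
    have hsub' : Set.uIcc 0 s ⊆ Set.Ioo (-δ) δ :=
      Set.ordConnected_Ioo.uIcc_subset ⟨by linarith, hδ⟩ hsI
    have h1 := intervalIntegral.integral_hasDerivAt_right
      ((hon.mono hsub').intervalIntegrable)
      (hon.stronglyMeasurableAtFilter isOpen_Ioo s hsI) (hon.continuousAt (isOpen_Ioo.mem_nhds hsI))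
    refine (h1.const_add y).congr_of_eventuallyEq ?_
    filter_upwards [isOpen_Ioo.mem_nhds hsI] with r hr
    exact hint r y (hmem.2 ⟨abs_lt.2 hr, hy⟩)

/-- The local flow of a smooth vector field is smooth jointly in time and initial value. The time
is moved into the equation by rescaling (`y' = s v(y)` on `[0, 1]`), so that the flow solves an
equation in the Banach space of curves to which the inverse function theorem applies. -/
theorem exists_smooth_flow [FiniteDimensional ℝ E] {v : E → E} {U : Set E} {y₀ : E}
    (hU : IsOpen U) (hy₀ : y₀ ∈ U) (hv : ContDiffOn ℝ ∞ v U) :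
    ∃ (φ : ℝ × E → E) (W : Set (ℝ × E)), IsOpen W ∧ (0, y₀) ∈ W ∧ ContDiffOn ℝ ∞ φ W ∧
      (∀ a ∈ W, φ a ∈ U) ∧ (∀ y, (0, y) ∈ W → φ (0, y) = y) ∧
      ∀ s y, (s, y) ∈ W → HasDerivAt (fun r => φ (r, y)) (v (φ (s, y))) s := by
  have : CompleteSpace E := FiniteDimensional.complete ℝ E
  obtain ⟨v₁, hv₁, hsupp, hEq⟩ := exists_contDiff_eventuallyEq hU hy₀ hv
  obtain ⟨K, hK⟩ := hv₁.lipschitzWith_of_hasCompactSupport hsupp (by simp)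
  obtain ⟨φ, δ, hδ, hφ, h0, hd⟩ := exists_smooth_flow_of_lipschitz hv₁ hK y₀
  obtain ⟨U', hU'sub, hU', hy₀'⟩ := mem_nhds_iff.1 (Filter.inter_mem hEq (hU.mem_nhds hy₀))
  have hbase : ((0 : ℝ), y₀) ∈ Metric.ball ((0 : ℝ), y₀) δ := Metric.mem_ball_self hδ
  refine ⟨φ, Metric.ball (0, y₀) δ ∩ φ ⁻¹' U',
    hφ.continuousOn.isOpen_inter_preimage Metric.isOpen_ball hU', ⟨hbase, ?_⟩,
    hφ.mono Set.inter_subset_left, fun a ha => (hU'sub ha.2).2, fun y hy => h0 y hy.1,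
    fun s y hsy => ?_⟩
  · change φ (0, y₀) ∈ U'
    rwa [h0 _ hbase]
  · have h1 : v₁ (φ (s, y)) = v (φ (s, y)) := (hU'sub hsy.2).1
    rw [← h1]
    exact hd s y hsy.1

end Flow

/-! ### Calculus of smooth functions on the jet space -/

/-- Jets of order less than `n` in each variable. -/
abbrev FinJet (n : ℕ) := ℝ × ℝ × (Fin n → Fin n → ℝ)

section SmoothAt

variable {E F : Type*} [NormedAddCommGroup E] [NormedSpace ℝ E] [NormedAddCommGroup F]
  [NormedSpace ℝ F]

/-- The function `f` is, near `z`, a smooth function `g` of the jet coordinates of order less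
than `n`. -/
def RepAt (n : ℕ) (g : FinJet n → E) (f : Jet → E) (z : Jet) : Prop :=
  ∃ W : Set (FinJet n), IsOpen W ∧ trunc n z ∈ W ∧ ContDiffOn ℝ ∞ g W ∧
    ∀ w, trunc n w ∈ W → f w = g (trunc n w)

/-- Vector-valued functions which near `z` depend smoothly on finitely many jet coordinates. -/
def SmoothAt (f : Jet → E) (z : Jet) : Prop :=
  ∃ (n : ℕ) (g : FinJet n → E), RepAt n g f z

theorem SmoothOn.smoothAt {f : Jet → ℝ} {D : Set Jet} (hf : SmoothOn f D) {z : Jet} (hz : z ∈ D) :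
    SmoothAt f z := hf z hz

/-- Truncation as a continuous linear map. -/
noncomputable def truncCLM (n : ℕ) : Jet →L[ℝ] FinJet n where
  toLinearMap := truncLin n
  cont := by
    change Continuous (trunc n)
    unfold trunc
    fun_prop

theorem continuous_trunc (n : ℕ) : Continuous (trunc n) := (truncCLM n).continuous

theorem trunc_add (n : ℕ) (z w : Jet) : trunc n (z + w) = trunc n z + trunc n w := rfl

theorem trunc_smul (n : ℕ) (c : ℝ) (z : Jet) : trunc n (c • z) = c • trunc n z := rfl

/-- The neighbourhoods of a jet are generated by the finite-order neighbourhoods. -/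
theorem nhds_jet (z : Jet) : 𝓝 z = ⨅ n, Filter.comap (trunc n) (𝓝 (trunc n z)) := by
  refine le_antisymm (le_iInf fun n => (continuous_trunc n).continuousAt.tendsto.le_comap) ?_
  have hn : ∀ n, Filter.Tendsto (trunc n)
      (⨅ n, Filter.comap (trunc n) (𝓝 (trunc n z))) (𝓝 (trunc n z)) :=
    fun n => Filter.tendsto_iff_comap.2 (iInf_le _ n)
  change Filter.Tendsto id _ (𝓝 z)
  refine Prod.tendsto_iff _ _ |>.2 ⟨?_, Prod.tendsto_iff _ _ |>.2 ⟨?_, ?_⟩⟩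
  · exact (continuous_fst.tendsto (trunc 0 z)).comp (hn 0)
  · exact ((continuous_fst.comp continuous_snd).tendsto (trunc 0 z)).comp (hn 0)
  · refine tendsto_pi_nhds.2 fun i => tendsto_pi_nhds.2 fun j => ?_
    have hc : Continuous fun y : FinJet (max i j + 1) =>
        y.2.2 ⟨i, by omega⟩ ⟨j, by omega⟩ := by fun_prop
    exact (hc.tendsto _).comp (hn (max i j + 1))

/-- The box of jets whose coordinates of order less than `n` are `r`-close to those of `z`. -/
def box (n : ℕ) (z : Jet) (r : ℝ) : Set Jet := trunc n ⁻¹' Metric.ball (trunc n z) r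

theorem isOpen_box (n : ℕ) (z : Jet) (r : ℝ) : IsOpen (box n z r) :=
  Metric.isOpen_ball.preimage (continuous_trunc n)

theorem mem_box_self (n : ℕ) (z : Jet) {r : ℝ} (hr : 0 < r) : z ∈ box n z r :=
  Metric.mem_ball_self hr

theorem mem_box {n : ℕ} {z w : Jet} {r : ℝ} (hr : 0 < r) :
    w ∈ box n z r ↔ |w.1 - z.1| < r ∧ |w.2.1 - z.2.1| < r ∧
      ∀ i < n, ∀ j < n, |w.2.2 i j - z.2.2 i j| < r := by
  simp only [box, Set.mem_preimage, Metric.mem_ball, Prod.dist_eq, max_lt_iff, dist_pi_lt_iff hr,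
    Real.dist_eq, trunc, Fin.forall_iff]

theorem box_anti {n m : ℕ} (h : n ≤ m) (z : Jet) {r : ℝ} (hr : 0 < r) : box m z r ⊆ box n z r := by
  intro w hw
  rw [mem_box hr] at hw ⊢
  exact ⟨hw.1, hw.2.1, fun i hi j hj => hw.2.2 i (hi.trans_le h) j (hj.trans_le h)⟩

theorem convex_box (n : ℕ) (z : Jet) (r : ℝ) : Convex ℝ (box n z r) :=
  (convex_ball _ _).linear_preimage (truncLin n)

theorem exists_box_subset {D : Set Jet} {z : Jet} (hD : D ∈ 𝓝 z) :
    ∃ (n : ℕ) (r : ℝ), 0 < r ∧ box n z r ⊆ D := by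
  have hdir : Directed (· ≥ ·) fun n => Filter.comap (trunc n) (𝓝 (trunc n z)) := by
    have hle : ∀ n m, n ≤ m → Filter.comap (trunc m) (𝓝 (trunc m z)) ≤
        Filter.comap (trunc n) (𝓝 (trunc n z)) := by
      intro n m h
      refine Filter.tendsto_iff_comap.1 ?_
      let p : FinJet m → FinJet n :=
        fun y => (y.1, y.2.1, fun i j => y.2.2 (Fin.castLE h i) (Fin.castLE h j))
      have hp : Continuous p := by fun_prop
      exact (hp.tendsto (trunc m z)).comp Filter.tendsto_comap
    intro n m
    exact ⟨max n m, hle _ _ (le_max_left _ _), hle _ _ (le_max_right _ _)⟩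
  rw [nhds_jet, Filter.mem_iInf_of_directed hdir] at hD
  obtain ⟨n, s, hs, hsD⟩ := hD
  obtain ⟨r, hr, hrs⟩ := Metric.mem_nhds_iff.1 hs
  exact ⟨n, r, hr, fun w hw => hsD (hrs hw)⟩

theorem RepAt.raise {n m : ℕ} (hnm : n ≤ m) {g : FinJet n → E} {f : Jet → E} {z : Jet}
    (h : RepAt n g f z) :
    RepAt m (fun y => g (y.1, y.2.1, fun i j => y.2.2 (Fin.castLE hnm i) (Fin.castLE hnm j)))
      f z := by
  obtain ⟨W, hW, hz, hg, hfg⟩ := h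
  let p : FinJet m → FinJet n :=
    fun y => (y.1, y.2.1, fun i j => y.2.2 (Fin.castLE hnm i) (Fin.castLE hnm j))
  have hp : ContDiff ℝ ∞ p := by fun_prop
  exact ⟨p ⁻¹' W, hW.preimage hp.continuous, hz, hg.comp hp.contDiffOn fun y hy => hy,
    fun w hw => hfg w hw⟩

theorem RepAt.eventually {n : ℕ} {g : FinJet n → E} {f : Jet → E} {z : Jet} (h : RepAt n g f z) :
    ∀ᶠ w in 𝓝 z, RepAt n g f w ∧ f w = g (trunc n w) := by
  obtain ⟨W, hW, hz, hg, hfg⟩ := h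
  filter_upwards [(hW.preimage (continuous_trunc n)).mem_nhds hz] with w hw
  exact ⟨⟨W, hW, hw, hg, hfg⟩, hfg w hw⟩

theorem RepAt.contDiffAt {n : ℕ} {g : FinJet n → E} {f : Jet → E} {z : Jet} (h : RepAt n g f z) :
    ContDiffAt ℝ ∞ g (trunc n z) := by
  obtain ⟨W, hW, hz, hg, -⟩ := h
  exact hg.contDiffAt (hW.mem_nhds hz)

theorem SmoothAt.eventually {f : Jet → E} {z : Jet} (h : SmoothAt f z) :
    ∀ᶠ w in 𝓝 z, SmoothAt f w := by
  obtain ⟨n, g, h⟩ := h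
  exact h.eventually.mono fun w hw => ⟨n, g, hw.1⟩

theorem SmoothAt.continuousAt {f : Jet → E} {z : Jet} (h : SmoothAt f z) : ContinuousAt f z := by
  obtain ⟨n, g, h⟩ := h
  have h1 : ContinuousAt (fun w => g (trunc n w)) z :=
    ContinuousAt.comp (g := g) h.contDiffAt.continuousAt (continuous_trunc n).continuousAt
  exact h1.congr (h.eventually.mono fun w hw => hw.2.symm)

theorem SmoothAt.congr {f f' : Jet → E} {z : Jet} (h : SmoothAt f z) (hff' : f' =ᶠ[𝓝 z] f) :
    SmoothAt f' z := by
  obtain ⟨n, g, h⟩ := h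
  obtain ⟨m, r, hr, hsub⟩ := exists_box_subset hff'
  obtain ⟨W, hW, hz, hg, hfg⟩ := h.raise (le_max_left n m)
  refine ⟨max n m, _, W ∩ Metric.ball (trunc (max n m) z) r, hW.inter Metric.isOpen_ball,
    ⟨hz, Metric.mem_ball_self hr⟩, hg.mono Set.inter_subset_left, fun w hw => ?_⟩
  exact (hsub (box_anti (le_max_right n m) z hr hw.2)).trans (hfg w hw.1)

theorem smoothAt_trunc_comp {n : ℕ} {g : FinJet n → E} {z : Jet} {W : Set (FinJet n)}
    (hW : IsOpen W) (hz : trunc n z ∈ W) (hg : ContDiffOn ℝ ∞ g W) :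
    SmoothAt (fun w => g (trunc n w)) z :=
  ⟨n, g, W, hW, hz, hg, fun _ _ => rfl⟩

theorem SmoothAt.prodMk {f : Jet → E} {f' : Jet → F} {z : Jet} (h : SmoothAt f z)
    (h' : SmoothAt f' z) : SmoothAt (fun w => (f w, f' w)) z := by
  obtain ⟨n, g, h⟩ := h
  obtain ⟨m, g', h'⟩ := h'
  obtain ⟨W, hW, hz, hg, hfg⟩ := h.raise (le_max_left n m)
  obtain ⟨W', hW', hz', hg', hfg'⟩ := h'.raise (le_max_right n m)
  refine ⟨max n m, _, W ∩ W', hW.inter hW', ⟨hz, hz'⟩,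
    (hg.mono Set.inter_subset_left).prodMk (hg'.mono Set.inter_subset_right), fun w hw => ?_⟩
  exact Prod.ext (hfg w hw.1) (hfg' w hw.2)

theorem smoothAt_pi {ι : Type*} [Fintype ι] {f : Jet → ι → E} {z : Jet}
    (h : ∀ i, SmoothAt (fun w => f w i) z) : SmoothAt f z := by
  choose n g h using h
  have hle : ∀ i, n i ≤ Finset.univ.sup n := fun i => Finset.le_sup (Finset.mem_univ i)
  have h' := fun i => (h i).raise (hle i)
  choose W hW hz hg hfg using h'
  refine ⟨Finset.univ.sup n, _, ⋂ i, W i, isOpen_iInter_of_finite hW, Set.mem_iInter.2 hz,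
    contDiffOn_pi.2 fun i => (hg i).mono (Set.iInter_subset _ i), fun w hw => ?_⟩
  ext i
  exact hfg i w (Set.mem_iInter.1 hw i)

/-- A smooth function of a smooth function is smooth. -/
theorem SmoothAt.comp {f : Jet → E} {g : E → F} {U : Set E} {z : Jet} (hU : IsOpen U)
    (hz : f z ∈ U) (hg : ContDiffOn ℝ ∞ g U) (h : SmoothAt f z) :
    SmoothAt (fun w => g (f w)) z := by
  obtain ⟨n, p, W, hW, hzW, hp, hfp⟩ := h
  refine ⟨n, g ∘ p, W ∩ p ⁻¹' U, hp.continuousOn.isOpen_inter_preimage hW hU, ⟨hzW, ?_⟩,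
    hg.comp (hp.mono Set.inter_subset_left) fun y hy => hy.2, fun w hw => ?_⟩
  · rw [Set.mem_preimage, ← hfp z hzW]
    exact hz
  · exact congrArg g (hfp w hw.1)

theorem SmoothAt.comp_contDiff {f : Jet → E} {g : E → F} {z : Jet} (hg : ContDiff ℝ ∞ g)
    (h : SmoothAt f z) : SmoothAt (fun w => g (f w)) z :=
  SmoothAt.comp isOpen_univ trivial hg.contDiffOn h

theorem smoothAt_const (c : E) (z : Jet) : SmoothAt (fun _ => c) z :=
  ⟨0, fun _ => c, Set.univ, isOpen_univ, trivial, contDiffOn_const, fun _ _ => rfl⟩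

theorem smoothAt_t (z : Jet) : SmoothAt (fun w => w.1) z :=
  ⟨0, fun y => y.1, Set.univ, isOpen_univ, trivial, contDiffOn_fst, fun _ _ => rfl⟩

theorem smoothAt_x (z : Jet) : SmoothAt (fun w => w.2.1) z :=
  ⟨0, fun y => y.2.1, Set.univ, isOpen_univ, trivial, by fun_prop, fun _ _ => rfl⟩

theorem smoothAt_u (i j : ℕ) (z : Jet) : SmoothAt (fun w => w.2.2 i j) z :=
  ⟨max i j + 1, fun y => y.2.2 ⟨i, by omega⟩ ⟨j, by omega⟩, Set.univ, isOpen_univ, trivial,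
    by fun_prop, fun _ _ => rfl⟩

theorem SmoothAt.add {f f' : Jet → E} {z : Jet} (h : SmoothAt f z) (h' : SmoothAt f' z) :
    SmoothAt (fun w => f w + f' w) z :=
  SmoothAt.comp_contDiff (contDiff_fst.add contDiff_snd) (h.prodMk h')

theorem SmoothAt.sub {f f' : Jet → E} {z : Jet} (h : SmoothAt f z) (h' : SmoothAt f' z) :
    SmoothAt (fun w => f w - f' w) z :=
  SmoothAt.comp_contDiff (contDiff_fst.sub contDiff_snd) (h.prodMk h')

theorem SmoothAt.neg {f : Jet → E} {z : Jet} (h : SmoothAt f z) : SmoothAt (fun w => -f w) z :=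
  SmoothAt.comp_contDiff contDiff_neg h

theorem SmoothAt.mul {f f' : Jet → ℝ} {z : Jet} (h : SmoothAt f z) (h' : SmoothAt f' z) :
    SmoothAt (fun w => f w * f' w) z :=
  SmoothAt.comp_contDiff (contDiff_fst.mul contDiff_snd) (h.prodMk h')

theorem smoothAt_toJ1 (z : Jet) : SmoothAt toJ1 z :=
  (smoothAt_t z).prodMk ((smoothAt_x z).prodMk ((smoothAt_u 0 0 z).prodMk (smoothAt_u 0 1 z)))

theorem smoothAt_toJ2 (z : Jet) : SmoothAt toJ2 z :=
  (smoothAt_t z).prodMk ((smoothAt_x z).prodMk ((smoothAt_u 0 0 z).prodMk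
    ((smoothAt_u 0 1 z).prodMk (smoothAt_u 0 2 z))))

/-! ### Directional derivatives along smooth fields -/

/-- Smoothness near `z` of all components of a map (or vector field) on the jet space. -/
def SmoothField (a : Jet → Jet) (z : Jet) : Prop :=
  SmoothAt (fun w => (a w).1) z ∧ SmoothAt (fun w => (a w).2.1) z ∧
    ∀ i j, SmoothAt (fun w => (a w).2.2 i j) z

theorem SmoothField.trunc {a : Jet → Jet} {z : Jet} (ha : SmoothField a z) (n : ℕ) :
    SmoothAt (fun w => trunc n (a w)) z :=
  ha.1.prodMk (ha.2.1.prodMk (smoothAt_pi fun i => smoothAt_pi fun j => ha.2.2 i j))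

theorem smoothField_const (v : Jet) (z : Jet) : SmoothField (fun _ => v) z :=
  ⟨smoothAt_const _ z, smoothAt_const _ z, fun _ _ => smoothAt_const _ z⟩

theorem smoothField_vecX (z : Jet) : SmoothField vecX z :=
  ⟨smoothAt_const _ z, smoothAt_const _ z, fun i j => smoothAt_u i (j + 1) z⟩

theorem smoothField_vecT (z : Jet) : SmoothField vecT z :=
  ⟨smoothAt_const _ z, smoothAt_const _ z, fun i j => smoothAt_u (i + 1) j z⟩

/-- A map with smooth components is continuous. -/
theorem SmoothField.continuousAt {a : Jet → Jet} {z : Jet} (ha : SmoothField a z) :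
    ContinuousAt a z := by
  refine ha.1.continuousAt.prodMk (ha.2.1.continuousAt.prodMk ?_)
  exact continuousAt_pi.2 fun i => continuousAt_pi.2 fun j => (ha.2.2 i j).continuousAt

theorem SmoothAt.comp_field {f : Jet → E} {a : Jet → Jet} {z : Jet} (hf : SmoothAt f (a z))
    (ha : SmoothField a z) : SmoothAt (fun w => f (a w)) z := by
  obtain ⟨n, g, W, hW, hz, hg, hfg⟩ := hf
  refine (SmoothAt.comp (f := fun w => EvolCL.trunc n (a w)) hW hz hg (ha.trunc n)).congr ?_
  filter_upwards [ha.continuousAt.preimage_mem_nhds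
    ((hW.preimage (continuous_trunc n)).mem_nhds hz)] with w hw
  exact hfg _ hw

/-- The derivative of a smooth function along a curve with differentiable components. -/
theorem RepAt.hasDerivAt {n : ℕ} {g : FinJet n → E} {f : Jet → E} {c : ℝ → Jet} {s₀ : ℝ}
    (h : RepAt n g f (c s₀)) {v : FinJet n} (hc : HasDerivAt (fun s => trunc n (c s)) v s₀) :
    HasDerivAt (fun s => f (c s)) (fderiv ℝ g (trunc n (c s₀)) v) s₀ := by
  have h1 : HasFDerivAt g (fderiv ℝ g (trunc n (c s₀))) (trunc n (c s₀)) :=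
    (h.contDiffAt.differentiableAt (by simp)).hasFDerivAt
  have h2 := h1.comp_hasDerivAt s₀ hc
  obtain ⟨W, hW, hz, hg, hfg⟩ := h
  refine h2.congr_of_eventuallyEq ?_
  filter_upwards [hc.continuousAt.preimage_mem_nhds (hW.mem_nhds hz)] with s hs
  exact hfg _ hs

theorem hasDerivAt_trunc_line (n : ℕ) (z v : Jet) :
    HasDerivAt (fun s : ℝ => trunc n (z + s • v)) (trunc n v) 0 := by
  have h : HasDerivAt (fun s : ℝ => trunc n z + s • trunc n v) ((1 : ℝ) • trunc n v) 0 :=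
    ((hasDerivAt_id (0 : ℝ)).smul_const (trunc n v)).const_add (trunc n z)
  rw [one_smul] at h
  exact h

theorem RepAt.lineDeriv_eq {n : ℕ} {g : FinJet n → E} {f : Jet → E} {z : Jet} (h : RepAt n g f z)
    (v : Jet) : lineDeriv ℝ f z v = fderiv ℝ g (trunc n z) (trunc n v) := by
  have h' : RepAt n g f (z + (0 : ℝ) • v) := by simpa using h
  have := (h'.hasDerivAt (c := fun s => z + s • v) (hasDerivAt_trunc_line n z v)).deriv
  simpa [lineDeriv] using this

theorem SmoothAt.hasDerivAt_line {f : Jet → E} {z : Jet} (h : SmoothAt f z) (v : Jet) :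
    HasDerivAt (fun s : ℝ => f (z + s • v)) (lineDeriv ℝ f z v) 0 := by
  obtain ⟨n, g, h⟩ := h
  have h' : RepAt n g f (z + (0 : ℝ) • v) := by simpa using h
  have := h'.hasDerivAt (c := fun s => z + s • v) (hasDerivAt_trunc_line n z v)
  rw [h.lineDeriv_eq]
  simpa using this

theorem lineDeriv_eq_of_hasDerivAt {f : Jet → E} {z v : Jet} {f' : E}
    (h : HasDerivAt (fun s : ℝ => f (z + s • v)) f' 0) : lineDeriv ℝ f z v = f' := h.deriv

theorem lineDeriv_congr {f f' : Jet → E} {z : Jet} (h : f =ᶠ[𝓝 z] f') (v : Jet) :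
    lineDeriv ℝ f z v = lineDeriv ℝ f' z v := by
  have hc : Continuous fun s : ℝ => z + s • v := by fun_prop
  have h0 : Filter.Tendsto (fun s : ℝ => z + s • v) (𝓝 0) (𝓝 z) := by
    simpa using hc.tendsto 0
  have h1 : (fun s : ℝ => f (z + s • v)) =ᶠ[𝓝 0] fun s => f' (z + s • v) := h0.eventually h
  exact h1.deriv_eq

theorem SmoothAt.lineDeriv_add {f f' : Jet → E} {z : Jet} (h : SmoothAt f z) (h' : SmoothAt f' z)
    (v : Jet) :
    lineDeriv ℝ (fun w => f w + f' w) z v = lineDeriv ℝ f z v + lineDeriv ℝ f' z v :=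
  lineDeriv_eq_of_hasDerivAt ((h.hasDerivAt_line v).add (h'.hasDerivAt_line v))

theorem SmoothAt.lineDeriv_sub {f f' : Jet → E} {z : Jet} (h : SmoothAt f z) (h' : SmoothAt f' z)
    (v : Jet) :
    lineDeriv ℝ (fun w => f w - f' w) z v = lineDeriv ℝ f z v - lineDeriv ℝ f' z v :=
  lineDeriv_eq_of_hasDerivAt ((h.hasDerivAt_line v).sub (h'.hasDerivAt_line v))

theorem lineDeriv_fun_neg {f : Jet → E} {z v : Jet} :
    lineDeriv ℝ (fun w => -f w) z v = -lineDeriv ℝ f z v :=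
  deriv.fun_neg

theorem SmoothAt.lineDeriv_mul {f f' : Jet → ℝ} {z : Jet} (h : SmoothAt f z) (h' : SmoothAt f' z)
    (v : Jet) :
    lineDeriv ℝ (fun w => f w * f' w) z v =
      lineDeriv ℝ f z v * f' z + f z * lineDeriv ℝ f' z v := by
  have := (h.hasDerivAt_line v).mul (h'.hasDerivAt_line v)
  simp only [zero_smul, add_zero] at this
  exact lineDeriv_eq_of_hasDerivAt this

theorem lineDeriv_fun_const (c : E) (z v : Jet) : lineDeriv ℝ (fun _ : Jet => c) z v = 0 :=
  deriv_const _ _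

theorem SmoothAt.lineDeriv_comp {f : Jet → E} {g : E → F} {z : Jet} (h : SmoothAt f z)
    (hg : DifferentiableAt ℝ g (f z)) (v : Jet) :
    lineDeriv ℝ (fun w => g (f w)) z v = fderiv ℝ g (f z) (lineDeriv ℝ f z v) := by
  refine lineDeriv_eq_of_hasDerivAt ?_
  have h1 : HasFDerivAt g (fderiv ℝ g (f z)) (f (z + (0 : ℝ) • v)) := by
    simpa using hg.hasFDerivAt
  exact h1.comp_hasDerivAt (0 : ℝ) (h.hasDerivAt_line v)

theorem lineDeriv_t (z v : Jet) : lineDeriv ℝ (fun w : Jet => w.1) z v = v.1 := by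
  refine lineDeriv_eq_of_hasDerivAt ?_
  simpa using ((hasDerivAt_id (0 : ℝ)).mul_const v.1).const_add z.1

theorem lineDeriv_x (z v : Jet) : lineDeriv ℝ (fun w : Jet => w.2.1) z v = v.2.1 := by
  refine lineDeriv_eq_of_hasDerivAt ?_
  simpa using ((hasDerivAt_id (0 : ℝ)).mul_const v.2.1).const_add z.2.1

theorem lineDeriv_u (i j : ℕ) (z v : Jet) :
    lineDeriv ℝ (fun w : Jet => w.2.2 i j) z v = v.2.2 i j := by
  refine lineDeriv_eq_of_hasDerivAt ?_
  simpa using ((hasDerivAt_id (0 : ℝ)).mul_const (v.2.2 i j)).const_add (z.2.2 i j)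

theorem hasDerivAt_toJ1 (z v : Jet) :
    HasDerivAt (fun s : ℝ => toJ1 (z + s • v)) (toJ1 v) 0 := by
  have h : HasDerivAt (fun s : ℝ => toJ1 z + s • toJ1 v) ((1 : ℝ) • toJ1 v) 0 :=
    ((hasDerivAt_id (0 : ℝ)).smul_const (toJ1 v)).const_add (toJ1 z)
  rw [one_smul] at h
  exact h

theorem hasDerivAt_toJ2 (z v : Jet) :
    HasDerivAt (fun s : ℝ => toJ2 (z + s • v)) (toJ2 v) 0 := by
  have h : HasDerivAt (fun s : ℝ => toJ2 z + s • toJ2 v) ((1 : ℝ) • toJ2 v) 0 :=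
    ((hasDerivAt_id (0 : ℝ)).smul_const (toJ2 v)).const_add (toJ2 z)
  rw [one_smul] at h
  exact h

theorem lineDeriv_comp_toJ1 {g : J1 → E} {z : Jet} (hg : DifferentiableAt ℝ g (toJ1 z)) (v : Jet) :
    lineDeriv ℝ (fun w => g (toJ1 w)) z v = fderiv ℝ g (toJ1 z) (toJ1 v) := by
  rw [(smoothAt_toJ1 z).lineDeriv_comp hg, lineDeriv_eq_of_hasDerivAt (hasDerivAt_toJ1 z v)]

theorem lineDeriv_comp_toJ2 {g : J2 → E} {z : Jet} (hg : DifferentiableAt ℝ g (toJ2 z)) (v : Jet) :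
    lineDeriv ℝ (fun w => g (toJ2 w)) z v = fderiv ℝ g (toJ2 z) (toJ2 v) := by
  rw [(smoothAt_toJ2 z).lineDeriv_comp hg, lineDeriv_eq_of_hasDerivAt (hasDerivAt_toJ2 z v)]

theorem SmoothAt.lineDeriv_dir_add {f : Jet → E} {z : Jet} (h : SmoothAt f z) (v v' : Jet) :
    lineDeriv ℝ f z (v + v') = lineDeriv ℝ f z v + lineDeriv ℝ f z v' := by
  obtain ⟨n, g, h⟩ := h
  simp only [h.lineDeriv_eq, trunc_add, map_add]

theorem SmoothAt.lineDeriv_dir_smul {f : Jet → E} {z : Jet} (h : SmoothAt f z) (c : ℝ) (v : Jet) :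
    lineDeriv ℝ f z (c • v) = c • lineDeriv ℝ f z v := by
  obtain ⟨n, g, h⟩ := h
  simp only [h.lineDeriv_eq, trunc_smul, map_smul]

/-- The coordinate direction of `u i j`. -/
def eu (i j : ℕ) : Jet := (0, 0, fun i' j' => if i' = i ∧ j' = j then 1 else 0)

/-- A directional derivative depends only on those components of the direction for which the
partial derivative does not vanish. -/
theorem SmoothAt.lineDeriv_congr_dir {f : Jet → E} {z : Jet} (h : SmoothAt f z) {v v' : Jet}
    (ht : v.1 = v'.1) (hx : v.2.1 = v'.2.1)
    (hu : ∀ i j, v.2.2 i j = v'.2.2 i j ∨ lineDeriv ℝ f z (eu i j) = 0) :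
    lineDeriv ℝ f z v = lineDeriv ℝ f z v' := by
  obtain ⟨n, g, h⟩ := h
  have key : trunc n v - trunc n v' =
      ∑ i : Fin n, ∑ j : Fin n, (v.2.2 i j - v'.2.2 i j) • trunc n (eu i j) := by
    refine Prod.ext ?_ (Prod.ext ?_ ?_)
    · simp [Prod.fst_sum, trunc, eu, ht]
    · simp [Prod.fst_sum, Prod.snd_sum, trunc, eu, hx]
    · ext a b
      simp only [Prod.snd_sum, Prod.smul_snd, Finset.sum_apply, Pi.smul_apply, smul_eq_mul]
      rw [Finset.sum_eq_single a, Finset.sum_eq_single b]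
      · simp [trunc, eu]
      · intro j _ hj
        have : (b : ℕ) ≠ j := fun h => hj (Fin.ext h.symm)
        simp [trunc, eu, this]
      · simp
      · intro i _ hi
        have : (a : ℕ) ≠ i := fun h => hi (Fin.ext h.symm)
        simp [trunc, eu, this]
      · simp
  rw [← sub_eq_zero, h.lineDeriv_eq, h.lineDeriv_eq, ← map_sub, key, map_sum]
  refine Finset.sum_eq_zero fun i _ => ?_
  rw [map_sum]
  refine Finset.sum_eq_zero fun j _ => ?_
  rw [map_smul, ← h.lineDeriv_eq]
  rcases hu i j with h1 | h1
  · rw [h1, sub_self, zero_smul]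
  · rw [h1, smul_zero]

/-- The derivative in the direction `v` of a map (or vector field) on the jet space. -/
noncomputable def dField (a : Jet → Jet) (z v : Jet) : Jet :=
  (lineDeriv ℝ (fun w => (a w).1) z v, lineDeriv ℝ (fun w => (a w).2.1) z v,
    fun i j => lineDeriv ℝ (fun w => (a w).2.2 i j) z v)

theorem SmoothField.hasDerivAt_trunc {a : Jet → Jet} {z : Jet} (ha : SmoothField a z) (v : Jet)
    (n : ℕ) : HasDerivAt (fun s : ℝ => EvolCL.trunc n (a (z + s • v)))
      (EvolCL.trunc n (dField a z v)) 0 := by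
  refine (ha.1.hasDerivAt_line v).prodMk ((ha.2.1.hasDerivAt_line v).prodMk ?_)
  refine hasDerivAt_pi.2 fun i => hasDerivAt_pi.2 fun j => ?_
  exact (ha.2.2 i j).hasDerivAt_line v

/-- The chain rule for maps of the jet space. -/
theorem SmoothAt.lineDeriv_comp_field {f : Jet → E} {a : Jet → Jet} {z : Jet}
    (hf : SmoothAt f (a z)) (ha : SmoothField a z) (v : Jet) :
    lineDeriv ℝ (fun w => f (a w)) z v = lineDeriv ℝ f (a z) (dField a z v) := by
  obtain ⟨n, g, h⟩ := hf
  have h' : RepAt n g f (a (z + (0 : ℝ) • v)) := by simpa using h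
  have := h'.hasDerivAt (c := fun s => a (z + s • v)) (ha.hasDerivAt_trunc v n)
  rw [h.lineDeriv_eq]
  refine lineDeriv_eq_of_hasDerivAt ?_
  simpa using this

theorem RepAt.contDiffOn_fderiv {n : ℕ} {g : FinJet n → E} {f : Jet → E} {z : Jet}
    (h : RepAt n g f z) : ∃ W : Set (FinJet n), IsOpen W ∧ trunc n z ∈ W ∧
      ContDiffOn ℝ ∞ (fderiv ℝ g) W ∧ ∀ w, trunc n w ∈ W → RepAt n g f w := by
  obtain ⟨W, hW, hz, hg, hfg⟩ := h
  exact ⟨W, hW, hz, hg.fderiv_of_isOpen hW (by simp), fun w hw => ⟨W, hW, hw, hg, hfg⟩⟩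

theorem SmoothAt.lineDeriv_field {f : Jet → E} {a : Jet → Jet} {z : Jet} (hf : SmoothAt f z)
    (ha : SmoothField a z) : SmoothAt (fun w => lineDeriv ℝ f w (a w)) z := by
  obtain ⟨n, g, h⟩ := hf
  obtain ⟨W, hW, hz, hg, hr⟩ := h.contDiffOn_fderiv
  have h1 : SmoothAt (fun w => fderiv ℝ g (EvolCL.trunc n w)) z := smoothAt_trunc_comp hW hz hg
  have h2 : SmoothAt (fun w => fderiv ℝ g (EvolCL.trunc n w) (EvolCL.trunc n (a w))) z :=
    SmoothAt.comp_contDiff (g := fun p : (FinJet n →L[ℝ] E) × FinJet n => p.1 p.2)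
      (contDiff_fst.clm_apply contDiff_snd) (h1.prodMk (ha.trunc n))
  refine h2.congr ?_
  filter_upwards [(hW.preimage (continuous_trunc n)).mem_nhds hz] with w hw
  exact (hr w hw).lineDeriv_eq _

theorem SmoothAt.lineDeriv_const {f : Jet → E} {z : Jet} (hf : SmoothAt f z) (v : Jet) :
    SmoothAt (fun w => lineDeriv ℝ f w v) z :=
  hf.lineDeriv_field (smoothField_const v z)

theorem SmoothAt.Dx {f : Jet → ℝ} {z : Jet} (hf : SmoothAt f z) : SmoothAt (Dx f) z :=
  hf.lineDeriv_field (smoothField_vecX z)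

theorem SmoothAt.Dt {f : Jet → ℝ} {z : Jet} (hf : SmoothAt f z) : SmoothAt (Dt f) z :=
  hf.lineDeriv_field (smoothField_vecT z)

theorem RepAt.lineDeriv_lineDeriv {n : ℕ} {g : FinJet n → E} {f : Jet → E} {z : Jet}
    (h : RepAt n g f z) {a : Jet → Jet} (ha : SmoothField a z) (v : Jet) :
    lineDeriv ℝ (fun w => lineDeriv ℝ f w (a w)) z v =
      fderiv ℝ (fderiv ℝ g) (trunc n z) (trunc n v) (trunc n (a z)) +
        lineDeriv ℝ f z (dField a z v) := by
  rw [h.lineDeriv_eq]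
  obtain ⟨W, hW, hz, hg, hr⟩ := h.contDiffOn_fderiv
  have heq : (fun w => lineDeriv ℝ f w (a w)) =ᶠ[𝓝 z]
      fun w => fderiv ℝ g (trunc n w) (trunc n (a w)) := by
    filter_upwards [(hW.preimage (continuous_trunc n)).mem_nhds hz] with w hw
    exact (hr w hw).lineDeriv_eq _
  rw [lineDeriv_congr heq]
  refine lineDeriv_eq_of_hasDerivAt ?_
  have h1 : HasFDerivAt (fderiv ℝ g) (fderiv ℝ (fderiv ℝ g) (trunc n z))
      (trunc n (z + (0 : ℝ) • v)) := by
    simpa using ((hg.contDiffAt (hW.mem_nhds hz)).differentiableAt (by simp)).hasFDerivAt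
  have h2 := h1.comp_hasDerivAt (0 : ℝ) (hasDerivAt_trunc_line n z v)
  have h3 := HasDerivAt.clm_apply h2 (ha.hasDerivAt_trunc v n)
  have h4 : z + (0 : ℝ) • v = z := by rw [zero_smul, add_zero]
  simp only [Function.comp_apply, h4] at h3
  exact h3

/-- The commutator of two vector fields, in a form free of subtraction of fields: the part of
the iterated derivative which is of second order in `f` is symmetric. -/
theorem SmoothAt.lineDeriv_comm {f : Jet → E} {z : Jet} (hf : SmoothAt f z) {a b : Jet → Jet}
    (ha : SmoothField a z) (hb : SmoothField b z) :
    lineDeriv ℝ (fun w => lineDeriv ℝ f w (a w)) z (b z) + lineDeriv ℝ f z (dField b z (a z)) =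
      lineDeriv ℝ (fun w => lineDeriv ℝ f w (b w)) z (a z) +
        lineDeriv ℝ f z (dField a z (b z)) := by
  obtain ⟨n, g, h⟩ := hf
  have hsymm : IsSymmSndFDerivAt ℝ g (trunc n z) := h.contDiffAt.isSymmSndFDerivAt (by
    rw [minSmoothness_of_isRCLikeNormedField]
    exact WithTop.coe_le_coe.2 le_top)
  rw [h.lineDeriv_lineDeriv ha, h.lineDeriv_lineDeriv hb, hsymm (trunc n (b z)) (trunc n (a z))]
  abel

theorem dField_const (v z v' : Jet) : dField (fun _ => v) z v' = 0 := by
  simp [dField, lineDeriv_fun_const, Prod.ext_iff, funext_iff]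

theorem dField_vecX (z v : Jet) : dField vecX z v = (0, 0, fun i j => v.2.2 i (j + 1)) := by
  simp only [dField, vecX, lineDeriv_fun_const, lineDeriv_u]

theorem dField_vecT (z v : Jet) : dField vecT z v = (0, 0, fun i j => v.2.2 (i + 1) j) := by
  simp only [dField, vecT, lineDeriv_fun_const, lineDeriv_u]

/-- The partial derivatives commute with each other. -/
theorem SmoothAt.lineDeriv_const_comm {f : Jet → E} {z : Jet} (hf : SmoothAt f z) (v v' : Jet) :
    lineDeriv ℝ (fun w => lineDeriv ℝ f w v) z v' =
      lineDeriv ℝ (fun w => lineDeriv ℝ f w v') z v := by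
  have := hf.lineDeriv_comm (smoothField_const v z) (smoothField_const v' z)
  simpa [dField_const] using this

theorem SmoothAt.lineDeriv_Dx {f : Jet → ℝ} {z : Jet} (hf : SmoothAt f z) (v : Jet) :
    lineDeriv ℝ (EvolCL.Dx f) z v =
      EvolCL.Dx (fun w => lineDeriv ℝ f w v) z +
        lineDeriv ℝ f z (0, 0, fun i j => v.2.2 i (j + 1)) := by
  have := hf.lineDeriv_comm (smoothField_vecX z) (smoothField_const v z)
  rw [dField_const, dField_vecX, lineDeriv_zero, add_zero] at this
  exact this

theorem SmoothAt.lineDeriv_Dt {f : Jet → ℝ} {z : Jet} (hf : SmoothAt f z) (v : Jet) :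
    lineDeriv ℝ (EvolCL.Dt f) z v =
      EvolCL.Dt (fun w => lineDeriv ℝ f w v) z +
        lineDeriv ℝ f z (0, 0, fun i j => v.2.2 (i + 1) j) := by
  have := hf.lineDeriv_comm (smoothField_vecT z) (smoothField_const v z)
  rw [dField_const, dField_vecT, lineDeriv_zero, add_zero] at this
  exact this

theorem shiftX_eu_succ (i j : ℕ) :
    ((0, 0, fun a b => (eu i (j + 1)).2.2 a (b + 1)) : Jet) = eu i j := by
  simp [eu]

theorem shiftX_eu_zero (i : ℕ) :
    ((0, 0, fun a b => (eu i 0).2.2 a (b + 1)) : Jet) = 0 := by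
  simp [eu, Prod.ext_iff, funext_iff]

theorem shiftT_eu_succ (i j : ℕ) :
    ((0, 0, fun a b => (eu (i + 1) j).2.2 (a + 1) b) : Jet) = eu i j := by
  simp [eu]

theorem SmoothAt.lineDeriv_Dx_succ {f : Jet → ℝ} {z : Jet} (hf : SmoothAt f z) (i j : ℕ) :
    lineDeriv ℝ (EvolCL.Dx f) z (eu i (j + 1)) =
      EvolCL.Dx (fun w => lineDeriv ℝ f w (eu i (j + 1))) z + lineDeriv ℝ f z (eu i j) := by
  rw [hf.lineDeriv_Dx, shiftX_eu_succ]

theorem SmoothAt.lineDeriv_Dx_zero {f : Jet → ℝ} {z : Jet} (hf : SmoothAt f z) (i : ℕ) :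
    lineDeriv ℝ (EvolCL.Dx f) z (eu i 0) = EvolCL.Dx (fun w => lineDeriv ℝ f w (eu i 0)) z := by
  rw [hf.lineDeriv_Dx, shiftX_eu_zero, lineDeriv_zero, add_zero]

theorem SmoothAt.lineDeriv_Dt_succ {f : Jet → ℝ} {z : Jet} (hf : SmoothAt f z) (i j : ℕ) :
    lineDeriv ℝ (EvolCL.Dt f) z (eu (i + 1) j) =
      EvolCL.Dt (fun w => lineDeriv ℝ f w (eu (i + 1) j)) z + lineDeriv ℝ f z (eu i j) := by
  rw [hf.lineDeriv_Dt, shiftT_eu_succ]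

/-- A smooth function whose derivative along a segment vanishes has equal values at its ends. -/
theorem eq_of_lineDeriv_eq_zero {f : Jet → ℝ} {z w : Jet}
    (hf : ∀ s ∈ Set.Icc (0 : ℝ) 1, SmoothAt f (z + s • (w - z)))
    (h0 : ∀ s ∈ Set.Icc (0 : ℝ) 1, lineDeriv ℝ f (z + s • (w - z)) (w - z) = 0) : f w = f z := by
  have hd : ∀ s ∈ Set.Icc (0 : ℝ) 1, HasDerivAt (fun r : ℝ => f (z + r • (w - z))) 0 s := by
    intro s hs
    have h1 := (hf s hs).hasDerivAt_line (w - z)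
    rw [h0 s hs] at h1
    have h2 : HasDerivAt (fun r : ℝ => f (z + s • (w - z) + (r - s) • (w - z))) 0 s := by
      have h3 : HasDerivAt (fun r : ℝ => f (z + s • (w - z) + r • (w - z))) 0 (s - s) := by
        rwa [sub_self]
      exact h3.comp_sub_const s s
    refine h2.congr_of_eventuallyEq (Filter.Eventually.of_forall fun r => ?_)
    change f _ = f _
    congr 1
    module
  have := constant_of_has_deriv_right_zero
    (fun s hs => (hd s hs).continuousAt.continuousWithinAt)
    (fun s hs => (hd s ⟨hs.1, hs.2.le⟩).hasDerivWithinAt) 1 ⟨zero_le_one, le_rfl⟩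
  simpa using this

end SmoothAt

/-! ### The solution jets -/

namespace Equation

variable (L : Equation)

/-- The jets over the domain of the equation. -/
def jetDom : Set Jet := {w | toJ2 w ∈ L.dom}

/-- The right-hand side of the equation as a differential function. -/
def rhs (w : Jet) : ℝ := L.H (toJ2 w)

/-- The total `x`-derivatives of the right-hand side. -/
noncomputable def rhsX (k : ℕ) : Jet → ℝ := Dx^[k] L.rhs

/-- The evolutionary vector field `∂_t + ∑ (D_xʲ H) ∂_{u_{0j}}`: the total derivative with respect
to `t` on the solution jets, when these are parametrised by `t`, `x` and the `u_{0j}`. -/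
noncomputable def vecE (w : Jet) : Jet := (1, 0, fun i j => if i = 0 then L.rhsX j w else 0)

/-- The derivative along the evolutionary vector field. -/
noncomputable def DtE (f : Jet → ℝ) (w : Jet) : ℝ := lineDeriv ℝ f w (L.vecE w)

/-- The value of `u_{ij}` on the solution jets in terms of `t`, `x` and the `u_{0k}`. -/
noncomputable def solCoord (i j : ℕ) : Jet → ℝ := L.DtE^[i] fun w => w.2.2 0 j

/-- The solution jet with the same `t`, `x` and `u_{0j}` as a given jet. -/
noncomputable def solMap (w : Jet) : Jet := (w.1, w.2.1, fun i j => L.solCoord i j w)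

variable {L}

theorem continuous_toJ2 : Continuous toJ2 := by
  unfold toJ2
  fun_prop

theorem continuous_toJ1 : Continuous toJ1 := by
  unfold toJ1
  fun_prop

theorem isOpen_jetDom : IsOpen L.jetDom := L.isOpen_dom.preimage continuous_toJ2

theorem differentiableAt_H {y : J2} (hy : y ∈ L.dom) : DifferentiableAt ℝ L.H y :=
  (L.smooth.contDiffAt (L.isOpen_dom.mem_nhds hy)).differentiableAt (by simp)

theorem smoothAt_rhs {w : Jet} (hw : w ∈ L.jetDom) : SmoothAt L.rhs w :=
  SmoothAt.comp (f := toJ2) (g := L.H) L.isOpen_dom hw L.smooth (smoothAt_toJ2 w)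

theorem rhsX_succ (k : ℕ) : L.rhsX (k + 1) = Dx (L.rhsX k) := Function.iterate_succ_apply' _ _ _

theorem smoothAt_rhsX {w : Jet} (hw : w ∈ L.jetDom) (k : ℕ) : SmoothAt (L.rhsX k) w := by
  induction k with
  | zero => exact smoothAt_rhs hw
  | succ k ih =>
    rw [rhsX_succ]
    exact ih.Dx

theorem smoothField_vecE {w : Jet} (hw : w ∈ L.jetDom) : SmoothField L.vecE w := by
  refine ⟨smoothAt_const _ w, smoothAt_const _ w, fun i j => ?_⟩
  by_cases hi : i = 0
  · simpa [vecE, hi] using smoothAt_rhsX hw j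
  · simpa [vecE, hi] using smoothAt_const (0 : ℝ) w

theorem dField_vecE (w v : Jet) : dField L.vecE w v =
    (0, 0, fun i j => if i = 0 then lineDeriv ℝ (L.rhsX j) w v else 0) := by
  refine Prod.ext (lineDeriv_fun_const (1 : ℝ) w v)
    (Prod.ext (lineDeriv_fun_const (0 : ℝ) w v) ?_)
  funext i j
  by_cases hi : i = 0
  · simp [dField, vecE, hi]
  · simp [dField, vecE, hi, lineDeriv_fun_const]

theorem _root_.EvolCL.SmoothAt.DtE {f : Jet → ℝ} {w : Jet} (hf : SmoothAt f w)
    (hw : w ∈ L.jetDom) : SmoothAt (L.DtE f) w :=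
  hf.lineDeriv_field (smoothField_vecE hw)

theorem solCoord_succ (i j : ℕ) : L.solCoord (i + 1) j = L.DtE (L.solCoord i j) :=
  Function.iterate_succ_apply' _ _ _

theorem smoothAt_solCoord {w : Jet} (hw : w ∈ L.jetDom) (i j : ℕ) :
    SmoothAt (L.solCoord i j) w := by
  induction i with
  | zero => exact smoothAt_u 0 j w
  | succ i ih =>
    rw [solCoord_succ]
    exact ih.DtE hw

theorem smoothField_solMap {w : Jet} (hw : w ∈ L.jetDom) : SmoothField L.solMap w :=
  ⟨smoothAt_t w, smoothAt_x w, fun i j => smoothAt_solCoord hw i j⟩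

theorem Dx_DtE {f : Jet → ℝ} {w : Jet} (hf : SmoothAt f w) (hw : w ∈ L.jetDom) :
    Dx (L.DtE f) w = L.DtE (Dx f) w := by
  have h := hf.lineDeriv_comm (smoothField_vecE hw) (smoothField_vecX w)
  have h1 : dField vecX w (L.vecE w) = dField L.vecE w (vecX w) := by
    rw [dField_vecX, dField_vecE]
    refine Prod.ext rfl (Prod.ext rfl ?_)
    funext i j
    by_cases hi : i = 0
    · simp only [vecE, hi, if_true, rhsX_succ]
      rfl
    · simp [vecE, hi]
  rw [h1] at h
  exact add_right_cancel h

theorem lineDeriv_DtE {f : Jet → ℝ} {w : Jet} (hf : SmoothAt f w) (hw : w ∈ L.jetDom) (v : Jet) :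
    lineDeriv ℝ (L.DtE f) w v = L.DtE (fun w' => lineDeriv ℝ f w' v) w +
      lineDeriv ℝ f w (0, 0, fun i j => if i = 0 then lineDeriv ℝ (L.rhsX j) w v else 0) := by
  have h := hf.lineDeriv_comm (smoothField_vecE hw) (smoothField_const v w)
  rw [dField_const, dField_vecE, lineDeriv_zero, add_zero] at h
  exact h

theorem Dx_solCoord {w : Jet} (hw : w ∈ L.jetDom) (i j : ℕ) :
    Dx (L.solCoord i j) w = L.solCoord i (j + 1) w := by
  induction i generalizing w with
  | zero => exact lineDeriv_u 0 j w (vecX w)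
  | succ i ih =>
    rw [solCoord_succ, Dx_DtE (smoothAt_solCoord hw i j) hw, solCoord_succ]
    exact lineDeriv_congr
      (Filter.eventually_of_mem (isOpen_jetDom.mem_nhds hw) fun w' hw' => ih hw') _

theorem dField_solMap_vecX {w : Jet} (hw : w ∈ L.jetDom) :
    dField L.solMap w (vecX w) = vecX (L.solMap w) := by
  refine Prod.ext (lineDeriv_t _ _) (Prod.ext (lineDeriv_x _ _) ?_)
  funext i j
  exact Dx_solCoord hw i j

theorem dField_solMap_vecE (w : Jet) : dField L.solMap w (L.vecE w) = vecT (L.solMap w) := by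
  refine Prod.ext (lineDeriv_t _ _) (Prod.ext (lineDeriv_x _ _) ?_)
  funext i j
  exact (congrFun (solCoord_succ i j) w).symm

theorem Dx_comp_solMap {f : Jet → ℝ} {w : Jet} (hw : w ∈ L.jetDom) (hf : SmoothAt f (L.solMap w)) :
    Dx (fun w' => f (L.solMap w')) w = Dx f (L.solMap w) := by
  rw [Dx, hf.lineDeriv_comp_field (smoothField_solMap hw), dField_solMap_vecX hw]
  rfl

theorem DtE_comp_solMap {f : Jet → ℝ} {w : Jet} (hw : w ∈ L.jetDom)
    (hf : SmoothAt f (L.solMap w)) :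
    L.DtE (fun w' => f (L.solMap w')) w = Dt f (L.solMap w) := by
  rw [DtE, hf.lineDeriv_comp_field (smoothField_solMap hw), dField_solMap_vecE]
  rfl

theorem smoothAt_defect {w : Jet} (hw : w ∈ L.jetDom) : SmoothAt L.defect w :=
  (smoothAt_u 1 0 w).sub (smoothAt_rhs hw)

/-- The image of `solMap` consists of solution jets: on it, the total derivatives become
derivatives along commuting fields, which annihilate the pulled back equation. -/
theorem solMap_mem_sol {w : Jet} (hw : w ∈ L.jetDom) : L.solMap w ∈ L.sol := by
  let Van : (Jet → ℝ) → Prop := fun f =>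
    (∀ w ∈ L.jetDom, SmoothAt f w) ∧ ∀ w ∈ L.jetDom, f (L.solMap w) = 0
  have hnhds : ∀ {f : Jet → ℝ} {w : Jet}, Van f → w ∈ L.jetDom →
      (fun w' => f (L.solMap w')) =ᶠ[𝓝 w] fun _ => 0 := fun hf hw =>
    Filter.eventually_of_mem (isOpen_jetDom.mem_nhds hw) hf.2
  have hX : ∀ f, Van f → Van (Dx f) := fun f hf =>
    ⟨fun w hw => (hf.1 w hw).Dx, fun w hw => by
      rw [← Dx_comp_solMap hw (hf.1 _ hw), Dx, lineDeriv_congr (hnhds hf hw),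
        lineDeriv_fun_const]⟩
  have hT : ∀ f, Van f → Van (Dt f) := fun f hf =>
    ⟨fun w hw => (hf.1 w hw).Dt, fun w hw => by
      rw [← DtE_comp_solMap hw (hf.1 _ hw), DtE, lineDeriv_congr (hnhds hf hw),
        lineDeriv_fun_const]⟩
  have h0 : Van L.defect := by
    refine ⟨fun w hw => smoothAt_defect hw, fun w hw => ?_⟩
    change L.solCoord 1 0 w - L.rhs w = 0
    rw [solCoord_succ, sub_eq_zero]
    exact lineDeriv_u 0 0 w (L.vecE w)
  have hit : ∀ (g : (Jet → ℝ) → (Jet → ℝ)), (∀ f, Van f → Van (g f)) →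
      ∀ n f, Van f → Van (g^[n] f) := by
    intro g hg n
    induction n with
    | zero => exact fun f hf => hf
    | succ n ih => exact fun f hf => ih _ (hg f hf)
  exact ⟨hw, fun i j => (hit Dt hT i _ (hit Dx hX j _ h0)).2 w hw⟩

theorem Dx_iterate_defect {w : Jet} (hw : w ∈ L.jetDom) (j : ℕ) :
    (Dx^[j] L.defect) w = w.2.2 1 j - L.rhsX j w := by
  induction j generalizing w with
  | zero => rfl
  | succ j ih =>
    rw [Function.iterate_succ_apply', rhsX_succ, Dx,
      lineDeriv_congr (Filter.eventually_of_mem (isOpen_jetDom.mem_nhds hw) fun w' hw' => ih hw'),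
      (smoothAt_u 1 j w).lineDeriv_sub (smoothAt_rhsX hw j), lineDeriv_u]
    rfl

theorem Dt_iterate_defect {w : Jet} (hw : w ∈ L.jetDom) (i j : ℕ) :
    (Dt^[i] (Dx^[j] L.defect)) w = w.2.2 (i + 1) j - (Dt^[i] (L.rhsX j)) w := by
  induction i generalizing w with
  | zero => exact Dx_iterate_defect hw j
  | succ i ih =>
    have hs : SmoothAt (Dt^[i] (L.rhsX j)) w := by
      clear ih
      induction i with
      | zero => exact smoothAt_rhsX hw j
      | succ i ih =>
        rw [Function.iterate_succ_apply']
        exact ih.Dt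
    rw [Function.iterate_succ_apply', Function.iterate_succ_apply', Dt,
      lineDeriv_congr (Filter.eventually_of_mem (isOpen_jetDom.mem_nhds hw) fun w' hw' => ih hw'),
      (smoothAt_u (i + 1) j w).lineDeriv_sub hs, lineDeriv_u]
    rfl

/-- The function does not depend on the coordinates `u_{ij}` with `i > m`. -/
def RowLe (L : Equation) (m : ℕ) (f : Jet → ℝ) : Prop :=
  (∀ w ∈ L.jetDom, SmoothAt f w) ∧
    ∀ w ∈ L.jetDom, ∀ i > m, ∀ j, lineDeriv ℝ f w (eu i j) = 0

theorem RowLe.lineDeriv_eventually {m : ℕ} {f : Jet → ℝ} (hf : L.RowLe m f) {w : Jet}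
    (hw : w ∈ L.jetDom) {i : ℕ} (hi : m < i) (j : ℕ) :
    (fun w' => lineDeriv ℝ f w' (eu i j)) =ᶠ[𝓝 w] fun _ => 0 :=
  Filter.eventually_of_mem (isOpen_jetDom.mem_nhds hw) fun w' hw' => hf.2 w' hw' i hi j

theorem rowLe_rhs : L.RowLe 0 L.rhs := by
  refine ⟨fun w hw => smoothAt_rhs hw, fun w hw i hi j => ?_⟩
  have h := lineDeriv_comp_toJ2 (differentiableAt_H (L := L) hw) (eu i j)
  have h0 : toJ2 (eu i j) = 0 := by
    have : (0 : ℕ) ≠ i := by omega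
    simp [toJ2, eu, this]
  rw [h0, map_zero] at h
  exact h

theorem RowLe.Dx {m : ℕ} {f : Jet → ℝ} (hf : L.RowLe m f) : L.RowLe m (Dx f) := by
  refine ⟨fun w hw => (hf.1 w hw).Dx, fun w hw i hi j => ?_⟩
  cases j with
  | zero =>
    rw [(hf.1 w hw).lineDeriv_Dx_zero, EvolCL.Dx, lineDeriv_congr (hf.lineDeriv_eventually hw hi 0),
      lineDeriv_fun_const]
  | succ j =>
    rw [(hf.1 w hw).lineDeriv_Dx_succ, EvolCL.Dx,
      lineDeriv_congr (hf.lineDeriv_eventually hw hi (j + 1)), lineDeriv_fun_const,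
      hf.2 w hw i hi j, add_zero]

theorem RowLe.Dt {m : ℕ} {f : Jet → ℝ} (hf : L.RowLe m f) : L.RowLe (m + 1) (Dt f) := by
  refine ⟨fun w hw => (hf.1 w hw).Dt, fun w hw i hi j => ?_⟩
  obtain ⟨i, rfl⟩ : ∃ i', i = i' + 1 := ⟨i - 1, by omega⟩
  rw [(hf.1 w hw).lineDeriv_Dt_succ, EvolCL.Dt,
    lineDeriv_congr (hf.lineDeriv_eventually hw (by omega) j), lineDeriv_fun_const,
    hf.2 w hw i (by omega) j, add_zero]

theorem rowLe_rhsX (k : ℕ) : L.RowLe 0 (L.rhsX k) := by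
  induction k with
  | zero => exact rowLe_rhs
  | succ k ih =>
    rw [rhsX_succ]
    exact ih.Dx

theorem rowLe_Dt_iterate_rhsX (i j : ℕ) : L.RowLe i (EvolCL.Dt^[i] (L.rhsX j)) := by
  induction i with
  | zero => exact rowLe_rhsX j
  | succ i ih =>
    rw [Function.iterate_succ_apply']
    exact ih.Dt

theorem RowLe.eq {m : ℕ} {f : Jet → ℝ} (hf : L.RowLe m f) {w w' : Jet} (hw : w ∈ L.jetDom)
    (ht : w'.1 = w.1) (hx : w'.2.1 = w.2.1) (hu : ∀ i ≤ m, ∀ j, w'.2.2 i j = w.2.2 i j) :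
    f w' = f w := by
  have hseg : ∀ s : ℝ, w + s • (w' - w) ∈ L.jetDom := by
    intro s
    have : toJ2 (w + s • (w' - w)) = toJ2 w := by
      simp [toJ2, ht, hx, hu 0 (Nat.zero_le m)]
    change toJ2 _ ∈ L.dom
    rw [this]
    exact hw
  refine eq_of_lineDeriv_eq_zero (fun s _ => hf.1 _ (hseg s)) fun s _ => ?_
  rw [(hf.1 _ (hseg s)).lineDeriv_congr_dir (v' := 0) (by simp [ht]) (by simp [hx]),
    lineDeriv_zero]
  intro i j
  rcases le_or_gt i m with hi | hi
  · left
    simp [hu i hi j]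
  · right
    exact hf.2 _ (hseg s) i hi j

/-- A solution jet is determined by `t`, `x` and the `u_{0j}`: the equation and its differential
consequences express row `i + 1` of the `u_{ij}` through the rows up to `i`. -/
theorem solMap_eq_self {w : Jet} (hw : w ∈ L.sol) : L.solMap w = w := by
  have hs := solMap_mem_sol hw.1
  have hrow : ∀ v ∈ L.sol, ∀ i j, v.2.2 (i + 1) j = (EvolCL.Dt^[i] (L.rhsX j)) v := by
    intro v hv i j
    have := Dt_iterate_defect hv.1 i j
    rw [hv.2 i j] at this
    linarith
  have key : ∀ m, ∀ i ≤ m, ∀ j, (L.solMap w).2.2 i j = w.2.2 i j := by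
    intro m
    induction m with
    | zero =>
      intro i hi j
      obtain rfl : i = 0 := by omega
      rfl
    | succ m ih =>
      intro i hi j
      rcases Nat.lt_or_ge i (m + 1) with h | h
      · exact ih i (by omega) j
      · obtain rfl : i = m + 1 := by omega
        rw [hrow _ hs, hrow _ hw]
        exact (rowLe_Dt_iterate_rhsX m j).eq hw.1 rfl rfl ih
  refine Prod.ext rfl (Prod.ext rfl ?_)
  funext i j
  exact key i i le_rfl j

theorem continuousAt_solMap {w : Jet} (hw : w ∈ L.jetDom) : ContinuousAt L.solMap w :=
  (smoothField_solMap hw).continuousAt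

/-- The total derivatives are tangent to the solution jets. -/
theorem Dx_congr_sol {f f' : Jet → ℝ} {w : Jet} (hw : w ∈ L.sol) (hf : SmoothAt f w)
    (hf' : SmoothAt f' w) (h : ∀ᶠ w' in 𝓝 w, w' ∈ L.sol → f w' = f' w') :
    Dx f w = Dx f' w := by
  have hs := solMap_eq_self hw
  have h1 : (fun w' => f (L.solMap w')) =ᶠ[𝓝 w] fun w' => f' (L.solMap w') := by
    have h2 : ContinuousAt L.solMap w := continuousAt_solMap hw.1
    rw [← hs] at h
    filter_upwards [h2.eventually h, isOpen_jetDom.mem_nhds hw.1] with w' hw' hw''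
    exact hw' (solMap_mem_sol hw'')
  have e1 := Dx_comp_solMap (f := f) hw.1 (by rwa [hs])
  have e2 := Dx_comp_solMap (f := f') hw.1 (by rwa [hs])
  rw [hs] at e1 e2
  rw [← e1, ← e2]
  exact lineDeriv_congr h1 _

theorem Dt_congr_sol {f f' : Jet → ℝ} {w : Jet} (hw : w ∈ L.sol) (hf : SmoothAt f w)
    (hf' : SmoothAt f' w) (h : ∀ᶠ w' in 𝓝 w, w' ∈ L.sol → f w' = f' w') :
    Dt f w = Dt f' w := by
  have hs := solMap_eq_self hw
  have h1 : (fun w' => f (L.solMap w')) =ᶠ[𝓝 w] fun w' => f' (L.solMap w') := by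
    have h2 : ContinuousAt L.solMap w := continuousAt_solMap hw.1
    rw [← hs] at h
    filter_upwards [h2.eventually h, isOpen_jetDom.mem_nhds hw.1] with w' hw' hw''
    exact hw' (solMap_mem_sol hw'')
  have e1 := DtE_comp_solMap (f := f) hw.1 (by rwa [hs])
  have e2 := DtE_comp_solMap (f := f') hw.1 (by rwa [hs])
  rw [hs] at e1 e2
  rw [← e1, ← e2]
  exact lineDeriv_congr h1 _

end Equation

/-! ### Differential functions of `t`, `x` and finitely many `x`-derivatives -/

/-- Near `z`, the function is a smooth function of `t`, `x` and the `u_{0j}` with `j ≤ n`. -/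
def Spatial (n : ℕ) (f : Jet → ℝ) (z : Jet) : Prop :=
  SmoothAt f z ∧ ∀ᶠ w in 𝓝 z, ∀ i j, (i ≠ 0 ∨ n < j) → lineDeriv ℝ f w (eu i j) = 0

namespace Spatial

variable {n m : ℕ} {f f' : Jet → ℝ} {z : Jet}

theorem eventually (h : Spatial n f z) : ∀ᶠ w in 𝓝 z, Spatial n f w := by
  filter_upwards [h.1.eventually, h.2.eventually_nhds] with w h1 h2
  exact ⟨h1, h2⟩

theorem zero (h : Spatial n f z) {i j : ℕ} (hij : i ≠ 0 ∨ n < j) :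
    lineDeriv ℝ f z (eu i j) = 0 := h.2.self_of_nhds i j hij

theorem eventuallyEq_zero (h : Spatial n f z) {i j : ℕ} (hij : i ≠ 0 ∨ n < j) :
    (fun w => lineDeriv ℝ f w (eu i j)) =ᶠ[𝓝 z] fun _ => 0 :=
  h.2.mono fun _ hw => hw i j hij

theorem congr (h : Spatial n f z) (he : f' =ᶠ[𝓝 z] f) : Spatial n f' z := by
  refine ⟨h.1.congr he, ?_⟩
  filter_upwards [h.2, he.eventually_nhds] with w h1 h2 i j hij
  rw [lineDeriv_congr h2, h1 i j hij]

theorem mono (h : Spatial n f z) (hnm : n ≤ m) : Spatial m f z :=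
  ⟨h.1, h.2.mono fun _ hw i j hij => hw i j (hij.imp_right hnm.trans_lt)⟩

theorem lower (h : Spatial (n + 1) f z)
    (h0 : ∀ᶠ w in 𝓝 z, lineDeriv ℝ f w (eu 0 (n + 1)) = 0) : Spatial n f z := by
  refine ⟨h.1, ?_⟩
  filter_upwards [h.2, h0] with w h1 h2 i j hij
  by_cases hi : i = 0
  · subst hi
    rcases hij with hij | hij
    · exact absurd rfl hij
    · rcases Nat.lt_or_ge (n + 1) j with hj | hj
      · exact h1 0 j (Or.inr hj)
      · obtain rfl : j = n + 1 := by omega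
        exact h2
  · exact h1 i j (Or.inl hi)

theorem add (h : Spatial n f z) (h' : Spatial n f' z) : Spatial n (fun w => f w + f' w) z := by
  refine ⟨h.1.add h'.1, ?_⟩
  filter_upwards [h.eventually, h'.eventually] with w h1 h2 i j hij
  rw [h1.1.lineDeriv_add h2.1, h1.zero hij, h2.zero hij, add_zero]

theorem sub (h : Spatial n f z) (h' : Spatial n f' z) : Spatial n (fun w => f w - f' w) z := by
  refine ⟨h.1.sub h'.1, ?_⟩
  filter_upwards [h.eventually, h'.eventually] with w h1 h2 i j hij
  rw [h1.1.lineDeriv_sub h2.1, h1.zero hij, h2.zero hij, sub_zero]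

theorem mul (h : Spatial n f z) (h' : Spatial n f' z) : Spatial n (fun w => f w * f' w) z := by
  refine ⟨h.1.mul h'.1, ?_⟩
  filter_upwards [h.eventually, h'.eventually] with w h1 h2 i j hij
  rw [h1.1.lineDeriv_mul h2.1, h1.zero hij, h2.zero hij, zero_mul, mul_zero, add_zero]

theorem const (c : ℝ) (z : Jet) : Spatial n (fun _ => c) z :=
  ⟨smoothAt_const c z, Filter.Eventually.of_forall fun _ _ _ _ => lineDeriv_fun_const _ _ _⟩

theorem pderiv (h : Spatial n f z) (v : Jet) : Spatial n (fun w => lineDeriv ℝ f w v) z := by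
  refine ⟨h.1.lineDeriv_const v, ?_⟩
  filter_upwards [h.eventually] with w hw i j hij
  rw [hw.1.lineDeriv_const_comm, lineDeriv_congr (hw.eventuallyEq_zero hij), lineDeriv_fun_const]

theorem Dx (h : Spatial n f z) : Spatial (n + 1) (Dx f) z := by
  refine ⟨h.1.Dx, ?_⟩
  filter_upwards [h.eventually] with w hw i j hij
  cases j with
  | zero =>
    have hi : i ≠ 0 ∨ n < 0 := by omega
    rw [hw.1.lineDeriv_Dx_zero, EvolCL.Dx, lineDeriv_congr (hw.eventuallyEq_zero hi),
      lineDeriv_fun_const]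
  | succ j =>
    rw [hw.1.lineDeriv_Dx_succ, EvolCL.Dx,
      lineDeriv_congr (hw.eventuallyEq_zero (j := j + 1) (by omega)),
      lineDeriv_fun_const, hw.zero (by omega), add_zero]

/-- The total `x`-derivative raises the order by one; its derivative with respect to the new
top variable is the old top derivative. -/
theorem lineDeriv_Dx_top (h : Spatial n f z) :
    lineDeriv ℝ (EvolCL.Dx f) z (eu 0 (n + 1)) = lineDeriv ℝ f z (eu 0 n) := by
  rw [h.1.lineDeriv_Dx_succ, EvolCL.Dx, lineDeriv_congr (h.eventuallyEq_zero (by omega)),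
      lineDeriv_fun_const, zero_add]

variable {L : Equation}

theorem _root_.EvolCL.Equation.spatial_rhsX (hz : z ∈ L.jetDom) (k : ℕ) :
    Spatial (k + 2) (L.rhsX k) z := by
  induction k with
  | zero =>
    refine ⟨Equation.smoothAt_rhs hz, ?_⟩
    filter_upwards [Equation.isOpen_jetDom.mem_nhds hz] with w hw i j hij
    have h := lineDeriv_comp_toJ2 (Equation.differentiableAt_H (L := L) hw) (eu i j)
    have hne : ∀ b ≤ 2, ¬(0 = i ∧ b = j) := by omega
    have h0 : toJ2 (eu i j) = 0 := by
      simp [toJ2, eu, hne 0 (by norm_num), hne 1 (by norm_num), hne 2 le_rfl]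
    rw [h0, map_zero] at h
    exact h
  | succ k ih =>
    rw [Equation.rhsX_succ]
    exact ih.Dx

theorem DtE (h : Spatial n f z) (hz : z ∈ L.jetDom) : Spatial (n + 2) (L.DtE f) z := by
  refine ⟨h.1.DtE hz, ?_⟩
  filter_upwards [h.eventually, Equation.isOpen_jetDom.mem_nhds hz] with w hw hwD i j hij
  have hij' : i ≠ 0 ∨ n < j := by omega
  rw [Equation.lineDeriv_DtE hw.1 hwD, Equation.DtE, lineDeriv_congr (hw.eventuallyEq_zero hij'),
    lineDeriv_fun_const, zero_add, hw.1.lineDeriv_congr_dir (v' := 0) (by rfl) (by rfl), lineDeriv_zero]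
  intro a b
  by_cases hab : a ≠ 0 ∨ n < b
  · exact Or.inr (hw.zero hab)
  · left
    have hs := (Equation.spatial_rhsX hwD b).zero (i := i) (j := j) (by omega)
    simp [hs]

/-- A smooth function of `t`, `x` and the `u_{0j}` has finite order. -/
theorem exists_of_smoothAt (h : SmoothAt f z)
    (h0 : ∀ᶠ w in 𝓝 z, ∀ i j, i ≠ 0 → lineDeriv ℝ f w (eu i j) = 0) : ∃ n, Spatial n f z := by
  obtain ⟨n, g, hg⟩ := h
  refine ⟨n, ⟨n, g, hg⟩, ?_⟩
  filter_upwards [h0, hg.eventually] with w h1 h2 i j hij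
  rcases hij with hi | hj
  · exact h1 i j hi
  · rw [h2.1.lineDeriv_eq]
    have : trunc n (eu i j) = 0 := by
      refine Prod.ext rfl (Prod.ext rfl ?_)
      ext a b
      have hb : (b : ℕ) ≠ j := by omega
      simp [trunc, eu, hb]
    rw [this, map_zero]

end Spatial

/-! ### Reduction to finitely many variables -/

/-- The variables `t`, `x` and `u_{0j}`, `j ≤ n`. -/
abbrev RowSpace (n : ℕ) := ℝ × ℝ × (Fin (n + 1) → ℝ)

/-- The projection of jets to the variables `t`, `x`, `u_{0j}`, `j ≤ n`. -/
def row (n : ℕ) (w : Jet) : RowSpace n := (w.1, w.2.1, fun j => w.2.2 0 j)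

/-- The section of `row n` with the remaining coordinates taken from `z`. -/
def rowIns (n : ℕ) (z : Jet) (y : RowSpace n) : Jet :=
  (y.1, y.2.1, fun i j => if h : i = 0 ∧ j < n + 1 then y.2.2 ⟨j, h.2⟩ else z.2.2 i j)

theorem smoothAt_row (n : ℕ) (z : Jet) : SmoothAt (row n) z :=
  (smoothAt_t z).prodMk ((smoothAt_x z).prodMk (smoothAt_pi fun j => smoothAt_u 0 j z))

theorem rowIns_row (n : ℕ) (z : Jet) : rowIns n z (row n z) = z := by
  refine Prod.ext rfl (Prod.ext rfl ?_)
  funext i j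
  by_cases h : i = 0 ∧ j < n + 1
  · simp only [rowIns, row, h, and_self, dite_true]
  · simp only [rowIns, h, dite_false]

theorem contDiff_trunc_rowIns (n m : ℕ) (z : Jet) :
    ContDiff ℝ ∞ fun y : RowSpace n => trunc m (rowIns n z y) := by
  refine contDiff_fst.prodMk (contDiff_snd.fst.prodMk ?_)
  refine contDiff_pi.2 fun i => contDiff_pi.2 fun j => ?_
  by_cases h : (i : ℕ) = 0 ∧ (j : ℕ) < n + 1
  · simp only [rowIns, h, and_self, dite_true]
    fun_prop
  · simp only [rowIns, h, dite_false]
    fun_prop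

theorem continuous_row (n : ℕ) : Continuous (row n) := by
  unfold row
  fun_prop

theorem continuous_rowIns (n : ℕ) (z : Jet) : Continuous (rowIns n z) := by
  refine continuous_fst.prodMk (continuous_snd.fst.prodMk ?_)
  refine continuous_pi fun i => continuous_pi fun j => ?_
  by_cases h : i = 0 ∧ j < n + 1
  · simp only [h, and_self, dite_true]
    fun_prop
  · simp only [h, dite_false]
    fun_prop

theorem hasDerivAt_row (n : ℕ) (z v : Jet) :
    HasDerivAt (fun s : ℝ => row n (z + s • v)) (row n v) 0 := by
  have h : HasDerivAt (fun s : ℝ => row n z + s • row n v) ((1 : ℝ) • row n v) 0 :=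
    ((hasDerivAt_id (0 : ℝ)).smul_const (row n v)).const_add (row n z)
  rw [one_smul] at h
  exact h

theorem lineDeriv_comp_row {n : ℕ} {g : RowSpace n → ℝ} {z : Jet}
    (hg : DifferentiableAt ℝ g (row n z)) (v : Jet) :
    lineDeriv ℝ (fun w => g (row n w)) z v = fderiv ℝ g (row n z) (row n v) := by
  rw [(smoothAt_row n z).lineDeriv_comp hg, lineDeriv_eq_of_hasDerivAt (hasDerivAt_row n z v)]

theorem row_eu_eq_zero {n i j : ℕ} (h : i ≠ 0 ∨ n < j) : row n (eu i j) = 0 := by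
  refine Prod.ext rfl (Prod.ext rfl ?_)
  ext b
  simp only [row, eu, Prod.snd_zero, Pi.zero_apply, ite_eq_right_iff]
  omega

theorem spatial_comp_row {n : ℕ} {g : RowSpace n → ℝ} {U : Set (RowSpace n)} {z : Jet}
    (hU : IsOpen U) (hz : row n z ∈ U) (hg : ContDiffOn ℝ ∞ g U) :
    Spatial n (fun w => g (row n w)) z := by
  refine ⟨SmoothAt.comp hU hz hg (smoothAt_row n z), ?_⟩
  filter_upwards [(hU.preimage (continuous_row n)).mem_nhds hz] with w hw i j hij
  rw [lineDeriv_comp_row ((hg.contDiffAt (hU.mem_nhds hw)).differentiableAt (by simp)),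
    row_eu_eq_zero hij, map_zero]

theorem Spatial.exists_rep {n : ℕ} {f : Jet → ℝ} {z : Jet} (h : Spatial n f z) :
    ∃ (g : RowSpace n → ℝ) (U : Set (RowSpace n)), IsOpen U ∧ row n z ∈ U ∧ ContDiffOn ℝ ∞ g U ∧
      ∀ᶠ w in 𝓝 z, f w = g (row n w) := by
  obtain ⟨N, r, hr, hbox⟩ := exists_box_subset h.eventually
  refine ⟨fun y => f (rowIns n z y), rowIns n z ⁻¹' box N z r,
    (isOpen_box N z r).preimage (continuous_rowIns n z), ?_, fun y hy => ?_, ?_⟩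
  · rw [Set.mem_preimage, rowIns_row]
    exact mem_box_self N z hr
  · obtain ⟨m, g, hg⟩ := (hbox hy).1
    have h1 : ContDiffAt ℝ ∞ (fun y => g (trunc m (rowIns n z y))) y :=
      ContDiffAt.comp y hg.contDiffAt (contDiff_trunc_rowIns n m z).contDiffAt
    refine (h1.congr_of_eventuallyEq ?_).contDiffWithinAt
    exact ((continuous_rowIns n z).continuousAt.eventually hg.eventually).mono fun y' hy' => hy'.2
  · have hcont : ContinuousAt (fun w => rowIns n z (row n w)) z :=
      ((continuous_rowIns n z).comp (continuous_row n)).continuousAt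
    have hmem : ∀ᶠ w in 𝓝 z, rowIns n z (row n w) ∈ box N z r := by
      refine hcont.eventually ?_
      simp only [rowIns_row]
      exact (isOpen_box N z r).mem_nhds (mem_box_self N z hr)
    filter_upwards [hmem, (isOpen_box N z r).mem_nhds (mem_box_self N z hr)] with w h1 h2
    have hseg : ∀ s ∈ Set.Icc (0 : ℝ) 1,
        rowIns n z (row n w) + s • (w - rowIns n z (row n w)) ∈ box N z r := by
      intro s hs
      exact (convex_box N z r).add_smul_sub_mem h1 h2 hs
    refine eq_of_lineDeriv_eq_zero (fun s hs => (hbox (hseg s hs)).1) fun s hs => ?_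
    rw [(hbox (hseg s hs)).1.lineDeriv_congr_dir (v' := 0) (by simp [rowIns, row])
      (by simp [rowIns, row]), lineDeriv_zero]
    intro i j
    by_cases hij : i ≠ 0 ∨ n < j
    · exact Or.inr ((hbox (hseg s hs)).zero hij)
    · left
      have hij' : i = 0 ∧ j < n + 1 := by omega
      simp only [rowIns, row, hij', and_self, dite_true, Prod.snd_sub, Pi.sub_apply, sub_self]
      rfl

theorem Spatial.exists_primitive {n : ℕ} {a : Jet → ℝ} {z : Jet} (h : Spatial n a z) :
    ∃ Φ : Jet → ℝ, Spatial n Φ z ∧ ∀ᶠ w in 𝓝 z, lineDeriv ℝ Φ w (eu 0 n) = a w := by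
  obtain ⟨g, U, hU, hz, hg, hag⟩ := h.exists_rep
  let φ : RowSpace n →L[ℝ] ℝ := (ContinuousLinearMap.proj (Fin.last n)).comp
    ((ContinuousLinearMap.snd ℝ ℝ _).comp (ContinuousLinearMap.snd ℝ ℝ _))
  obtain ⟨P, hP, hPg⟩ := exists_smooth_primitive hU hz hg (e := row n (eu 0 n)) (φ := φ)
    (by simp [φ, row, eu])
  refine ⟨fun w => P (row n w), spatial_comp_row isOpen_univ trivial hP.contDiffOn, ?_⟩
  filter_upwards [(continuous_row n).continuousAt.eventually hPg, hag] with w h1 h2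
  rw [lineDeriv_comp_row (hP.differentiable (by simp) _), h1, h2]

/-! ### Reduction of the order of conserved densities -/

namespace Equation

variable {L : Equation} {z : Jet}

/-- The derivative of the right-hand side with respect to `u_{0j}`. -/
noncomputable def dRhs (L : Equation) (j : ℕ) (w : Jet) : ℝ := lineDeriv ℝ L.rhs w (eu 0 j)

theorem dRhs_eq {w : Jet} (hw : w ∈ L.jetDom) :
    L.dRhs 2 w = fderiv ℝ L.H (toJ2 w) (0, 0, 0, 0, 1) := by
  have h := lineDeriv_comp_toJ2 (differentiableAt_H (L := L) hw) (eu 0 2)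
  have h0 : toJ2 (eu 0 2) = (0, 0, 0, 0, 1) := by simp [toJ2, eu]
  rw [h0] at h
  exact h

theorem dRhs_ne_zero {w : Jet} (hw : w ∈ L.jetDom) : L.dRhs 2 w ≠ 0 := by
  rw [dRhs_eq hw]
  exact L.nondeg _ hw

theorem spatial_rhs (hz : z ∈ L.jetDom) : Spatial 2 L.rhs z := spatial_rhsX hz 0

theorem spatial_dRhs (hz : z ∈ L.jetDom) (j : ℕ) : Spatial 2 (L.dRhs j) z :=
  (spatial_rhs hz).pderiv _

theorem lineDeriv_rhsX_top (hz : z ∈ L.jetDom) (k : ℕ) :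
    lineDeriv ℝ (L.rhsX k) z (eu 0 (k + 2)) = L.dRhs 2 z := by
  induction k with
  | zero => rfl
  | succ k ih => rw [rhsX_succ, (spatial_rhsX hz k).lineDeriv_Dx_top, ih]

theorem lineDeriv_rhsX_sub (hz : z ∈ L.jetDom) (k : ℕ) :
    lineDeriv ℝ (L.rhsX k) z (eu 0 (k + 1)) = L.dRhs 1 z + k * Dx (L.dRhs 2) z := by
  induction k with
  | zero => simp [dRhs, rhsX]
  | succ k ih =>
    have h1 : (fun w => lineDeriv ℝ (L.rhsX k) w (eu 0 (k + 1 + 1))) =ᶠ[𝓝 z] L.dRhs 2 :=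
      Filter.eventually_of_mem (isOpen_jetDom.mem_nhds hz) fun w hw => lineDeriv_rhsX_top hw k
    rw [rhsX_succ, (smoothAt_rhsX hz k).lineDeriv_Dx_succ, ih, Dx, lineDeriv_congr h1, Dx]
    push_cast
    ring

/-- `DtE F + Dx G = 0` near `z`: the conservation law restricted to the solution jets. -/
def Conserved (L : Equation) (F G : Jet → ℝ) (z : Jet) : Prop :=
  ∀ᶠ w in 𝓝 z, L.DtE F w + Dx G w = 0

/-- The conservation law differentiated in a constant direction. -/
theorem Conserved.lineDeriv {F G : Jet → ℝ} (h : L.Conserved F G z) (hz : z ∈ L.jetDom)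
    (hF : SmoothAt F z) (hG : SmoothAt G z) (v : Jet) :
    L.DtE (fun w => lineDeriv ℝ F w v) z +
      lineDeriv ℝ F z (0, 0, fun i j => if i = 0 then lineDeriv ℝ (L.rhsX j) z v else 0) +
      lineDeriv ℝ (Dx G) z v = 0 := by
  rw [← lineDeriv_DtE hF hz, ← (hF.DtE hz).lineDeriv_add hG.Dx, lineDeriv_congr h,
    lineDeriv_fun_const]

variable {F G : Jet → ℝ} {n m : ℕ}

theorem Conserved.eventually (h : L.Conserved F G z) : ∀ᶠ w in 𝓝 z, L.Conserved F G w :=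
  h.eventually_nhds

/-- If the density has order `n`, the flux has order at most `n + 1`: otherwise its top derivative
enters `D_x G` in an order that nothing compensates. -/
theorem Conserved.spatial_flux (h : L.Conserved F G z) (hz : z ∈ L.jetDom) (hF : Spatial n F z)
    (hG : Spatial m G z) : Spatial (n + 1) G z := by
  induction m with
  | zero => exact hG.mono (by omega)
  | succ m ih =>
    rcases Nat.lt_or_ge (n + 1) (m + 1) with hnm | hnm
    · refine ih (hG.lower ?_)
      filter_upwards [h.eventually, hF.eventually, hG.eventually, isOpen_jetDom.mem_nhds hz]
        with w h1 h2 h3 h4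
      have h5 := h1.lineDeriv h4 h2.1 h3.1 (eu 0 (m + 1 + 1))
      have hdir : ∀ i j, (if i = 0 then _root_.lineDeriv ℝ (L.rhsX j) w (eu 0 (m + 1 + 1)) else 0) =
          (0 : ℝ) ∨ _root_.lineDeriv ℝ F w (eu i j) = 0 := by
        intro i j
        by_cases hij : i ≠ 0 ∨ n < j
        · exact Or.inr (h2.zero hij)
        · left
          rw [(spatial_rhsX h4 j).zero (by omega), ite_self]
      rw [h2.1.lineDeriv_congr_dir (v' := 0) (by simp) (by simp) hdir, lineDeriv_zero,
        h3.lineDeriv_Dx_top,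
        DtE, lineDeriv_congr (h2.eventuallyEq_zero (by omega)), lineDeriv_fun_const, zero_add,
        zero_add] at h5
      exact h5
    · exact hG.mono hnm

/-- The coefficient of `u_{0,n+2}` in a conservation law whose density has order `n`. -/
theorem Conserved.top (h : L.Conserved F G z) (hz : z ∈ L.jetDom) (hF : Spatial n F z)
    (hG : Spatial (n + 1) G z) :
    _root_.lineDeriv ℝ F z (eu 0 n) * L.dRhs 2 z + _root_.lineDeriv ℝ G z (eu 0 (n + 1)) = 0 := by
  have h5 := h.lineDeriv hz hF.1 hG.1 (eu 0 (n + 1 + 1))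
  have hdir : ∀ i j, (if i = 0 then _root_.lineDeriv ℝ (L.rhsX j) z (eu 0 (n + 1 + 1)) else 0) =
      (L.dRhs 2 z • eu 0 n).2.2 i j ∨ _root_.lineDeriv ℝ F z (eu i j) = 0 := by
    intro i j
    by_cases hij : i ≠ 0 ∨ n < j
    · exact Or.inr (hF.zero hij)
    · left
      obtain ⟨rfl, hj⟩ : i = 0 ∧ j ≤ n := by omega
      rcases hj.lt_or_eq with hj | rfl
      · rw [(spatial_rhsX hz j).zero (by omega), ite_self]
        simp [eu, hj.ne]
      · rw [lineDeriv_rhsX_top hz]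
        simp [eu]
  rw [hF.1.lineDeriv_congr_dir (v' := L.dRhs 2 z • eu 0 n) (by simp [eu]) (by simp [eu]) hdir,
    hF.1.lineDeriv_dir_smul, hG.lineDeriv_Dx_top, DtE,
    lineDeriv_congr (hF.eventuallyEq_zero (by omega)), lineDeriv_fun_const, zero_add,
    smul_eq_mul] at h5
  linarith

/-- The derivative of a conservation law by the second highest variable, `u_{0,n+2}` for a density
of order `n + 1`. -/
theorem Conserved.second (h : L.Conserved F G z) (hz : z ∈ L.jetDom) (hF : Spatial (n + 1) F z)
    (hG : Spatial (n + 2) G z) :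
    _root_.lineDeriv ℝ F z (eu 0 (n + 1)) * (L.dRhs 1 z + (n + 1) * Dx (L.dRhs 2) z) +
      _root_.lineDeriv ℝ F z (eu 0 n) * L.dRhs 2 z +
      Dx (fun w => _root_.lineDeriv ℝ G w (eu 0 (n + 2))) z +
      _root_.lineDeriv ℝ G z (eu 0 (n + 1)) = 0 := by
  have h5 := h.lineDeriv hz hF.1 hG.1 (eu 0 (n + 1 + 1))
  have hdir : ∀ i j, (if i = 0 then _root_.lineDeriv ℝ (L.rhsX j) z (eu 0 (n + 1 + 1)) else 0) =
      ((L.dRhs 1 z + (n + 1) * Dx (L.dRhs 2) z) • eu 0 (n + 1) +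
        L.dRhs 2 z • eu 0 n).2.2 i j ∨ _root_.lineDeriv ℝ F z (eu i j) = 0 := by
    intro i j
    by_cases hij : i ≠ 0 ∨ n + 1 < j
    · exact Or.inr (hF.zero hij)
    · left
      obtain ⟨rfl, hj⟩ : i = 0 ∧ j ≤ n + 1 := by omega
      rcases hj.lt_or_eq with hj | rfl
      · rcases (Nat.le_of_lt_succ hj).lt_or_eq with hj | rfl
        · rw [(spatial_rhsX hz j).zero (by omega), ite_self]
          have : j ≠ n + 1 := by omega
          simp [eu, hj.ne, this]
        · rw [lineDeriv_rhsX_top hz]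
          simp [eu]
      · rw [lineDeriv_rhsX_sub hz]
        simp [eu]
  rw [hF.1.lineDeriv_congr_dir (v' := (L.dRhs 1 z + (n + 1) * Dx (L.dRhs 2) z) • eu 0 (n + 1) +
        L.dRhs 2 z • eu 0 n) (by simp [eu]) (by simp [eu]) hdir,
    hF.1.lineDeriv_dir_add, hF.1.lineDeriv_dir_smul, hF.1.lineDeriv_dir_smul,
    hG.1.lineDeriv_Dx_succ, DtE,
    lineDeriv_congr (hF.eventuallyEq_zero (by omega)), lineDeriv_fun_const, zero_add,
    smul_eq_mul, smul_eq_mul] at h5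
  linarith

/-- Conserved densities of order at least two are affine in the highest derivative: the derivative
of `Conserved.second` with respect to the top variable contains the second derivative of the density
twice, once through the flux, with coefficient `H_{u_xx} ≠ 0`. -/
theorem Conserved.affine (h : L.Conserved F G z) (hz : z ∈ L.jetDom) (hF : Spatial (n + 2) F z)
    (hG : Spatial (n + 3) G z) :
    _root_.lineDeriv ℝ (fun w => _root_.lineDeriv ℝ F w (eu 0 (n + 2))) z (eu 0 (n + 2)) = 0 := by
  have hev := (h.eventually.and (hF.eventually.and (hG.eventually.and
    (isOpen_jetDom.mem_nhds hz : ∀ᶠ w in 𝓝 z, w ∈ L.jetDom))))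
  have hsec : (fun w => _root_.lineDeriv ℝ F w (eu 0 (n + 2)) *
      (L.dRhs 1 w + ((n + 1 : ℕ) + 1) * Dx (L.dRhs 2) w) +
      _root_.lineDeriv ℝ F w (eu 0 (n + 1)) * L.dRhs 2 w +
      Dx (fun w => _root_.lineDeriv ℝ G w (eu 0 (n + 3))) w +
      _root_.lineDeriv ℝ G w (eu 0 (n + 2))) =ᶠ[𝓝 z] fun _ => 0 :=
    hev.mono fun w hw => hw.1.second hw.2.2.2 hw.2.1 hw.2.2.1
  have htop : (fun w => _root_.lineDeriv ℝ G w (eu 0 (n + 3))) =ᶠ[𝓝 z]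
      fun w => -(_root_.lineDeriv ℝ F w (eu 0 (n + 2)) * L.dRhs 2 w) :=
    hev.mono fun w hw => by
      have := hw.1.top hw.2.2.2 hw.2.1 hw.2.2.1
      simp only
      linarith
  have hF' := hF.pderiv (eu 0 (n + 2))
  have hF'' := hF.pderiv (eu 0 (n + 1))
  have h1 := spatial_dRhs hz 1
  have h2 := spatial_dRhs hz 2
  have h2' : Spatial (n + 2) (L.dRhs 2) z := h2.mono (by omega)
  have hG' : Spatial (n + 2) (fun w => _root_.lineDeriv ℝ G w (eu 0 (n + 3))) z := by
    refine Spatial.congr ?_ htop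
    have := (Spatial.const (n := n + 2) 0 z).sub (hF'.mul h2')
    simpa using this
  have e1 : SmoothAt (fun w => L.dRhs 1 w + ((n + 1 : ℕ) + 1) * Dx (L.dRhs 2) w) z :=
    h1.1.add ((smoothAt_const _ z).mul h2.1.Dx)
  have e2 := hF'.1.mul e1
  have e3 := hF''.1.mul h2.1
  have e4 := hG'.1.Dx
  have e5 := hG.1.lineDeriv_const (eu 0 (n + 2))
  have key := lineDeriv_congr hsec (eu 0 (n + 3))
  have c1 : _root_.lineDeriv ℝ (fun w => _root_.lineDeriv ℝ F w (eu 0 (n + 2))) z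
      (eu 0 (n + 3)) = 0 := hF'.zero (by omega)
  have c2 : _root_.lineDeriv ℝ (fun w => _root_.lineDeriv ℝ F w (eu 0 (n + 1))) z
      (eu 0 (n + 3)) = 0 := hF''.zero (by omega)
  have c3 : _root_.lineDeriv ℝ (L.dRhs 2) z (eu 0 (n + 3)) = 0 := h2.zero (by omega)
  have c4 : _root_.lineDeriv ℝ (L.dRhs 1) z (eu 0 (n + 3)) = 0 := h1.zero (by omega)
  have c5 := hG'.lineDeriv_Dx_top
  have c6 := h2'.lineDeriv_Dx_top
  have c7 := lineDeriv_congr htop (eu 0 (n + 2))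
  rw [lineDeriv_fun_neg, hF'.1.lineDeriv_mul h2.1] at c7
  have c8 := hG.1.lineDeriv_const_comm (eu 0 (n + 2)) (eu 0 (n + 3))
  rw [((e2.add e3).add e4).lineDeriv_add e5, (e2.add e3).lineDeriv_add e4, e2.lineDeriv_add e3,
    hF'.1.lineDeriv_mul e1, hF''.1.lineDeriv_mul h2.1,
    h1.1.lineDeriv_add ((smoothAt_const _ z).mul h2.1.Dx),
    (smoothAt_const _ z).lineDeriv_mul h2.1.Dx, lineDeriv_fun_const, lineDeriv_fun_const, c1, c2,
    c3, c4, c5, c6, c8, c7] at key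
  -- `H_{u_xx}` depends on the top variable only if the latter is `u_xx`, that is, for `n = 0`.
  have c9 : (n : ℝ) * _root_.lineDeriv ℝ (L.dRhs 2) z (eu 0 (n + 2)) = 0 := by
    rcases Nat.eq_zero_or_pos n with hn | hn
    · simp [hn]
    · rw [h2.zero (by omega), mul_zero]
  push_cast at key
  have c10 : _root_.lineDeriv ℝ (fun w => _root_.lineDeriv ℝ F w (eu 0 (n + 2))) z
      (eu 0 (n + 2)) * L.dRhs 2 z = 0 := by
    linear_combination (-1 / 2) * key + (1 / 2) * _root_.lineDeriv ℝ F z (eu 0 (n + 2)) * c9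
  exact (mul_eq_zero.1 c10).resolve_right (dRhs_ne_zero hz)

/-- Subtraction of the null divergence `(D_x Φ, -D_t Φ)`. -/
theorem Conserved.sub_null (h : L.Conserved F G z) (hz : z ∈ L.jetDom) {Φ : Jet → ℝ}
    (hF : SmoothAt F z) (hG : SmoothAt G z) (hΦ : SmoothAt Φ z) :
    L.Conserved (fun w => F w - Dx Φ w) (fun w => G w + L.DtE Φ w) z := by
  filter_upwards [h, hF.eventually, hG.eventually, hΦ.eventually, isOpen_jetDom.mem_nhds hz]
    with w h1 h2 h3 h4 h5
  have e1 : L.DtE (fun w => F w - Dx Φ w) w = L.DtE F w - L.DtE (Dx Φ) w :=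
    h2.lineDeriv_sub h4.Dx _
  have e2 : Dx (fun w => G w + L.DtE Φ w) w = Dx G w + Dx (L.DtE Φ) w :=
    h3.lineDeriv_add (h4.DtE h5) _
  rw [e1, e2, Dx_DtE h4 h5]
  linarith

/-- Every conserved density of finite order is equivalent to one of order at most one. -/
theorem Conserved.exists_reduction (m : ℕ) : ∀ {F G : Jet → ℝ}, L.Conserved F G z →
    z ∈ L.jetDom → Spatial (m + 1) F z → Spatial (m + 2) G z →
    ∃ (F' G' Φ : Jet → ℝ) (k : ℕ), L.Conserved F' G' z ∧ Spatial 1 F' z ∧ Spatial 2 G' z ∧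
      Spatial k Φ z ∧ ∀ᶠ w in 𝓝 z, F w = F' w + Dx Φ w ∧ G w = G' w - L.DtE Φ w := by
  induction m with
  | zero =>
    intro F G h hz hF hG
    refine ⟨F, G, fun _ => 0, 0, h, hF, hG, Spatial.const 0 z, Filter.Eventually.of_forall ?_⟩
    intro w
    simp [Dx, DtE, lineDeriv_fun_const]
  | succ m ih =>
    intro F G h hz hF hG
    have ha : Spatial (m + 1) (fun w => _root_.lineDeriv ℝ F w (eu 0 (m + 2))) z := by
      refine (hF.pderiv _).lower ?_
      filter_upwards [h.eventually, hF.eventually, hG.eventually, isOpen_jetDom.mem_nhds hz]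
        with w h1 h2 h3 h4
      exact h1.affine h4 h2 h3
    obtain ⟨Φ, hΦ, hΦa⟩ := ha.exists_primitive
    have hF1 : Spatial (m + 1) (fun w => F w - Dx Φ w) z := by
      refine (hF.sub hΦ.Dx).lower ?_
      filter_upwards [hF.eventually, hΦ.eventually, hΦa] with w h1 h2 h3
      rw [h1.1.lineDeriv_sub h2.1.Dx, h2.lineDeriv_Dx_top, h3, sub_self]
    have hcons := h.sub_null hz hF.1 hG.1 hΦ.1
    have hG1 : Spatial (m + 2) (fun w => G w + L.DtE Φ w) z :=
      hcons.spatial_flux hz hF1 (hG.add (hΦ.DtE hz))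
    obtain ⟨F', G', Ψ, k, h1, h2, h3, h4, h5⟩ := ih hcons hz hF1 hG1
    refine ⟨F', G', fun w => Φ w + Ψ w, max (m + 1) k, h1, h2, h3,
      (hΦ.mono (le_max_left _ _)).add (h4.mono (le_max_right _ _)), ?_⟩
    filter_upwards [h5, hΦ.eventually, h4.eventually] with w h6 h7 h8
    have e1 : Dx (fun w => Φ w + Ψ w) w = Dx Φ w + Dx Ψ w := h7.1.lineDeriv_add h8.1 _
    have e2 : L.DtE (fun w => Φ w + Ψ w) w = L.DtE Φ w + L.DtE Ψ w := h7.1.lineDeriv_add h8.1 _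
    rw [e1, e2]
    exact ⟨by linarith [h6.1], by linarith [h6.2]⟩

end Equation

/-! ### Functions of `(t, x, u, u_x)` -/

/-- The derivative of a function of `(t, x, u, u_x)` in the direction `v`; the partial derivatives
`pt`, `px`, `pu`, `pp` are the special cases of coordinate directions. -/
noncomputable def pd (v : J1) (f : J1 → ℝ) (y : J1) : ℝ := fderiv ℝ f y v

theorem pt_eq (f : J1 → ℝ) : pt f = pd (1, 0, 0, 0) f := rfl
theorem px_eq (f : J1 → ℝ) : px f = pd (0, 1, 0, 0) f := rfl
theorem pu_eq (f : J1 → ℝ) : pu f = pd (0, 0, 1, 0) f := rfl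
theorem pp_eq (f : J1 → ℝ) : pp f = pd (0, 0, 0, 1) f := rfl

theorem fderiv_J1_apply (f : J1 → ℝ) (y v : J1) : fderiv ℝ f y v =
    v.1 * pt f y + v.2.1 * px f y + v.2.2.1 * pu f y + v.2.2.2 * pp f y := by
  have hv : v = v.1 • ((1, 0, 0, 0) : J1) + v.2.1 • ((0, 1, 0, 0) : J1) +
      v.2.2.1 • ((0, 0, 1, 0) : J1) + v.2.2.2 • ((0, 0, 0, 1) : J1) := by
    simp
  nth_rewrite 1 [hv]
  simp only [map_add, map_smul, smul_eq_mul]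
  rfl

section pd

variable {f g : J1 → ℝ} {y : J1} {N : Set J1}

theorem pd_congr (h : f =ᶠ[𝓝 y] g) (v : J1) : pd v f y = pd v g y := by
  rw [pd, pd, h.fderiv_eq]

theorem pd_congr_on (hN : IsOpen N) (hy : y ∈ N) (h : ∀ y ∈ N, f y = g y) (v : J1) :
    pd v f y = pd v g y :=
  pd_congr (Filter.eventually_of_mem (hN.mem_nhds hy) h) v

theorem pd_add (hf : DifferentiableAt ℝ f y) (hg : DifferentiableAt ℝ g y) (v : J1) :
    pd v (fun y => f y + g y) y = pd v f y + pd v g y := by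
  rw [pd, fderiv_fun_add hf hg]
  rfl

theorem pd_sub (hf : DifferentiableAt ℝ f y) (hg : DifferentiableAt ℝ g y) (v : J1) :
    pd v (fun y => f y - g y) y = pd v f y - pd v g y := by
  rw [pd, fderiv_fun_sub hf hg]
  rfl

theorem pd_neg (v : J1) : pd v (fun y => -f y) y = -pd v f y := by
  rw [pd, fderiv_fun_neg]
  rfl

theorem pd_mul (hf : DifferentiableAt ℝ f y) (hg : DifferentiableAt ℝ g y) (v : J1) :
    pd v (fun y => f y * g y) y = pd v f y * g y + f y * pd v g y := by
  rw [pd, fderiv_fun_mul hf hg]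
  simp only [add_apply, smul_apply, smul_eq_mul, pd]
  ring

theorem pd_const (c : ℝ) (v : J1) : pd v (fun _ => c) y = 0 := by
  simp [pd]

theorem pd_coord_t (v : J1) : pd v (fun y => y.1) y = v.1 := by
  rw [pd, fderiv_fst]
  rfl

theorem pd_coord_x (v : J1) : pd v (fun y => y.2.1) y = v.2.1 := by
  have h : HasFDerivAt (fun y : J1 => y.2.1) ((ContinuousLinearMap.fst ℝ ℝ (ℝ × ℝ)).comp
      (ContinuousLinearMap.snd ℝ ℝ (ℝ × ℝ × ℝ))) y := hasFDerivAt_snd.fst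
  rw [pd, h.fderiv]
  rfl

theorem pd_coord_u (v : J1) : pd v (fun y => y.2.2.1) y = v.2.2.1 := by
  have h : HasFDerivAt (fun y : J1 => y.2.2.1) ((ContinuousLinearMap.fst ℝ ℝ ℝ).comp
      ((ContinuousLinearMap.snd ℝ ℝ (ℝ × ℝ)).comp
      (ContinuousLinearMap.snd ℝ ℝ (ℝ × ℝ × ℝ)))) y := hasFDerivAt_snd.snd.fst
  rw [pd, h.fderiv]
  rfl

theorem pd_coord_p (v : J1) : pd v (fun y => y.2.2.2) y = v.2.2.2 := by
  have h : HasFDerivAt (fun y : J1 => y.2.2.2) ((ContinuousLinearMap.snd ℝ ℝ ℝ).comp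
      ((ContinuousLinearMap.snd ℝ ℝ (ℝ × ℝ)).comp
      (ContinuousLinearMap.snd ℝ ℝ (ℝ × ℝ × ℝ)))) y := hasFDerivAt_snd.snd.snd
  rw [pd, h.fderiv]
  rfl

theorem contDiffOn_pd (hN : IsOpen N) (hf : ContDiffOn ℝ ∞ f N) (v : J1) :
    ContDiffOn ℝ ∞ (pd v f) N :=
  (hf.fderiv_of_isOpen hN (by simp)).clm_apply contDiffOn_const

theorem differentiableAt_of_contDiffOn {E F : Type*} [NormedAddCommGroup E] [NormedSpace ℝ E]
    [NormedAddCommGroup F] [NormedSpace ℝ F] {f : E → F} {N : Set E} {y : E} (hN : IsOpen N)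
    (hf : ContDiffOn ℝ ∞ f N) (hy : y ∈ N) : DifferentiableAt ℝ f y :=
  (hf.contDiffAt (hN.mem_nhds hy)).differentiableAt (by simp)

theorem pd_comm (hN : IsOpen N) (hf : ContDiffOn ℝ ∞ f N) (hy : y ∈ N) (v v' : J1) :
    pd v (pd v' f) y = pd v' (pd v f) y := by
  have hsymm : IsSymmSndFDerivAt ℝ f y := (hf.contDiffAt (hN.mem_nhds hy)).isSymmSndFDerivAt (by
    rw [minSmoothness_of_isRCLikeNormedField]
    exact WithTop.coe_le_coe.2 le_top)
  have hd : DifferentiableAt ℝ (fderiv ℝ f) y :=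
    differentiableAt_of_contDiffOn hN (hf.fderiv_of_isOpen hN (by simp)) hy
  have h : ∀ a b : J1, pd a (pd b f) y = fderiv ℝ (fderiv ℝ f) y a b := by
    intro a b
    change fderiv ℝ (fun y => fderiv ℝ f y b) y a = _
    rw [fderiv_clm_apply hd (differentiableAt_const b)]
    simp
  rw [h, h, hsymm v v']

end pd

/-- The part `(t, x, u, u_x)` of `(t, x, u, u_x, u_xx)`. -/
def J2.toJ1 (y : J2) : J1 := (y.1, y.2.1, y.2.2.1, y.2.2.2.1)

/-- The total `x`-derivative of a function of `(t, x, u, u_x)`. -/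
noncomputable def tdx (f : J1 → ℝ) (y : J2) : ℝ :=
  px f y.toJ1 + y.2.2.2.1 * pu f y.toJ1 + y.2.2.2.2 * pp f y.toJ1

theorem toJ1_toJ2 (w : Jet) : (toJ2 w).toJ1 = toJ1 w := rfl

theorem Dx_comp_toJ1 {f : J1 → ℝ} {w : Jet} (hf : DifferentiableAt ℝ f (toJ1 w)) :
    Dx (fun w => f (toJ1 w)) w = tdx f (toJ2 w) := by
  rw [Dx, lineDeriv_comp_toJ1 hf, fderiv_J1_apply]
  simp only [toJ1, vecX, tdx, toJ2, J2.toJ1]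
  ring

theorem Dt_comp_toJ1 {f : J1 → ℝ} {w : Jet} (hf : DifferentiableAt ℝ f (toJ1 w)) :
    Dt (fun w => f (toJ1 w)) w =
      pt f (toJ1 w) + w.2.2 1 0 * pu f (toJ1 w) + w.2.2 1 1 * pp f (toJ1 w) := by
  rw [Dt, lineDeriv_comp_toJ1 hf, fderiv_J1_apply]
  simp only [toJ1, vecT]
  ring

theorem smoothAt_comp_toJ1 {f : J1 → ℝ} {N : Set J1} (hN : IsOpen N) (hf : ContDiffOn ℝ ∞ f N)
    {w : Jet} (hw : toJ1 w ∈ N) : SmoothAt (fun w => f (toJ1 w)) w :=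
  SmoothAt.comp hN hw hf (smoothAt_toJ1 w)

/-- The section of `toJ2` with the remaining coordinates taken from `z`. -/
def insJ2 (z : Jet) (y : J2) : Jet :=
  (y.1, y.2.1, fun i j =>
    if i = 0 ∧ j = 0 then y.2.2.1 else if i = 0 ∧ j = 1 then y.2.2.2.1 else
      if i = 0 ∧ j = 2 then y.2.2.2.2 else z.2.2 i j)

theorem toJ2_insJ2 (z : Jet) (y : J2) : toJ2 (insJ2 z y) = y := by
  simp [toJ2, insJ2]

theorem insJ2_toJ2 (z : Jet) : insJ2 z (toJ2 z) = z := by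
  refine Prod.ext rfl (Prod.ext rfl ?_)
  funext i j
  simp only [insJ2, toJ2]
  split_ifs with h1 h2 h3
  · rw [h1.1, h1.2]
  · rw [h2.1, h2.2]
  · rw [h3.1, h3.2]
  · rfl

theorem continuous_insJ2 (z : Jet) : Continuous (insJ2 z) := by
  refine continuous_fst.prodMk (continuous_snd.fst.prodMk ?_)
  refine continuous_pi fun i => continuous_pi fun j => ?_
  split_ifs <;> fun_prop

theorem eventually_toJ2 {z : Jet} {p : J2 → Prop} (h : ∀ᶠ w in 𝓝 z, p (toJ2 w)) :
    ∀ᶠ y in 𝓝 (toJ2 z), p y := by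
  have h1 : Filter.Tendsto (insJ2 z) (𝓝 (toJ2 z)) (𝓝 z) := by
    have := (continuous_insJ2 z).tendsto (toJ2 z)
    rwa [insJ2_toJ2] at this
  filter_upwards [h1.eventually h] with y hy
  rwa [toJ2_insJ2] at hy

/-- A function of `t`, `x`, `u_{00}`, `u_{01}` factors through `toJ1`. -/
theorem Spatial.exists_rep_J1 {f : Jet → ℝ} {z : Jet} (h : Spatial 1 f z) :
    ∃ (g : J1 → ℝ) (N : Set J1), IsOpen N ∧ toJ1 z ∈ N ∧ ContDiffOn ℝ ∞ g N ∧
      ∀ᶠ w in 𝓝 z, f w = g (toJ1 w) := by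
  obtain ⟨g, U, hU, hz, hg, hfg⟩ := h.exists_rep
  let p : J1 → RowSpace 1 := fun y => (y.1, y.2.1, ![y.2.2.1, y.2.2.2])
  have hp : ContDiff ℝ ∞ p := by
    refine contDiff_fst.prodMk (contDiff_snd.fst.prodMk (contDiff_pi.2 fun i => ?_))
    fin_cases i
    · exact contDiff_snd.snd.fst
    · exact contDiff_snd.snd.snd
  have hpr : ∀ w, p (toJ1 w) = row 1 w := by
    intro w
    refine Prod.ext rfl (Prod.ext rfl ?_)
    ext i
    fin_cases i <;> rfl
  refine ⟨g ∘ p, p ⁻¹' U, hU.preimage hp.continuous, ?_, hg.comp hp.contDiffOn fun y hy => hy, ?_⟩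
  · rw [Set.mem_preimage, hpr]
    exact hz
  · filter_upwards [hfg] with w hw
    rw [hw, Function.comp_apply, hpr]

/-! ### The normal form of conserved vectors -/

namespace Equation

variable {L : Equation} {z : Jet}

theorem sol_eq {w : Jet} (hw : w ∈ L.sol) (j : ℕ) : w.2.2 1 j = L.rhsX j w := by
  have h := Dt_iterate_defect hw.1 0 j
  rw [hw.2 0 j] at h
  change 0 = w.2.2 1 j - L.rhsX j w at h
  linarith

theorem Dt_eq_DtE {n : ℕ} {f : Jet → ℝ} (hf : Spatial n f z) (hz : z ∈ L.sol) :
    Dt f z = L.DtE f z := by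
  refine hf.1.lineDeriv_congr_dir rfl rfl fun i j => ?_
  by_cases hi : i = 0
  · left
    subst hi
    exact sol_eq hz j
  · exact Or.inr (hf.zero (Or.inl hi))

theorem spatial_comp_solMap {f : Jet → ℝ} (hz : z ∈ L.sol) (hf : SmoothAt f z) :
    ∃ n, Spatial n (fun w => f (L.solMap w)) z := by
  have hs := solMap_eq_self hz
  refine Spatial.exists_of_smoothAt
    (SmoothAt.comp_field (by rwa [hs]) (smoothField_solMap hz.1)) ?_
  have h1 : ∀ᶠ w in 𝓝 z, SmoothAt f (L.solMap w) := by
    refine (continuousAt_solMap hz.1).eventually ?_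
    rw [hs]
    exact hf.eventually
  filter_upwards [h1, isOpen_jetDom.mem_nhds hz.1] with w h2 h3 i j hi
  have hrow : ∀ a b, lineDeriv ℝ (L.solCoord a b) w (eu i j) = 0 := by
    intro a b
    have hsp : Spatial (b + 2 * a) (L.solCoord a b) w := by
      induction a with
      | zero =>
        refine ⟨smoothAt_u 0 b w, Filter.Eventually.of_forall fun w' i' j' hij => ?_⟩
        change lineDeriv ℝ (fun w : Jet => w.2.2 0 b) w' (eu i' j') = 0
        rw [lineDeriv_u]
        simp only [eu, ite_eq_right_iff]
        omega
      | succ a ih =>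
        rw [solCoord_succ]
        exact (ih.DtE h3).mono (by omega)
    exact hsp.zero (Or.inl hi)
  rw [h2.lineDeriv_comp_field (smoothField_solMap h3)]
  have h0 : dField L.solMap w (eu i j) = 0 := by
    refine Prod.ext (lineDeriv_t _ _) (Prod.ext (lineDeriv_x _ _) ?_)
    funext a b
    exact hrow a b
  rw [h0, lineDeriv_zero]

/-- Every conserved vector is, near a solution jet and up to a trivial one, of the form
`(f, k - f_p H)` with functions `f`, `k` of `(t, x, u, u_x)`. -/
theorem exists_normal_form (hz : z ∈ L.sol) {F G : Jet → ℝ} (hF : SmoothAt F z)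
    (hG : SmoothAt G z) (hFG : ∀ᶠ w in 𝓝 z, w ∈ L.sol → Dt F w + Dx G w = 0) :
    ∃ (f k : J1 → ℝ) (N : Set J1) (Φ : Jet → ℝ), IsOpen N ∧ toJ1 z ∈ N ∧ ContDiffOn ℝ ∞ f N ∧
      ContDiffOn ℝ ∞ k N ∧ SmoothAt Φ z ∧
      (∀ᶠ w in 𝓝 z, w ∈ L.sol → F w = f (toJ1 w) + Dx Φ w ∧
        G w = k (toJ1 w) - pp f (toJ1 w) * L.rhs w - Dt Φ w) ∧
      ∀ᶠ y in 𝓝 (toJ2 z), pt f y.toJ1 + (pu f y.toJ1 - tdx (pp f) y) * L.H y + tdx k y = 0 := by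
  have hs := solMap_eq_self hz
  have hc : ContinuousAt L.solMap z := continuousAt_solMap hz.1
  obtain ⟨n, hn⟩ := spatial_comp_solMap hz hF
  obtain ⟨m, hm⟩ := spatial_comp_solMap hz hG
  have hcons : L.Conserved (fun w => F (L.solMap w)) (fun w => G (L.solMap w)) z := by
    have h1 : ∀ᶠ w in 𝓝 z, SmoothAt F (L.solMap w) ∧ SmoothAt G (L.solMap w) ∧
        (L.solMap w ∈ L.sol → Dt F (L.solMap w) + Dx G (L.solMap w) = 0) := by
      have h2 : ∀ᶠ w in 𝓝 (L.solMap z), SmoothAt F w ∧ SmoothAt G w ∧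
          (w ∈ L.sol → Dt F w + Dx G w = 0) := by
        rw [hs]
        exact hF.eventually.and (hG.eventually.and hFG)
      exact hc.eventually h2
    filter_upwards [h1, isOpen_jetDom.mem_nhds hz.1] with w hw hwD
    rw [DtE_comp_solMap hwD hw.1, Dx_comp_solMap hwD hw.2.1]
    exact hw.2.2 (solMap_mem_sol hwD)
  have hn' := hn.mono (Nat.le_add_right n 1)
  obtain ⟨F', G', Φ, l, h1, h2, h3, h4, h5⟩ := hcons.exists_reduction n hz.1 hn'
    (hcons.spatial_flux hz.1 hn' hm)
  obtain ⟨f, N₁, hN₁, hz₁, hf, hff⟩ := h2.exists_rep_J1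
  have hK : Spatial 1 (fun w => G' w + lineDeriv ℝ F' w (eu 0 1) * L.rhs w) z := by
    refine (h3.add (((h2.pderiv (eu 0 1)).mono one_le_two).mul (spatial_rhs hz.1))).lower ?_
    filter_upwards [h1.eventually, h2.eventually, h3.eventually, isOpen_jetDom.mem_nhds hz.1]
      with w e1 e2 e3 e4
    have e5 := e1.top e4 e2 e3
    have e6 := (e2.pderiv (eu 0 1)).zero (i := 0) (j := 1 + 1) (by omega)
    have e7 := smoothAt_rhs e4
    have e8 := e2.1.lineDeriv_const (eu 0 1)
    rw [e3.1.lineDeriv_add (e8.mul e7), e8.lineDeriv_mul e7, e6]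
    simp only [dRhs] at e5
    linarith
  obtain ⟨k, N₂, hN₂, hz₂, hk, hkk⟩ := hK.exists_rep_J1
  have hmem : ∀ᶠ w in 𝓝 z, toJ1 w ∈ N₁ ∩ N₂ :=
    continuous_toJ1.continuousAt.eventually ((hN₁.inter hN₂).mem_nhds ⟨hz₁, hz₂⟩)
  have hpp : ∀ᶠ w in 𝓝 z, lineDeriv ℝ F' w (eu 0 1) = pp f (toJ1 w) := by
    filter_upwards [hff.eventually_nhds, hmem] with w e1 e2
    rw [lineDeriv_congr e1, lineDeriv_comp_toJ1 (differentiableAt_of_contDiffOn hN₁ hf e2.1)]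
    have h0 : toJ1 (eu 0 1) = (0, 0, 0, 1) := by simp [toJ1, eu]
    rw [h0]
    rfl
  have hG' : ∀ᶠ w in 𝓝 z, G' w = k (toJ1 w) - pp f (toJ1 w) * L.rhs w := by
    filter_upwards [hkk, hpp] with w e1 e2
    rw [← e1, e2]
    ring
  refine ⟨f, k, N₁ ∩ N₂, Φ, hN₁.inter hN₂, ⟨hz₁, hz₂⟩, hf.mono Set.inter_subset_left,
    hk.mono Set.inter_subset_right, h4.1, ?_, ?_⟩
  · filter_upwards [h5, hff, hG', h4.eventually] with w e1 e2 e3 e4 hw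
    have e5 := solMap_eq_self hw
    simp only [e5] at e1
    rw [Dt_eq_DtE e4 hw, ← e2, ← e3]
    exact e1
  · refine eventually_toJ2 ?_
    filter_upwards [h1, hff.eventually_nhds, hG'.eventually_nhds, hmem,
      isOpen_jetDom.mem_nhds hz.1] with w e1 e2 e3 e4 e5
    have hfd := differentiableAt_of_contDiffOn hN₁ hf e4.1
    have d1 : L.DtE F' w = pt f (toJ1 w) + L.rhs w * pu f (toJ1 w) +
        Dx L.rhs w * pp f (toJ1 w) := by
      rw [DtE, lineDeriv_congr e2, lineDeriv_comp_toJ1 hfd, fderiv_J1_apply]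
      simp only [toJ1, vecE, if_true, rhsX, Function.iterate_succ, Function.iterate_zero,
        Function.comp_apply, id]
      ring
    have hpf := contDiffOn_pd hN₁ hf (0, 0, 0, 1)
    have s1 := smoothAt_comp_toJ1 hN₁ hpf e4.1
    have s2 := smoothAt_comp_toJ1 hN₂ hk e4.2
    have s3 := smoothAt_rhs e5
    have d2 : Dx G' w = tdx k (toJ2 w) -
        (tdx (pp f) (toJ2 w) * L.rhs w + pp f (toJ1 w) * Dx L.rhs w) := by
      rw [Dx, lineDeriv_congr e3]
      have t1 := s2.lineDeriv_sub (s1.mul s3) (vecX w)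
      rw [s1.lineDeriv_mul s3] at t1
      have t2 := Dx_comp_toJ1 (differentiableAt_of_contDiffOn hN₂ hk e4.2)
      have t3 := Dx_comp_toJ1 (differentiableAt_of_contDiffOn hN₁ hpf e4.1)
      rw [Dx] at t2 t3
      rw [t2, t3] at t1
      exact t1
    rw [d1, d2] at e1
    change pt f (toJ1 w) + (pu f (toJ1 w) - tdx (pp f) (toJ2 w)) * L.rhs w + tdx k (toJ2 w) = 0
    linarith

end Equation

/-! ### Functions of `(t, x, u, u_x, u_xx)` -/

theorem contDiff_J2_toJ1 : ContDiff ℝ ∞ J2.toJ1 := by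
  unfold J2.toJ1
  fun_prop

/-- `J2.toJ1` as a continuous linear map. -/
def J2.toJ1CLM : J2 →L[ℝ] J1 where
  toFun := J2.toJ1
  map_add' _ _ := rfl
  map_smul' _ _ := rfl
  cont := contDiff_J2_toJ1.continuous

theorem fderiv_comp_J2_toJ1 {f : J1 → ℝ} {y : J2} (hf : DifferentiableAt ℝ f y.toJ1) (v : J2) :
    fderiv ℝ (fun y : J2 => f y.toJ1) y v = fderiv ℝ f y.toJ1 v.toJ1 := by
  have h : HasFDerivAt (fun y : J2 => f y.toJ1) ((fderiv ℝ f y.toJ1).comp J2.toJ1CLM) y :=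
    HasFDerivAt.comp (f := J2.toJ1CLM) y hf.hasFDerivAt J2.toJ1CLM.hasFDerivAt
  rw [h.fderiv]
  rfl

theorem contDiffOn_comp_J2_toJ1 {f : J1 → ℝ} {N : Set J1} (hf : ContDiffOn ℝ ∞ f N) :
    ContDiffOn ℝ ∞ (fun y : J2 => f y.toJ1) (J2.toJ1 ⁻¹' N) :=
  hf.comp contDiff_J2_toJ1.contDiffOn fun _ hy => hy

theorem contDiffOn_tdx {f : J1 → ℝ} {N : Set J1} (hN : IsOpen N) (hf : ContDiffOn ℝ ∞ f N) :
    ContDiffOn ℝ ∞ (tdx f) (J2.toJ1 ⁻¹' N) := by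
  have h1 := contDiffOn_comp_J2_toJ1 (contDiffOn_pd hN hf (0, 1, 0, 0))
  have h2 := contDiffOn_comp_J2_toJ1 (contDiffOn_pd hN hf (0, 0, 1, 0))
  have h3 := contDiffOn_comp_J2_toJ1 (contDiffOn_pd hN hf (0, 0, 0, 1))
  have h4 : ContDiff ℝ ∞ fun y : J2 => y.2.2.2.1 := by fun_prop
  have h5 : ContDiff ℝ ∞ fun y : J2 => y.2.2.2.2 := by fun_prop
  exact (h1.add (h4.contDiffOn.mul h2)).add (h5.contDiffOn.mul h3)

/-- The derivative of a function of `(t, x, u, u_x, u_xx)` with respect to `u_xx`. -/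
noncomputable def pq (f : J2 → ℝ) (y : J2) : ℝ := fderiv ℝ f y (0, 0, 0, 0, 1)

theorem hasDerivAt_pq {f : J2 → ℝ} {y : J2} (hf : DifferentiableAt ℝ f y) :
    HasDerivAt (fun s : ℝ => f (y + s • (0, 0, 0, 0, 1))) (pq f y) 0 :=
  hf.hasFDerivAt.hasLineDerivAt (0, 0, 0, 0, 1)

theorem pq_eq_of_hasDerivAt {f : J2 → ℝ} {y : J2} (hf : DifferentiableAt ℝ f y) {f' : ℝ}
    (h : HasDerivAt (fun s : ℝ => f (y + s • (0, 0, 0, 0, 1))) f' 0) : pq f y = f' :=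
  (hasDerivAt_pq hf).unique h

theorem pq_congr {f g : J2 → ℝ} {y : J2} (h : f =ᶠ[𝓝 y] g) : pq f y = pq g y := by
  rw [pq, pq, h.fderiv_eq]

theorem pq_comp_toJ1 {f : J1 → ℝ} {y : J2} (hf : DifferentiableAt ℝ f y.toJ1) :
    pq (fun y => f y.toJ1) y = 0 := by
  rw [pq, fderiv_comp_J2_toJ1 hf]
  have : J2.toJ1 (0, 0, 0, 0, 1) = 0 := rfl
  rw [this, map_zero]

theorem pq_add {f g : J2 → ℝ} {y : J2} (hf : DifferentiableAt ℝ f y)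
    (hg : DifferentiableAt ℝ g y) : pq (fun y => f y + g y) y = pq f y + pq g y := by
  rw [pq, fderiv_fun_add hf hg]
  rfl

theorem pq_mul {f g : J2 → ℝ} {y : J2} (hf : DifferentiableAt ℝ f y)
    (hg : DifferentiableAt ℝ g y) :
    pq (fun y => f y * g y) y = pq f y * g y + f y * pq g y := by
  rw [pq, fderiv_fun_mul hf hg]
  simp only [add_apply, smul_apply, smul_eq_mul, pq]
  ring

theorem pq_tdx {f : J1 → ℝ} {N : Set J1} (hN : IsOpen N) (hf : ContDiffOn ℝ ∞ f N) {y : J2}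
    (hy : y.toJ1 ∈ N) : pq (tdx f) y = pp f y.toJ1 := by
  refine pq_eq_of_hasDerivAt (differentiableAt_of_contDiffOn
    (hN.preimage contDiff_J2_toJ1.continuous) (contDiffOn_tdx hN hf) hy) ?_
  have h : ∀ s : ℝ, tdx f (y + s • (0, 0, 0, 0, 1)) = tdx f y + s * pp f y.toJ1 := by
    intro s
    have e : (y + s • ((0, 0, 0, 0, 1) : J2)).toJ1 = y.toJ1 := by simp [J2.toJ1]
    rw [tdx, e, tdx]
    simp
    ring
  simp only [h]
  simpa using ((hasDerivAt_id (0 : ℝ)).mul_const (pp f y.toJ1)).const_add (tdx f y)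

theorem exists_continuousLinearEquiv_of_injective {E : Type*} [NormedAddCommGroup E]
    [NormedSpace ℝ E] [FiniteDimensional ℝ E] (A : E →L[ℝ] E) (h : ∀ v, A v = 0 → v = 0) :
    ∃ B : E ≃L[ℝ] E, (B : E →L[ℝ] E) = A := by
  have hinj : Function.Injective (A : E →ₗ[ℝ] E) :=
    (injective_iff_map_eq_zero (A : E →ₗ[ℝ] E)).2 h
  refine ⟨(LinearEquiv.ofInjectiveEndo (A : E →ₗ[ℝ] E) hinj).toContinuousLinearEquiv, ?_⟩
  ext v
  rfl

/-! ### Contact maps -/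

/-- Contact relations: on fibres of `t` the form `dU - V dX` is a multiple of `du - u_x dx`. -/
structure ContactOn (X U V : J1 → ℝ) (N : Set J1) : Prop where
  isOpen : IsOpen N
  smooth_X : ContDiffOn ℝ ∞ X N
  smooth_U : ContDiffOn ℝ ∞ U N
  smooth_V : ContDiffOn ℝ ∞ V N
  pp_eq : ∀ y ∈ N, pp U y = V y * pp X y
  px_eq : ∀ y ∈ N, px U y + y.2.2.2 * pu U y = V y * (px X y + y.2.2.2 * pu X y)

/-- The factor `a` in `dU - V dX = a (du - u_x dx)` on fibres of `t`. -/
noncomputable def contactFactor (X U V : J1 → ℝ) (y : J1) : ℝ := pu U y - V y * pu X y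

/-- The map `(t, x, u, u_x) ↦ (t, X, U, V)`. -/
def contactMap (X U V : J1 → ℝ) (y : J1) : J1 := (y.1, X y, U y, V y)

/-- The prolongation `(t, x, u, u_x, u_xx) ↦ (t, X, U, V, D_x V / D_x X)`. -/
noncomputable def contactMap₂ (X U V : J1 → ℝ) (y : J2) : J2 :=
  (y.1, X y.toJ1, U y.toJ1, V y.toJ1, tdx V y / tdx X y)

namespace ContactOn

variable {X U V : J1 → ℝ} {N : Set J1}

theorem mono (h : ContactOn X U V N) {N' : Set J1} (hN' : IsOpen N') (hsub : N' ⊆ N) :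
    ContactOn X U V N' :=
  ⟨hN', h.smooth_X.mono hsub, h.smooth_U.mono hsub, h.smooth_V.mono hsub,
    fun y hy => h.pp_eq y (hsub hy), fun y hy => h.px_eq y (hsub hy)⟩

theorem tdx_eq (h : ContactOn X U V N) {y : J2} (hy : y.toJ1 ∈ N) :
    tdx U y = V y.toJ1 * tdx X y := by
  have h1 := h.pp_eq _ hy
  have h2 := h.px_eq _ hy
  simp only [tdx]
  change px U y.toJ1 + y.2.2.2.1 * pu U y.toJ1 = V y.toJ1 * (px X y.toJ1 +
    y.2.2.2.1 * pu X y.toJ1) at h2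
  linear_combination h2 + y.2.2.2.2 * h1

/-- Differentiating the contact relations crosswise shows that the Jacobian of `(X, V)` along
`D_x`, `∂_{u_x}` is the contact factor. -/
theorem jacobian_eq (h : ContactOn X U V N) {y : J1} (hy : y ∈ N) :
    pp V y * (px X y + y.2.2.2 * pu X y) - pp X y * (px V y + y.2.2.2 * pu V y) =
      contactFactor X U V y := by
  have dX := fun v => differentiableAt_of_contDiffOn h.isOpen (contDiffOn_pd h.isOpen h.smooth_X v)
    hy
  have dU := fun v => differentiableAt_of_contDiffOn h.isOpen (contDiffOn_pd h.isOpen h.smooth_U v)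
    hy
  have dV := differentiableAt_of_contDiffOn h.isOpen h.smooth_V hy
  have dp : DifferentiableAt ℝ (fun y : J1 => y.2.2.2) y := by fun_prop
  have e1 := pd_congr_on h.isOpen hy h.pp_eq (0, 1, 0, 0)
  have e2 := pd_congr_on h.isOpen hy h.pp_eq (0, 0, 1, 0)
  have e3 := pd_congr_on h.isOpen hy h.px_eq (0, 0, 0, 1)
  simp only [pu_eq, EvolCL.pp_eq, EvolCL.px_eq, contactFactor] at e1 e2 e3 ⊢
  rw [pd_mul dV (dX _)] at e1 e2
  rw [pd_add (dU _) (dp.fun_mul (dU _)), pd_mul dp (dU _),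
    pd_mul dV ((dX _).fun_add (dp.fun_mul (dX _))), pd_add (dX _) (dp.fun_mul (dX _)), pd_mul dp (dX _), pd_coord_p] at e3
  have c1 := pd_comm h.isOpen h.smooth_U hy (0, 1, 0, 0) (0, 0, 0, 1)
  have c2 := pd_comm h.isOpen h.smooth_U hy (0, 0, 1, 0) (0, 0, 0, 1)
  have c3 := pd_comm h.isOpen h.smooth_X hy (0, 1, 0, 0) (0, 0, 0, 1)
  have c4 := pd_comm h.isOpen h.smooth_X hy (0, 0, 1, 0) (0, 0, 0, 1)
  rw [c1, c3] at e1
  rw [c2, c4] at e2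
  linear_combination e1 + y.2.2.2 * e2 - e3

theorem jacobian_eq₂ (h : ContactOn X U V N) {y : J2} (hy : y.toJ1 ∈ N) :
    pp V y.toJ1 * tdx X y - pp X y.toJ1 * tdx V y = contactFactor X U V y.toJ1 := by
  rw [← h.jacobian_eq hy]
  simp only [tdx, J2.toJ1]
  ring

theorem contactV_eq (h : ContactOn X U V N) {y : J1} (hy : y ∈ N)
    (hr : px X y + pu X y * y.2.2.2 ≠ 0 ∨ pp X y ≠ 0) : contactV X U y = V y := by
  by_cases hp : pp X y = 0
  · have hr' := hr.resolve_right (not_not.2 hp)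
    rw [contactV, if_neg (not_not.2 hp), div_eq_iff hr']
    linear_combination h.px_eq y hy
  · rw [contactV, if_pos hp, div_eq_iff hp, h.pp_eq y hy]

theorem smooth_contactMap (h : ContactOn X U V N) : ContDiffOn ℝ ∞ (contactMap X U V) N :=
  contDiffOn_fst.prodMk (h.smooth_X.prodMk (h.smooth_U.prodMk h.smooth_V))

theorem fderiv_contactMap (h : ContactOn X U V N) {y : J1} (hy : y ∈ N) (v : J1) :
    fderiv ℝ (contactMap X U V) y v =
      (v.1, fderiv ℝ X y v, fderiv ℝ U y v, fderiv ℝ V y v) := by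
  have d1 := (differentiableAt_of_contDiffOn h.isOpen h.smooth_X hy).hasFDerivAt
  have d2 := (differentiableAt_of_contDiffOn h.isOpen h.smooth_U hy).hasFDerivAt
  have d3 := (differentiableAt_of_contDiffOn h.isOpen h.smooth_V hy).hasFDerivAt
  have d : HasFDerivAt (contactMap X U V) _ y :=
    hasFDerivAt_fst.prodMk (d1.prodMk (d2.prodMk d3))
  rw [d.fderiv]
  rfl

theorem fderiv_contactMap_injective (h : ContactOn X U V N) {y : J1} (hy : y ∈ N)
    (ha : contactFactor X U V y ≠ 0) (v : J1) (hv : fderiv ℝ (contactMap X U V) y v = 0) :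
    v = 0 := by
  rw [h.fderiv_contactMap hy, fderiv_J1_apply, fderiv_J1_apply, fderiv_J1_apply] at hv
  simp only [Prod.mk_eq_zero] at hv
  obtain ⟨h1, h2, h3, h4⟩ := hv
  have e1 := h.pp_eq y hy
  have e2 := h.px_eq y hy
  have e3 := h.jacobian_eq hy
  rw [h1] at h2 h3 h4
  have hu : v.2.2.1 = y.2.2.2 * v.2.1 := by
    have : contactFactor X U V y * (v.2.2.1 - y.2.2.2 * v.2.1) = 0 := by
      simp only [contactFactor]
      linear_combination h3 - V y * h2 - v.2.2.2 * e1 - v.2.1 * e2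
    linarith [(mul_eq_zero.1 this).resolve_left ha]
  rw [hu] at h2 h4
  have hx : v.2.1 = 0 := by
    have : contactFactor X U V y * v.2.1 = 0 := by
      linear_combination pp V y * h2 - pp X y * h4 - v.2.1 * e3
    exact (mul_eq_zero.1 this).resolve_left ha
  have hp : v.2.2.2 = 0 := by
    have : contactFactor X U V y * v.2.2.2 = 0 := by
      linear_combination (px X y + y.2.2.2 * pu X y) * h4 - (px V y + y.2.2.2 * pu V y) * h2
        - v.2.2.2 * e3
    exact (mul_eq_zero.1 this).resolve_left ha
  rw [hx, mul_zero] at hu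
  exact Prod.ext h1 (Prod.ext hx (Prod.ext hu hp))

/-- The domain of the second prolongation. -/
def dom₂ (X : J1 → ℝ) (N : Set J1) : Set J2 := {y | y.toJ1 ∈ N ∧ tdx X y ≠ 0}

theorem isOpen_dom₂ (h : ContactOn X U V N) : IsOpen (dom₂ X N) := by
  have := (contDiffOn_tdx h.isOpen h.smooth_X).continuousOn.isOpen_inter_preimage
    (h.isOpen.preimage contDiff_J2_toJ1.continuous) (isOpen_compl_singleton (x := (0 : ℝ)))
  exact this

theorem smooth_contactMap₂ (h : ContactOn X U V N) :
    ContDiffOn ℝ ∞ (contactMap₂ X U V) (dom₂ X N) := by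
  have hsub : dom₂ X N ⊆ J2.toJ1 ⁻¹' N := fun y hy => hy.1
  have h1 := (contDiffOn_comp_J2_toJ1 h.smooth_X).mono hsub
  have h2 := (contDiffOn_comp_J2_toJ1 h.smooth_U).mono hsub
  have h3 := (contDiffOn_comp_J2_toJ1 h.smooth_V).mono hsub
  have h4 := (contDiffOn_tdx h.isOpen h.smooth_V).mono hsub
  have h5 := (contDiffOn_tdx h.isOpen h.smooth_X).mono hsub
  exact contDiffOn_fst.prodMk (h1.prodMk (h2.prodMk (h3.prodMk (h4.div h5 fun y hy => hy.2))))

theorem fderiv_contactMap₂_q (h : ContactOn X U V N) {y : J2} (hy : y ∈ dom₂ X N) :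
    fderiv ℝ (contactMap₂ X U V) y (0, 0, 0, 0, 1) =
      (contactFactor X U V y.toJ1 / tdx X y ^ 2) • ((0, 0, 0, 0, 1) : J2) := by
  have hline : HasDerivAt (fun s : ℝ => contactMap₂ X U V (y + s • (0, 0, 0, 0, 1)))
      (fderiv ℝ (contactMap₂ X U V) y (0, 0, 0, 0, 1)) 0 :=
    (differentiableAt_of_contDiffOn h.isOpen_dom₂ h.smooth_contactMap₂
      hy).hasFDerivAt.hasLineDerivAt _
  have e : ∀ s : ℝ, (y + s • ((0, 0, 0, 0, 1) : J2)).toJ1 = y.toJ1 := by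
    intro s
    simp [J2.toJ1]
  have e' : ∀ s : ℝ, (y + s • ((0, 0, 0, 0, 1) : J2)).1 = y.1 := by
    intro s
    simp
  have hN := h.isOpen.preimage contDiff_J2_toJ1.continuous
  have d1 := hasDerivAt_pq (differentiableAt_of_contDiffOn hN
    (contDiffOn_tdx h.isOpen h.smooth_V) hy.1)
  have d2 := hasDerivAt_pq (differentiableAt_of_contDiffOn hN
    (contDiffOn_tdx h.isOpen h.smooth_X) hy.1)
  have hx : tdx X (y + (0 : ℝ) • (0, 0, 0, 0, 1)) ≠ 0 := by simpa using hy.2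
  have d3 := HasDerivAt.fun_div d1 d2 hx
  rw [pq_tdx h.isOpen h.smooth_V hy.1, pq_tdx h.isOpen h.smooth_X hy.1, zero_smul, add_zero,
    mul_comm (tdx V y), h.jacobian_eq₂ hy.1] at d3
  have d4 : HasDerivAt (fun s : ℝ => contactMap₂ X U V (y + s • (0, 0, 0, 0, 1)))
      (0, 0, 0, 0, contactFactor X U V y.toJ1 / tdx X y ^ 2) 0 := by
    simp only [contactMap₂, e, e']
    exact (hasDerivAt_const (0 : ℝ) y.1).prodMk ((hasDerivAt_const (0 : ℝ) (X y.toJ1)).prodMk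
      ((hasDerivAt_const (0 : ℝ) (U y.toJ1)).prodMk
        ((hasDerivAt_const (0 : ℝ) (V y.toJ1)).prodMk d3)))
  rw [hline.unique d4]
  simp

theorem fderiv_contactMap₂_injective (h : ContactOn X U V N) {y : J2} (hy : y ∈ dom₂ X N)
    (ha : contactFactor X U V y.toJ1 ≠ 0) (v : J2)
    (hv : fderiv ℝ (contactMap₂ X U V) y v = 0) : v = 0 := by
  have hd := (differentiableAt_of_contDiffOn h.isOpen_dom₂ h.smooth_contactMap₂ hy).hasFDerivAt
  have hd1 := (differentiableAt_of_contDiffOn h.isOpen h.smooth_contactMap hy.1).hasFDerivAt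
  have h1 : fderiv ℝ (contactMap X U V) y.toJ1 v.toJ1 = 0 := by
    have e1 : HasFDerivAt (fun y : J2 => (contactMap₂ X U V y).toJ1)
        (J2.toJ1CLM.comp (fderiv ℝ (contactMap₂ X U V) y)) y :=
      HasFDerivAt.comp y J2.toJ1CLM.hasFDerivAt hd
    have e2 : HasFDerivAt (fun y : J2 => contactMap X U V y.toJ1)
        ((fderiv ℝ (contactMap X U V) y.toJ1).comp J2.toJ1CLM) y :=
      HasFDerivAt.comp (f := J2.toJ1CLM) y hd1 J2.toJ1CLM.hasFDerivAt
    have e3 := congrArg (fun A : J2 →L[ℝ] J1 => A v) (e1.unique e2)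
    simp only [ContinuousLinearMap.comp_apply, hv, map_zero] at e3
    exact e3.symm
  have h2 := h.fderiv_contactMap_injective hy.1 ha _ h1
  have h3 : v = v.2.2.2.2 • ((0, 0, 0, 0, 1) : J2) := by
    have hc : v.1 = 0 ∧ v.2.1 = 0 ∧ v.2.2.1 = 0 ∧ v.2.2.2.1 = 0 := by
      simpa [J2.toJ1, Prod.ext_iff] using h2
    simp [Prod.ext_iff, hc]
  rw [h3, map_smul, h.fderiv_contactMap₂_q hy, smul_smul] at hv
  have h4 : v.2.2.2.2 * (contactFactor X U V y.toJ1 / tdx X y ^ 2) = 0 := by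
    simpa [Prod.ext_iff] using hv
  have h5 := (mul_eq_zero.1 h4).resolve_right (div_ne_zero ha (pow_ne_zero 2 hy.2))
  rw [h3, h5, zero_smul]

theorem rank_eq_two (h : ContactOn X U V N) {y : J1} (hy : y ∈ N)
    (ha : contactFactor X U V y ≠ 0) (hr : px X y + pu X y * y.2.2.2 ≠ 0 ∨ pp X y ≠ 0) :
    (!![px X y, pu X y, pp X y; px U y, pu U y, pp U y] : Matrix (Fin 2) (Fin 3) ℝ).rank = 2 := by
  have hli : LinearIndependent ℝ
      (!![px X y, pu X y, pp X y; px U y, pu U y, pp U y] : Matrix (Fin 2) (Fin 3) ℝ).row := by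
    refine LinearIndependent.pair_iff.2 fun s t hst => ?_
    have h0 := congrFun hst 0
    have h1 := congrFun hst 1
    have h2 := congrFun hst 2
    simp only [Matrix.cons_val_zero,
      Matrix.cons_val_one, Matrix.cons_val, Pi.add_apply, Pi.smul_apply, smul_eq_mul,
      Pi.zero_apply] at h0 h1 h2
    have e1 := h.pp_eq y hy
    have e2 := h.px_eq y hy
    have hs : s + t * V y = 0 := by
      rcases hr with hr | hr
      · have : (s + t * V y) * (px X y + pu X y * y.2.2.2) = 0 := by
          linear_combination h0 + y.2.2.2 * h1 - t * e2
        exact (mul_eq_zero.1 this).resolve_right hr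
      · have : (s + t * V y) * pp X y = 0 := by linear_combination h2 - t * e1
        exact (mul_eq_zero.1 this).resolve_right hr
    have ht : t = 0 := by
      have : t * contactFactor X U V y = 0 := by
        simp only [contactFactor]
        linear_combination h1 - pu X y * hs
      exact (mul_eq_zero.1 this).resolve_right ha
    exact ⟨by rw [ht] at hs; linarith, ht⟩
  simpa using hli.rank_matrix

end ContactOn

/-! ### The pair obtained by a contact transformation -/

/-- Total derivatives commute. -/
theorem SmoothAt.Dt_Dx {f : Jet → ℝ} {z : Jet} (hf : SmoothAt f z) :
    EvolCL.Dt (EvolCL.Dx f) z = EvolCL.Dx (EvolCL.Dt f) z := by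
  have h := hf.lineDeriv_comm (smoothField_vecX z) (smoothField_vecT z)
  rw [dField_vecT, dField_vecX] at h
  exact add_right_cancel h

/-- A conserved vector may be changed by a null divergence and on the solution jets without
leaving its conservation law. -/
theorem exists_mk_eq {L : Equation} {D : Set Jet} (hD : IsOpen D) (P : CV L D)
    {F G Φ : Jet → ℝ} (hF : SmoothOn F D) (hG : SmoothOn G D) (hΦ : SmoothOn Φ D)
    (h : ∀ w ∈ D, w ∈ L.sol → P.1.1 w = F w + Dx Φ w ∧ P.1.2 w = G w - Dt Φ w) :
    ∃ P' : CV L D, P'.1 = (F, G) ∧ CL.mk P' = CL.mk P := by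
  have hcv : (F, G) ∈ CV L D := by
    refine ⟨hF, hG, fun w hw => ?_⟩
    have hF' := hF.smoothAt hw.1
    have hG' := hG.smoothAt hw.1
    have hΦ' := hΦ.smoothAt hw.1
    have e1 : Dt P.1.1 w = Dt (fun w => F w + Dx Φ w) w :=
      Equation.Dt_congr_sol hw.2 (P.2.1.smoothAt hw.1) (hF'.add hΦ'.Dx)
        (Filter.eventually_of_mem (hD.mem_nhds hw.1) fun w' h1 h2 => (h w' h1 h2).1)
    have e2 : Dx P.1.2 w = Dx (fun w => G w - Dt Φ w) w :=
      Equation.Dx_congr_sol hw.2 (P.2.2.1.smoothAt hw.1) (hG'.sub hΦ'.Dt)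
        (Filter.eventually_of_mem (hD.mem_nhds hw.1) fun w' h1 h2 => (h w' h1 h2).2)
    have e3 := P.2.2.2 w hw
    have e4 : Dt (fun w => F w + Dx Φ w) w = Dt F w + Dt (Dx Φ) w := hF'.lineDeriv_add hΦ'.Dx _
    have e5 : Dx (fun w => G w - Dt Φ w) w = Dx G w - Dx (Dt Φ) w := hG'.lineDeriv_sub hΦ'.Dt _
    rw [e1, e2, e4, e5, hΦ'.Dt_Dx] at e3
    change Dt F w + Dx G w = 0
    linarith
  refine ⟨⟨(F, G), hcv⟩, rfl, (Submodule.Quotient.eq _).2 ?_⟩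
  intro z hz
  refine ⟨D, fun w => -Φ w, hD, hz.1, fun w hw => (hΦ.smoothAt hw).neg, fun w hw => ?_⟩
  have e := h w hw.1 hw.2
  have e1 : Dx (fun w => -Φ w) w = -Dx Φ w := lineDeriv_fun_neg
  have e2 : Dt (fun w => -Φ w) w = -Dt Φ w := lineDeriv_fun_neg
  rw [e1, e2]
  change F w - P.1.1 w = _ ∧ G w - P.1.2 w = _
  rw [e.1, e.2]
  constructor <;> ring

namespace ContactOn

variable {X U V : J1 → ℝ} {N : Set J1}

theorem continuousOn_contactFactor (h : ContactOn X U V N) :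
    ContinuousOn (contactFactor X U V) N :=
  (contDiffOn_pd h.isOpen h.smooth_U _).continuousOn.sub
    (h.smooth_V.continuousOn.mul (contDiffOn_pd h.isOpen h.smooth_X _).continuousOn)

/-- Where the contact factor does not vanish, `contactMap` is a local diffeomorphism. -/
theorem exists_chart (h : ContactOn X U V N) {y : J1} (hy : y ∈ N)
    (ha : contactFactor X U V y ≠ 0) :
    ∃ e : OpenPartialHomeomorph J1 J1, y ∈ e.source ∧ e.source ⊆ N ∧
      (∀ y, e y = contactMap X U V y) ∧ ContDiffOn ℝ ∞ e.symm e.target := by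
  obtain ⟨B, hB⟩ := exists_continuousLinearEquiv_of_injective _
    (h.fderiv_contactMap_injective hy ha)
  refine exists_local_smooth_inverse h.isOpen hy h.smooth_contactMap B ?_
  rw [hB]
  exact (differentiableAt_of_contDiffOn h.isOpen h.smooth_contactMap hy).hasFDerivAt

/-- Where the contact factor does not vanish, the second prolongation is a local diffeomorphism. -/
theorem exists_chart₂ (h : ContactOn X U V N) {S : Set J2} (hS : IsOpen S) (hSN : S ⊆ dom₂ X N)
    {y : J2} (hy : y ∈ S) (ha : contactFactor X U V y.toJ1 ≠ 0) :
    ∃ e : OpenPartialHomeomorph J2 J2, y ∈ e.source ∧ e.source ⊆ S ∧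
      (∀ y, e y = contactMap₂ X U V y) ∧ ContDiffOn ℝ ∞ e.symm e.target := by
  obtain ⟨B, hB⟩ := exists_continuousLinearEquiv_of_injective _
    (h.fderiv_contactMap₂_injective (hSN hy) ha)
  refine exists_local_smooth_inverse hS hy (h.smooth_contactMap₂.mono hSN) B ?_
  rw [hB]
  exact (differentiableAt_of_contDiffOn h.isOpen_dom₂ h.smooth_contactMap₂
    (hSN hy)).hasFDerivAt

/-- The chain rule for `D_x`. -/
theorem tdx_comp_contactMap (h : ContactOn X U V N) {y : J2} (hy : y ∈ dom₂ X N) {m : J1 → ℝ}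
    (hm : DifferentiableAt ℝ m (contactMap X U V y.toJ1)) :
    tdx (fun y => m (contactMap X U V y)) y = tdx m (contactMap₂ X U V y) * tdx X y := by
  have hd := differentiableAt_of_contDiffOn h.isOpen h.smooth_contactMap hy.1
  have hf : ∀ v, fderiv ℝ (fun y => m (contactMap X U V y)) y.toJ1 v =
      v.1 * pt m (contactMap X U V y.toJ1) +
        fderiv ℝ X y.toJ1 v * px m (contactMap X U V y.toJ1) +
        fderiv ℝ U y.toJ1 v * pu m (contactMap X U V y.toJ1) +
        fderiv ℝ V y.toJ1 v * pp m (contactMap X U V y.toJ1) := by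
    intro v
    have h1 : HasFDerivAt (fun y => m (contactMap X U V y)) _ y.toJ1 :=
      HasFDerivAt.comp y.toJ1 hm.hasFDerivAt hd.hasFDerivAt
    rw [h1.fderiv, ContinuousLinearMap.comp_apply, h.fderiv_contactMap hy.1, fderiv_J1_apply]
  have hU := h.tdx_eq hy.1
  have e1 : tdx m (contactMap₂ X U V y) * tdx X y =
      tdx X y * px m (contactMap X U V y.toJ1) +
        tdx X y * V y.toJ1 * pu m (contactMap X U V y.toJ1) +
        tdx V y / tdx X y * tdx X y * pp m (contactMap X U V y.toJ1) := by
    simp only [tdx, contactMap₂, contactMap, J2.toJ1]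
    ring
  rw [e1, div_mul_cancel₀ _ hy.2, mul_comm (tdx X y) (V _), ← hU]
  simp only [tdx, px, pu, pp, hf]
  ring

/-- The contact transformation `t̃ = t`, `x̃ = X`, `ũ = U`. -/
noncomputable def transformation (h : ContactOn X U V N)
    (ha : ∀ y ∈ N, contactFactor X U V y ≠ 0)
    (hr : ∀ y ∈ N, px X y + pu X y * y.2.2.2 ≠ 0 ∨ pp X y ≠ 0)
    (hinj : Set.InjOn (contactMap X U V) N) : ContactTransformation where
  dom := N
  isOpen_dom := h.isOpen
  T := id
  X := X
  U := U
  smooth_T := contDiffOn_id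
  smooth_X := h.smooth_X
  smooth_U := h.smooth_U
  deriv_T_ne y _ := by rw [deriv_id]; exact one_ne_zero
  rank_eq_two y hy := h.rank_eq_two hy (ha y hy) (hr y hy)
  contact y hy := by
    linear_combination (pp X y) * h.px_eq y hy - (px X y + pu X y * y.2.2.2) * h.pp_eq y hy
  regular := hr
  injOn := hinj.congr fun y hy => by simp [contactMap, h.contactV_eq hy (hr y hy)]

/-- The right-hand side of the transformed equation in the old coordinates. -/
noncomputable def newRhs (X U V : J1 → ℝ) (L : Equation) (y : J2) : ℝ :=
  contactFactor X U V y.toJ1 * L.H y + (pt U y.toJ1 - V y.toJ1 * pt X y.toJ1)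

theorem smooth_newRhs (h : ContactOn X U V N) (L : Equation) :
    ContDiffOn ℝ ∞ (newRhs X U V L) (J2.toJ1 ⁻¹' N ∩ L.dom) := by
  have hX := fun v => contDiffOn_comp_J2_toJ1 (contDiffOn_pd h.isOpen h.smooth_X v)
  have hU := fun v => contDiffOn_comp_J2_toJ1 (contDiffOn_pd h.isOpen h.smooth_U v)
  have hV := contDiffOn_comp_J2_toJ1 h.smooth_V
  exact ((((hU _).sub (hV.mul (hX _))).mono Set.inter_subset_left).mul
    (L.smooth.mono Set.inter_subset_right)).add
    (((hU _).sub (hV.mul (hX _))).mono Set.inter_subset_left)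

theorem pq_newRhs (h : ContactOn X U V N) {L : Equation} {y : J2} (hy : y.toJ1 ∈ N)
    (hL : y ∈ L.dom) : pq (newRhs X U V L) y = contactFactor X U V y.toJ1 * pq L.H y := by
  have dX := fun v => differentiableAt_of_contDiffOn h.isOpen (contDiffOn_pd h.isOpen h.smooth_X v)
    hy
  have dU := fun v => differentiableAt_of_contDiffOn h.isOpen (contDiffOn_pd h.isOpen h.smooth_U v)
    hy
  have dV := differentiableAt_of_contDiffOn h.isOpen h.smooth_V hy
  have d1 : DifferentiableAt ℝ (contactFactor X U V) y.toJ1 := (dU _).fun_sub (dV.fun_mul (dX _))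
  have d2 : DifferentiableAt ℝ (fun y => pt U y - V y * pt X y) y.toJ1 :=
    (dU _).fun_sub (dV.fun_mul (dX _))
  have hc : DifferentiableAt ℝ J2.toJ1 y := contDiff_J2_toJ1.differentiable (by simp) y
  have d3 : DifferentiableAt ℝ (fun y : J2 => contactFactor X U V y.toJ1) y :=
    DifferentiableAt.comp y d1 hc
  have d4 : DifferentiableAt ℝ (fun y : J2 => pt U y.toJ1 - V y.toJ1 * pt X y.toJ1) y :=
    DifferentiableAt.comp y d2 hc
  have dH := Equation.differentiableAt_H hL
  have e : newRhs X U V L = fun y => contactFactor X U V y.toJ1 * L.H y +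
    (pt U y.toJ1 - V y.toJ1 * pt X y.toJ1) := rfl
  rw [e, pq_add (d3.fun_mul dH) d4, pq_mul d3 dH, pq_comp_toJ1 d1, pq_comp_toJ1 d2]
  ring

/-- The chain rule for `∂_{u_xx}`: the second prolongation is fibred over `(t, x, u, u_x)`. -/
theorem pq_comp_contactMap₂ (h : ContactOn X U V N) {y : J2} (hy : y ∈ dom₂ X N) {m : J2 → ℝ}
    (hm : DifferentiableAt ℝ m (contactMap₂ X U V y)) :
    pq (fun y => m (contactMap₂ X U V y)) y =
      contactFactor X U V y.toJ1 / tdx X y ^ 2 * pq m (contactMap₂ X U V y) := by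
  have hd := differentiableAt_of_contDiffOn h.isOpen_dom₂ h.smooth_contactMap₂ hy
  have h1 : HasFDerivAt (fun y => m (contactMap₂ X U V y)) _ y :=
    HasFDerivAt.comp y hm.hasFDerivAt hd.hasFDerivAt
  rw [pq, h1.fderiv, ContinuousLinearMap.comp_apply, h.fderiv_contactMap₂_q hy, map_smul]
  rfl

section transformed

variable {e : OpenPartialHomeomorph J2 J2} {L : Equation}

theorem smooth_transformed_rhs (h : ContactOn X U V N) (hsub : e.source ⊆ dom₂ X N ∩ L.dom)
    (hsymm : ContDiffOn ℝ ∞ e.symm e.target) :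
    ContDiffOn ℝ ∞ (fun y => newRhs X U V L (e.symm y)) e.target :=
  (h.smooth_newRhs L).comp hsymm fun _ hy =>
    ⟨(hsub (e.map_target hy)).1.1, (hsub (e.map_target hy)).2⟩

/-- The derivative of the transformed right-hand side with respect to `ũ_x̃x̃`: it vanishes nowhere,
and it does not depend on `ũ_x̃x̃` if the equation is quasi-linear and `X` is free of `u_x`. -/
theorem pq_transformed_rhs (h : ContactOn X U V N)
    (ha : ∀ y ∈ N, contactFactor X U V y ≠ 0) (hsub : e.source ⊆ dom₂ X N ∩ L.dom)
    (he : ∀ y, e y = contactMap₂ X U V y) (hsymm : ContDiffOn ℝ ∞ e.symm e.target)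
    {y : J2} (hy : y ∈ e.source) :
    pq (fun y => newRhs X U V L (e.symm y)) (contactMap₂ X U V y) =
      pq L.H y * tdx X y ^ 2 := by
  have hy' := hsub hy
  have hm : DifferentiableAt ℝ (fun y => newRhs X U V L (e.symm y)) (contactMap₂ X U V y) := by
    refine differentiableAt_of_contDiffOn e.open_target (h.smooth_transformed_rhs hsub hsymm) ?_
    rw [← he]
    exact e.map_source hy
  have h1 := h.pq_comp_contactMap₂ hy'.1 hm
  have h2 : (fun y => newRhs X U V L (e.symm (contactMap₂ X U V y))) =ᶠ[𝓝 y]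
      newRhs X U V L := by
    filter_upwards [e.open_source.mem_nhds hy] with y' hy'
    rw [← he, e.left_inv hy']
  rw [pq_congr h2, h.pq_newRhs hy'.1.1 hy'.2] at h1
  have ha' := ha _ hy'.1.1
  have hx := hy'.1.2
  field_simp at h1
  exact h1.symm

/-- The transformed equation, over the image of a set on which the second prolongation has the
inverse `e.symm`. -/
noncomputable def transformedEquation (h : ContactOn X U V N)
    (ha : ∀ y ∈ N, contactFactor X U V y ≠ 0) (hsub : e.source ⊆ dom₂ X N ∩ L.dom)
    (he : ∀ y, e y = contactMap₂ X U V y) (hsymm : ContDiffOn ℝ ∞ e.symm e.target) :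
    Equation where
  dom := e.target
  isOpen_dom := e.open_target
  H := fun y => newRhs X U V L (e.symm y)
  smooth := h.smooth_transformed_rhs hsub hsymm
  nondeg y hy := by
    have h1 := h.pq_transformed_rhs ha hsub he hsymm (e.map_target hy)
    rw [← he, e.right_inv hy] at h1
    have h2 := hsub (e.map_target hy)
    rw [pq] at h1
    rw [h1]
    exact mul_ne_zero (L.nondeg _ h2.2) (pow_ne_zero 2 h2.1.2)

theorem isQuasiLinear_transformedEquation (h : ContactOn X U V N)
    (ha : ∀ y ∈ N, contactFactor X U V y ≠ 0) (hsub : e.source ⊆ dom₂ X N ∩ L.dom)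
    (he : ∀ y, e y = contactMap₂ X U V y) (hsymm : ContDiffOn ℝ ∞ e.symm e.target)
    (hX : ∀ y ∈ N, pp X y = 0) (hL : L.IsQuasiLinear) :
    (h.transformedEquation ha hsub he hsymm).IsQuasiLinear := by
  intro y hy
  change pq (pq fun y => newRhs X U V L (e.symm y)) y = 0
  set m := fun y => newRhs X U V L (e.symm y) with hm
  have hms := h.smooth_transformed_rhs hsub hsymm
  have hy1 := e.map_target hy
  have hy2 := hsub hy1
  have hmd : DifferentiableAt ℝ (pq m) (contactMap₂ X U V (e.symm y)) := by
    refine differentiableAt_of_contDiffOn e.open_target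
      ((hms.fderiv_of_isOpen e.open_target (by simp)).clm_apply contDiffOn_const) ?_
    rw [← he, e.right_inv hy]
    exact hy
  have h1 := h.pq_comp_contactMap₂ hy2.1 hmd
  have h2 : (fun y => pq m (contactMap₂ X U V y)) =ᶠ[𝓝 (e.symm y)]
      fun y => pq L.H y * (tdx X y * tdx X y) := by
    filter_upwards [e.open_source.mem_nhds hy1] with y' hy'
    rw [h.pq_transformed_rhs ha hsub he hsymm hy', sq]
  have hN := h.isOpen.preimage contDiff_J2_toJ1.continuous
  have dX := differentiableAt_of_contDiffOn hN (contDiffOn_tdx h.isOpen h.smooth_X) hy2.1.1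
  have dH : DifferentiableAt ℝ (pq L.H) (e.symm y) := differentiableAt_of_contDiffOn L.isOpen_dom
    ((L.smooth.fderiv_of_isOpen L.isOpen_dom (by simp)).clm_apply contDiffOn_const) hy2.2
  have hL' : pq (pq L.H) (e.symm y) = 0 := hL _ hy2.2
  rw [pq_congr h2, pq_mul dH (dX.fun_mul dX), pq_mul dX dX, pq_tdx h.isOpen h.smooth_X hy2.1.1,
    hX _ hy2.1.1, hL'] at h1
  have h3 := div_ne_zero (ha _ hy2.1.1) (pow_ne_zero 2 hy2.1.2)
  rw [← he, e.right_inv hy] at h1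
  have h4 : contactFactor X U V (e.symm y).toJ1 / tdx X (e.symm y) ^ 2 * pq (pq m) y = 0 := by
    rw [← h1]
    ring
  exact (mul_eq_zero.1 h4).resolve_left h3

end transformed

theorem toJ2_prolong_transformation (h : ContactOn X U V N)
    (ha : ∀ y ∈ N, contactFactor X U V y ≠ 0)
    (hr : ∀ y ∈ N, px X y + pu X y * y.2.2.2 ≠ 0 ∨ pp X y ≠ 0)
    (hinj : Set.InjOn (contactMap X U V) N) {w : Jet} (hw : toJ2 w ∈ dom₂ X N) :
    toJ2 ((h.transformation ha hr hinj).prolong w) = contactMap₂ X U V (toJ2 w) := by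
  set 𝒯 := h.transformation ha hr hinj
  have hopen : IsOpen {w | toJ2 w ∈ dom₂ X N} := h.isOpen_dom₂.preimage Equation.continuous_toJ2
  have hX : ∀ w, toJ2 w ∈ dom₂ X N → Dx 𝒯.jetX w = tdx X (toJ2 w) := fun w hw =>
    Dx_comp_toJ1 (differentiableAt_of_contDiffOn h.isOpen h.smooth_X hw.1)
  have h1 : ∀ w, toJ2 w ∈ dom₂ X N → 𝒯.newDx 𝒯.jetU w = V (toJ1 w) := by
    intro w hw
    have hU : Dx 𝒯.jetU w = tdx U (toJ2 w) :=
      Dx_comp_toJ1 (differentiableAt_of_contDiffOn h.isOpen h.smooth_U hw.1)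
    rw [ContactTransformation.newDx, hX w hw, hU, h.tdx_eq hw.1, mul_div_cancel_right₀ _ hw.2]
    rfl
  have h2 : 𝒯.newDx (𝒯.newDx 𝒯.jetU) w = tdx V (toJ2 w) / tdx X (toJ2 w) := by
    have e : Dx (𝒯.newDx 𝒯.jetU) w = Dx (fun w => V (toJ1 w)) w :=
      lineDeriv_congr (Filter.eventually_of_mem (hopen.mem_nhds hw) h1) _
    rw [ContactTransformation.newDx, hX w hw, e,
      Dx_comp_toJ1 (differentiableAt_of_contDiffOn h.isOpen h.smooth_V hw.1)]
  exact Prod.ext rfl (Prod.ext rfl (Prod.ext rfl (Prod.ext (h1 w hw) h2)))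

end ContactOn

/-- A contact map for which the conserved vector takes the form `(U D_x X, g - U D_t X)`, up to a
null divergence and on the solution jets, transforms the conserved vector to `(ũ, g)` and hence
its characteristic to `1`. -/
theorem ContactOn.exists_mapsPair {L : Equation} {D : Set Jet} (hD : IsOpen D) (P : CV L D)
    {z : Jet} (hzD : z ∈ D) (hz : z ∈ L.sol) {X U V g : J1 → ℝ} {N : Set J1}
    (h : ContactOn X U V N) (hzN : toJ1 z ∈ N) (hg : ContDiffOn ℝ ∞ g N)
    (ha : contactFactor X U V (toJ1 z) ≠ 0) (hx : tdx X (toJ2 z) ≠ 0)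
    (hgx : ∀ᶠ y in 𝓝 (toJ2 z), tdx g y = -(newRhs X U V L y * tdx X y))
    {Ψ : Jet → ℝ} (hΨ : SmoothAt Ψ z)
    (hP : ∀ᶠ w in 𝓝 z, w ∈ L.sol →
      P.1.1 w = U (toJ1 w) * Dx (fun w => X (toJ1 w)) w + Dx Ψ w ∧
      P.1.2 w = g (toJ1 w) - U (toJ1 w) * Dt (fun w => X (toJ1 w)) w - Dt Ψ w) :
    ∃ (D₁ : Set Jet) (hD₁ : D₁ ⊆ D) (𝒯 : ContactTransformation)
      (L' : Equation) (D' : Set Jet) (ℱ' : CL L' D'),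
      IsOpen D₁ ∧ (D₁ ∩ L.sol).Nonempty ∧ IsOpen D' ∧
      𝒯.MapsPair (CL.restrict hD₁ (CL.mk P)) ℱ' ∧ ℱ'.HasCharacteristic (fun _ => 1) ∧
      ((∃ X₀ U₀ : ℝ × ℝ × ℝ → ℝ, ∀ y ∈ N,
        X y = X₀ (y.1, y.2.1, y.2.2.1) ∧ U y = U₀ (y.1, y.2.1, y.2.2.1)) → 𝒯.IsPoint) ∧
      ((∀ y ∈ N, pp X y = 0) → L.IsQuasiLinear → L'.IsQuasiLinear) := by
  -- Shrink `N` so that `contactMap` has a smooth inverse and the transformation is regular.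
  have hR : IsOpen {y | y ∈ N ∧ contactFactor X U V y ≠ 0 ∧
      (px X y + pu X y * y.2.2.2 ≠ 0 ∨ pp X y ≠ 0)} := by
    have c1 := h.continuousOn_contactFactor.isOpen_inter_preimage h.isOpen
      (isOpen_compl_singleton (x := (0 : ℝ)))
    have hp : Continuous fun y : J1 => y.2.2.2 := by fun_prop
    have c2 := (((contDiffOn_pd h.isOpen h.smooth_X (0, 1, 0, 0)).continuousOn).add
      (((contDiffOn_pd h.isOpen h.smooth_X (0, 0, 1, 0)).continuousOn).mul
        hp.continuousOn)).isOpen_inter_preimage h.isOpen (isOpen_compl_singleton (x := (0 : ℝ)))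
    have c3 := ((contDiffOn_pd h.isOpen h.smooth_X
      (0, 0, 0, 1)).continuousOn).isOpen_inter_preimage h.isOpen
        (isOpen_compl_singleton (x := (0 : ℝ)))
    convert c1.inter (c2.union c3) using 1
    ext y
    constructor
    · rintro ⟨h1, h2, h3 | h3⟩
      exacts [⟨⟨h1, h2⟩, Or.inl ⟨h1, h3⟩⟩, ⟨⟨h1, h2⟩, Or.inr ⟨h1, h3⟩⟩]
    · rintro ⟨⟨h1, h2⟩, ⟨-, h3⟩ | ⟨-, h3⟩⟩
      exacts [⟨h1, h2, Or.inl h3⟩, ⟨h1, h2, Or.inr h3⟩]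
  have hzR : px X (toJ1 z) + pu X (toJ1 z) * (toJ1 z).2.2.2 ≠ 0 ∨ pp X (toJ1 z) ≠ 0 := by
    by_contra! hcon
    refine hx ?_
    have h1 := hcon.1
    simp only [tdx, toJ1_toJ2, hcon.2]
    change px X (toJ1 z) + pu X (toJ1 z) * z.2.2 0 1 = 0 at h1
    change px X (toJ1 z) + z.2.2 0 1 * pu X (toJ1 z) + _ = 0
    linear_combination h1
  obtain ⟨e₁, hz₁, hs₁, he₁, hsymm₁⟩ := (h.mono hR fun y hy => hy.1).exists_chart
    ⟨hzN, ha, hzR⟩ ha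
  have h₁ : ContactOn X U V e₁.source := h.mono e₁.open_source fun y hy => (hs₁ hy).1
  have ha₁ : ∀ y ∈ e₁.source, contactFactor X U V y ≠ 0 := fun y hy => (hs₁ hy).2.1
  have hr₁ : ∀ y ∈ e₁.source, px X y + pu X y * y.2.2.2 ≠ 0 ∨ pp X y ≠ 0 :=
    fun y hy => (hs₁ hy).2.2
  have hinj₁ : Set.InjOn (contactMap X U V) e₁.source := e₁.injOn.congr fun y _ => he₁ y
  -- The second prolongation on the jets where the identity for `g` holds.
  obtain ⟨S, hS, hSo, hzS⟩ := eventually_nhds_iff.1 hgx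
  have hz₁' : (toJ2 z).toJ1 ∈ e₁.source := hz₁
  obtain ⟨e₂, hz₂, hs₂, he₂, hsymm₂⟩ := h₁.exists_chart₂
    (S := dom₂ X e₁.source ∩ L.dom ∩ S) ((h₁.isOpen_dom₂.inter L.isOpen_dom).inter hSo)
    (fun y hy => hy.1.1) ⟨⟨⟨hz₁', hx⟩, hz.1⟩, hzS⟩ ha
  have hsub : e₂.source ⊆ dom₂ X e₁.source ∩ L.dom := fun y hy => (hs₂ hy).1
  set 𝒯 := h₁.transformation ha₁ hr₁ hinj₁ with h𝒯
  set L' := h₁.transformedEquation ha₁ hsub he₂ hsymm₂ with hL'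
  obtain ⟨W, hW, hWo, hzW⟩ := eventually_nhds_iff.1 (hP.and hΨ.eventually)
  set D₁ : Set Jet := D ∩ toJ2 ⁻¹' e₂.source ∩ W
  have hD₁ : IsOpen D₁ :=
    (hD.inter (e₂.open_source.preimage Equation.continuous_toJ2)).inter hWo
  have hDD : D₁ ⊆ D := fun w hw => hw.1.1
  have hN : ∀ w ∈ D₁, toJ1 w ∈ e₁.source := fun w hw => (hsub hw.1.2).1.1
  have hpro : ∀ w ∈ D₁, toJ2 (𝒯.prolong w) = e₂ (toJ2 w) := fun w hw => by
    rw [he₂]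
    exact h₁.toJ2_prolong_transformation ha₁ hr₁ hinj₁ (hsub hw.1.2).1
  have hXd : ∀ w ∈ D₁, SmoothAt (fun w => X (toJ1 w)) w := fun w hw =>
    smoothAt_comp_toJ1 h₁.isOpen h₁.smooth_X (hN w hw)
  have hUd : ∀ w ∈ D₁, SmoothAt (fun w => U (toJ1 w)) w := fun w hw =>
    smoothAt_comp_toJ1 h₁.isOpen h₁.smooth_U (hN w hw)
  have hgd : ∀ w ∈ D₁, SmoothAt (fun w => g (toJ1 w)) w := fun w hw =>
    smoothAt_comp_toJ1 h.isOpen hg (hs₁ (hN w hw)).1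
  -- The representative `(U D_x X, g - U D_t X)` of the conservation law.
  obtain ⟨P₁, hP₁, hmk⟩ := exists_mk_eq (Φ := Ψ) hD₁ ⟨P.1, CV_mono L hDD P.2⟩
    (fun w hw => (hUd w hw).mul (hXd w hw).Dx)
    (fun w hw => (hgd w hw).sub ((hUd w hw).mul (hXd w hw).Dt))
    (fun w hw => (hW w hw.2).2) (fun w hw hw' => (hW w hw.2).1 hw')
  -- Its image `(u, m)`.
  set m : J1 → ℝ := fun y => g (e₁.symm y) with hm
  have hms : ContDiffOn ℝ ∞ m e₁.target :=
    hg.comp hsymm₁ fun y hy => (hs₁ (e₁.map_target hy)).1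
  have hm1 : ∀ y ∈ e₁.source, m (contactMap X U V y) = g y := fun y hy => by
    rw [hm, ← he₁]
    simp only [e₁.left_inv hy]
  set D' : Set Jet := toJ2 ⁻¹' e₂.target
  have htar : ∀ y ∈ e₂.target, y.toJ1 ∈ e₁.target := fun y hy => by
    have h1 : (e₂ (e₂.symm y)).toJ1 = e₁ (e₂.symm y).toJ1 := by
      rw [he₂, he₁]
      rfl
    rw [e₂.right_inv hy] at h1
    rw [h1]
    exact e₁.map_source (hsub (e₂.map_target hy)).1.1
  have hmx : ∀ y ∈ e₂.target, tdx m y = -L'.H y := by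
    intro y hy
    have h0 := e₂.map_target hy
    have h1 := (hsub h0).1
    have h2 := hS _ (hs₂ h0).2
    have h3 := h₁.tdx_comp_contactMap h1 (m := m) (by
      rw [← he₁]
      exact differentiableAt_of_contDiffOn e₁.open_target hms (e₁.map_source h1.1))
    have h4 : tdx (fun y => m (contactMap X U V y)) (e₂.symm y) = tdx g (e₂.symm y) := by
      simp only [tdx, pu_eq, EvolCL.pp_eq, EvolCL.px_eq, pd_congr_on e₁.open_source h1.1 hm1]
    rw [← he₂, e₂.right_inv hy, h4, h2] at h3
    have h5 : L'.H y = newRhs X U V L (e₂.symm y) := rfl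
    rw [h5]
    refine mul_right_cancel₀ h1.2 ?_
    rw [← h3]
    ring
  have hdiv : ∀ w ∈ D', Dt (fun w : Jet => w.2.2 0 0) w + Dx (fun w => m (toJ1 w)) w =
      L'.defect w := by
    intro w hw
    have h1 : Dt (fun w : Jet => w.2.2 0 0) w = w.2.2 1 0 := lineDeriv_u 0 0 _ _
    rw [h1, Dx_comp_toJ1 (differentiableAt_of_contDiffOn e₁.open_target hms (htar _ hw)),
      hmx _ hw]
    rfl
  have hcv : (fun w : Jet => w.2.2 0 0, fun w => m (toJ1 w)) ∈ CV L' D' :=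
    ⟨fun w _ => smoothAt_u 0 0 w,
      fun w hw => smoothAt_comp_toJ1 e₁.open_target hms (htar _ hw),
      fun w hw => (hdiv w hw.1).trans (hw.2.2 0 0)⟩
  refine ⟨D₁, hDD, 𝒯, L', D', CL.mk ⟨_, hcv⟩, hD₁, ⟨z, ⟨⟨hzD, hz₂⟩, hzW⟩, hz⟩,
    e₂.open_target.preimage Equation.continuous_toJ2, ?_, ?_, ?_, ?_⟩
  · have hDx : ∀ w ∈ D₁, Dx 𝒯.jetX w ≠ 0 := by
      intro w hw
      have h1 : Dx 𝒯.jetX w = tdx X (toJ2 w) :=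
        Dx_comp_toJ1 (differentiableAt_of_contDiffOn h₁.isOpen h₁.smooth_X (hN w hw))
      rw [h1]
      exact (hsub hw.1.2).1.2
    have hmaps : ∀ w ∈ D₁, toJ2 (𝒯.prolong w) ∈ e₂.target := fun w hw => by
      rw [hpro w hw]
      exact e₂.map_source hw.1.2
    have hT : ∀ w : Jet, deriv 𝒯.T w.1 = 1 := fun w => deriv_id _
    refine ⟨fun w hw => ⟨(hsub hw.1.2).2, hN w hw, hDx w hw⟩, fun w hw => hw, hmaps, ?_,
      P₁, ⟨_, hcv⟩, hmk, rfl, ?_⟩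
    · intro w hw
      have h1 : L'.H (toJ2 (𝒯.prolong w)) = newRhs X U V L (toJ2 w) := by
        rw [hpro w hw]
        change newRhs X U V L (e₂.symm (e₂ (toJ2 w))) = _
        rw [e₂.left_inv hw.1.2]
      have h2 : contactV 𝒯.X 𝒯.U (toJ1 w) = V (toJ1 w) :=
        h₁.contactV_eq (hN w hw) (hr₁ _ (hN w hw))
      rw [h1, h2, hT, div_one, div_one]
      simp only [newRhs, contactFactor, toJ1_toJ2]
      change _ = (pu U (toJ1 w) - pu X (toJ1 w) * V (toJ1 w)) * L.H (toJ2 w) +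
        (pt U (toJ1 w) - pt X (toJ1 w) * V (toJ1 w))
      ring
    · intro w hw
      have hJ : toJ1 (𝒯.prolong w) = contactMap X U V (toJ1 w) := by
        rw [← toJ1_toJ2, hpro w hw, he₂]
        rfl
      rw [hP₁, hT, div_one, div_one]
      constructor
      · change U (toJ1 w) = U (toJ1 w) * Dx 𝒯.jetX w / Dx 𝒯.jetX w
        rw [mul_div_cancel_right₀ _ (hDx w hw)]
      · change m (toJ1 (𝒯.prolong w)) = (g (toJ1 w) - U (toJ1 w) * Dt 𝒯.jetX w) +
          Dt 𝒯.jetX w / Dx 𝒯.jetX w * (U (toJ1 w) * Dx 𝒯.jetX w)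
        rw [hJ, hm1 _ (hN w hw)]
        have := hDx w hw
        field_simp
        ring
  · refine ⟨fun w _ => smoothAt_const 1 w, ⟨_, hcv⟩, rfl, fun w hw => ?_⟩
    rw [one_mul]
    exact hdiv w hw
  · rintro ⟨X₀, U₀, h0⟩
    exact ⟨X₀, U₀, fun y hy => h0 y (hs₁ hy).1⟩
  · intro hpX hqL
    exact h₁.isQuasiLinear_transformedEquation ha₁ hsub he₂ hsymm₂
      (fun y hy => hpX y (hs₁ hy).1) hqL

/-! ### Darboux coordinates -/

theorem tdx_add {f g : J1 → ℝ} {y : J2} (hf : DifferentiableAt ℝ f y.toJ1)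
    (hg : DifferentiableAt ℝ g y.toJ1) : tdx (fun y => f y + g y) y = tdx f y + tdx g y := by
  simp only [tdx, px_eq, pu_eq, pp_eq, pd_add hf hg]
  ring

theorem tdx_mul {f g : J1 → ℝ} {y : J2} (hf : DifferentiableAt ℝ f y.toJ1)
    (hg : DifferentiableAt ℝ g y.toJ1) :
    tdx (fun y => f y * g y) y = tdx f y * g y.toJ1 + f y.toJ1 * tdx g y := by
  simp only [tdx, px_eq, pu_eq, pp_eq, pd_mul hf hg]
  ring

/-- Near `z` the pair `P` is equivalent to `(f, k - f_{u_x} H)`, with functions `f`, `k` of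
`(t, x, u, u_x)`: on the solution jets the difference is the null divergence of `Ψ`. -/
structure NormalFormAt (L : Equation) (P : (Jet → ℝ) × (Jet → ℝ)) (f k : J1 → ℝ) (N : Set J1)
    (Ψ : Jet → ℝ) (z : Jet) : Prop where
  mem_sol : z ∈ L.sol
  isOpen : IsOpen N
  mem : toJ1 z ∈ N
  smooth_f : ContDiffOn ℝ ∞ f N
  smooth_k : ContDiffOn ℝ ∞ k N
  smooth_Ψ : SmoothAt Ψ z
  eq : ∀ᶠ w in 𝓝 z, w ∈ L.sol → P.1 w = f (toJ1 w) + Dx Ψ w ∧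
    P.2 w = k (toJ1 w) - pp f (toJ1 w) * L.rhs w - Dt Ψ w
  identity : ∀ᶠ y in 𝓝 (toJ2 z),
    pt f y.toJ1 + (pu f y.toJ1 - tdx (pp f) y) * L.H y + tdx k y = 0

/-- The normal form persists at the neighbouring solution jets. -/
theorem NormalFormAt.eventually {L : Equation} {P : (Jet → ℝ) × (Jet → ℝ)} {f k : J1 → ℝ}
    {N : Set J1} {Ψ : Jet → ℝ} {z : Jet} (h : NormalFormAt L P f k N Ψ z) :
    ∀ᶠ w in 𝓝 z, w ∈ L.sol → NormalFormAt L P f k N Ψ w := by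
  filter_upwards [Equation.continuous_toJ1.continuousAt.eventually (h.isOpen.mem_nhds h.mem),
    h.smooth_Ψ.eventually, h.eq.eventually_nhds,
    Equation.continuous_toJ2.continuousAt.eventually h.identity.eventually_nhds] with w h1 h2 h3 h4 hw
  exact ⟨hw, h.isOpen, h1, h.smooth_f, h.smooth_k, h2, h3, h4⟩

/-- The relation `(f - u_x f_{u_x}) dx + f_{u_x} du = dΦ + U dX` on the fibres of `t`. The form on
the left is the Poincaré–Cartan form of the variational problem with Lagrangian `f`. -/
structure DarbouxOn (f X U Φ : J1 → ℝ) (N : Set J1) : Prop where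
  isOpen : IsOpen N
  smooth_f : ContDiffOn ℝ ∞ f N
  smooth_X : ContDiffOn ℝ ∞ X N
  smooth_U : ContDiffOn ℝ ∞ U N
  smooth_Φ : ContDiffOn ℝ ∞ Φ N
  pp_eq : ∀ y ∈ N, pp Φ y = -(U y * pp X y)
  pu_eq : ∀ y ∈ N, pu Φ y = pp f y - U y * pu X y
  px_eq : ∀ y ∈ N, px Φ y = f y - y.2.2.2 * pp f y - U y * px X y

namespace DarbouxOn

variable {f X U V Φ : J1 → ℝ} {N : Set J1}

theorem mono (h : DarbouxOn f X U Φ N) {N' : Set J1} (hN' : IsOpen N') (hsub : N' ⊆ N) :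
    DarbouxOn f X U Φ N' :=
  ⟨hN', h.smooth_f.mono hsub, h.smooth_X.mono hsub, h.smooth_U.mono hsub, h.smooth_Φ.mono hsub,
    fun y hy => h.pp_eq y (hsub hy), fun y hy => h.pu_eq y (hsub hy),
    fun y hy => h.px_eq y (hsub hy)⟩

/-- The exterior derivative of the Darboux relation: `dX ∧ dU` in terms of `f`. -/
theorem wedge_eq (h : DarbouxOn f X U Φ N) {y : J1} (hy : y ∈ N) :
    pp U y * pu X y - pu U y * pp X y = pp (pp f) y ∧
    px U y * pp X y - pp U y * px X y = y.2.2.2 * pp (pp f) y ∧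
    pu U y * px X y - px U y * pu X y = pu f y - y.2.2.2 * pu (pp f) y - px (pp f) y := by
  have dX := fun v => differentiableAt_of_contDiffOn h.isOpen (contDiffOn_pd h.isOpen h.smooth_X v)
    hy
  have df := fun v => differentiableAt_of_contDiffOn h.isOpen (contDiffOn_pd h.isOpen h.smooth_f v)
    hy
  have df0 := differentiableAt_of_contDiffOn h.isOpen h.smooth_f hy
  have dU := differentiableAt_of_contDiffOn h.isOpen h.smooth_U hy
  have dp : DifferentiableAt ℝ (fun y : J1 => y.2.2.2) y := by fun_prop
  have e1 := fun v => pd_congr_on h.isOpen hy h.pp_eq v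
  have e2 := fun v => pd_congr_on h.isOpen hy h.pu_eq v
  have e3 := fun v => pd_congr_on h.isOpen hy h.px_eq v
  simp only [EvolCL.pu_eq, EvolCL.pp_eq, EvolCL.px_eq] at e1 e2 e3 ⊢
  simp only [pd_neg, pd_mul dU (dX _)] at e1
  simp only [pd_sub (df _) (dU.fun_mul (dX _)), pd_mul dU (dX _)] at e2
  simp only [pd_sub (df0.fun_sub (dp.fun_mul (df _))) (dU.fun_mul (dX _)),
    pd_sub df0 (dp.fun_mul (df _)), pd_mul dp (df _), pd_mul dU (dX _), pd_coord_p] at e3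
  have cΦ := fun v v' => pd_comm h.isOpen h.smooth_Φ hy v v'
  have cX := fun v v' => pd_comm h.isOpen h.smooth_X hy v v'
  refine ⟨?_, ?_, ?_⟩
  · have a := e1 (0, 0, 1, 0)
    have b := e2 (0, 0, 0, 1)
    rw [cΦ, cX (0, 0, 1, 0)] at a
    linear_combination b - a
  · have a := e1 (0, 1, 0, 0)
    have b := e3 (0, 0, 0, 1)
    rw [cΦ, cX (0, 1, 0, 0)] at a
    simp only at b
    linear_combination a - b
  · have a := e2 (0, 1, 0, 0)
    have b := e3 (0, 0, 1, 0)
    rw [cΦ, cX (0, 1, 0, 0)] at a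
    simp only at b
    linear_combination b - a

theorem tdx_Φ (h : DarbouxOn f X U Φ N) {y : J2} (hy : y.toJ1 ∈ N) :
    tdx Φ y = f y.toJ1 - U y.toJ1 * tdx X y := by
  have e := h.px_eq _ hy
  change px Φ y.toJ1 = f y.toJ1 - y.2.2.2.1 * pp f y.toJ1 - U y.toJ1 * px X y.toJ1 at e
  simp only [tdx, h.pp_eq _ hy, h.pu_eq _ hy, e]
  ring

/-- Under a contact map with the Darboux relation the variational derivative of `f` is the
contact factor times `D_x X`. -/
theorem euler_eq (h : DarbouxOn f X U Φ N) (hc : ContactOn X U V N) {y : J2} (hy : y.toJ1 ∈ N) :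
    pu f y.toJ1 - tdx (pp f) y = contactFactor X U V y.toJ1 * tdx X y := by
  obtain ⟨e1, -, e3⟩ := h.wedge_eq hy
  have c1 := hc.pp_eq _ hy
  have c2 := hc.px_eq _ hy
  simp only [tdx, contactFactor]
  change pu U y.toJ1 * px X y.toJ1 - px U y.toJ1 * pu X y.toJ1 = pu f y.toJ1 -
    y.2.2.2.1 * pu (pp f) y.toJ1 - px (pp f) y.toJ1 at e3
  change px U y.toJ1 + y.2.2.2.1 * pu U y.toJ1 =
    V y.toJ1 * (px X y.toJ1 + y.2.2.2.1 * pu X y.toJ1) at c2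
  linear_combination -e3 + y.2.2.2.2 * e1 - pu X y.toJ1 * c2 - y.2.2.2.2 * pu X y.toJ1 * c1

/-- The function `g` for which `(U D_x X, g - U D_t X)` is equivalent to a conserved vector in
normal form. -/
theorem tdx_flux (h : DarbouxOn f X U Φ N) (hc : ContactOn X U V N) {L : Equation} {k : J1 → ℝ}
    (hk : ContDiffOn ℝ ∞ k N) {y : J2} (hy : y.toJ1 ∈ N)
    (hnf : pt f y.toJ1 + (pu f y.toJ1 - tdx (pp f) y) * L.H y + tdx k y = 0) :
    tdx (fun y => k y + (pt Φ y + U y * pt X y)) y =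
      -(ContactOn.newRhs X U V L y * tdx X y) := by
  have dX := fun v => differentiableAt_of_contDiffOn h.isOpen (contDiffOn_pd h.isOpen h.smooth_X v)
    hy
  have df := fun v => differentiableAt_of_contDiffOn h.isOpen (contDiffOn_pd h.isOpen h.smooth_f v)
    hy
  have dΦ := fun v => differentiableAt_of_contDiffOn h.isOpen (contDiffOn_pd h.isOpen h.smooth_Φ v)
    hy
  have df0 := differentiableAt_of_contDiffOn h.isOpen h.smooth_f hy
  have dU := differentiableAt_of_contDiffOn h.isOpen h.smooth_U hy
  have dk := differentiableAt_of_contDiffOn h.isOpen hk hy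
  have dp : DifferentiableAt ℝ (fun y : J1 => y.2.2.2) y.toJ1 := by fun_prop
  have hΦt : tdx (pt Φ) y = pt f y.toJ1 - pt U y.toJ1 * tdx X y - U y.toJ1 * tdx (pt X) y := by
    have e1 := pd_congr_on h.isOpen hy h.pp_eq (1, 0, 0, 0)
    have e2 := pd_congr_on h.isOpen hy h.pu_eq (1, 0, 0, 0)
    have e3 := pd_congr_on h.isOpen hy h.px_eq (1, 0, 0, 0)
    simp only [tdx, EvolCL.pu_eq, EvolCL.pp_eq, EvolCL.px_eq, pt_eq] at e1 e2 e3 ⊢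
    simp only [pd_neg, pd_mul dU (dX _)] at e1
    simp only [pd_sub (df _) (dU.fun_mul (dX _)), pd_mul dU (dX _)] at e2
    simp only [pd_sub (df0.fun_sub (dp.fun_mul (df _))) (dU.fun_mul (dX _)),
      pd_sub df0 (dp.fun_mul (df _)), pd_mul dp (df _), pd_mul dU (dX _), pd_coord_p] at e3
    have hp : y.toJ1.2.2.2 = y.2.2.2.1 := rfl
    rw [hp] at e3
    simp only [pd_comm h.isOpen h.smooth_Φ hy _ (1, 0, 0, 0),
      pd_comm h.isOpen h.smooth_X hy _ (1, 0, 0, 0)]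
    simp only [zero_mul, zero_add] at e3
    linear_combination e3 + y.2.2.2.1 * e2 + y.2.2.2.2 * e1
  have h1 : DifferentiableAt ℝ (pt Φ) y.toJ1 := dΦ _
  have h2 : DifferentiableAt ℝ (pt X) y.toJ1 := dX _
  rw [tdx_add dk (h1.fun_add (dU.fun_mul h2)), tdx_add h1 (dU.fun_mul h2), tdx_mul dU h2, hΦt,
    hc.tdx_eq hy, ContactOn.newRhs]
  rw [h.euler_eq hc hy] at hnf
  linear_combination hnf

theorem smooth_flux (h : DarbouxOn f X U Φ N) {k : J1 → ℝ} (hk : ContDiffOn ℝ ∞ k N) :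
    ContDiffOn ℝ ∞ (fun y => k y + (pt Φ y + U y * pt X y)) N :=
  hk.add ((contDiffOn_pd h.isOpen h.smooth_Φ _).add
    (h.smooth_U.mul (contDiffOn_pd h.isOpen h.smooth_X _)))

/-- The conserved vector in terms of `X` and `U`, up to a null divergence and on the solution
jets. -/
theorem conservedVector_eq (h : DarbouxOn f X U Φ N) {L : Equation}
    {P : (Jet → ℝ) × (Jet → ℝ)} {z : Jet} {k : J1 → ℝ} {N₀ : Set J1} {Ψ : Jet → ℝ}
    (hnf : NormalFormAt L P f k N₀ Ψ z) (hzN : toJ1 z ∈ N) :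
    ∀ᶠ w in 𝓝 z, w ∈ L.sol →
      P.1 w = U (toJ1 w) * Dx (fun w => X (toJ1 w)) w + Dx (fun w => Φ (toJ1 w) + Ψ w) w ∧
      P.2 w = (k (toJ1 w) + (pt Φ (toJ1 w) + U (toJ1 w) * pt X (toJ1 w))) -
        U (toJ1 w) * Dt (fun w => X (toJ1 w)) w - Dt (fun w => Φ (toJ1 w) + Ψ w) w := by
  have hmem : ∀ᶠ w in 𝓝 z, toJ1 w ∈ N :=
    Equation.continuous_toJ1.continuousAt.eventually (h.isOpen.mem_nhds hzN)
  filter_upwards [hnf.eq, hmem, hnf.smooth_Ψ.eventually] with w h1 h2 h3 hw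
  have hΦs := smoothAt_comp_toJ1 h.isOpen h.smooth_Φ h2
  have dΦ := differentiableAt_of_contDiffOn h.isOpen h.smooth_Φ h2
  have dX := differentiableAt_of_contDiffOn h.isOpen h.smooth_X h2
  have e1 : Dx (fun w => Φ (toJ1 w) + Ψ w) w = Dx (fun w => Φ (toJ1 w)) w + Dx Ψ w :=
    hΦs.lineDeriv_add h3 _
  have e2 : Dt (fun w => Φ (toJ1 w) + Ψ w) w = Dt (fun w => Φ (toJ1 w)) w + Dt Ψ w :=
    hΦs.lineDeriv_add h3 _
  have e3 : w.2.2 1 0 = L.rhs w := Equation.sol_eq hw 0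
  have e4 := h.tdx_Φ (y := toJ2 w) h2
  rw [(h1 hw).1, (h1 hw).2, e1, e2, Dx_comp_toJ1 dX, Dx_comp_toJ1 dΦ, Dt_comp_toJ1 dX,
    Dt_comp_toJ1 dΦ, e4, e3, h.pp_eq _ h2, h.pu_eq _ h2, toJ1_toJ2]
  constructor <;> ring

theorem eventually_tdx_flux (h : DarbouxOn f X U Φ N) (hc : ContactOn X U V N) {L : Equation}
    {P : (Jet → ℝ) × (Jet → ℝ)} {z : Jet} {k : J1 → ℝ} {N₀ : Set J1} {Ψ : Jet → ℝ}
    (hnf : NormalFormAt L P f k N₀ Ψ z) (hk : ContDiffOn ℝ ∞ k N) (hzN : toJ1 z ∈ N) :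
    ∀ᶠ y in 𝓝 (toJ2 z), tdx (fun y => k y + (pt Φ y + U y * pt X y)) y =
      -(ContactOn.newRhs X U V L y * tdx X y) := by
  have hmem₂ : ∀ᶠ y in 𝓝 (toJ2 z), y.toJ1 ∈ N :=
    contDiff_J2_toJ1.continuous.continuousAt.eventually (h.isOpen.mem_nhds hzN)
  filter_upwards [hnf.identity, hmem₂] with y h1 h2
  exact h.tdx_flux hc hk h2 h1

/-- Darboux coordinates for the density of the normal form normalise the characteristic. -/
theorem exists_mapsPair (h : DarbouxOn f X U Φ N) (hc : ContactOn X U V N)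
    {L : Equation} {D : Set Jet} (hD : IsOpen D) (P : CV L D)
    {z : Jet} (hzD : z ∈ D) {k : J1 → ℝ} {N₀ : Set J1} {Ψ : Jet → ℝ}
    (hnf : NormalFormAt L P.1 f k N₀ Ψ z) (hN₀ : N ⊆ N₀) (hzN : toJ1 z ∈ N)
    (ha : contactFactor X U V (toJ1 z) ≠ 0) (hx : tdx X (toJ2 z) ≠ 0) :
    ∃ (D₁ : Set Jet) (hD₁ : D₁ ⊆ D) (𝒯 : ContactTransformation)
      (L' : Equation) (D' : Set Jet) (ℱ' : CL L' D'),
      IsOpen D₁ ∧ (D₁ ∩ L.sol).Nonempty ∧ IsOpen D' ∧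
      𝒯.MapsPair (CL.restrict hD₁ (CL.mk P)) ℱ' ∧ ℱ'.HasCharacteristic (fun _ => 1) ∧
      ((∃ X₀ U₀ : ℝ × ℝ × ℝ → ℝ, ∀ y ∈ N,
        X y = X₀ (y.1, y.2.1, y.2.2.1) ∧ U y = U₀ (y.1, y.2.1, y.2.2.1)) → 𝒯.IsPoint) ∧
      ((∀ y ∈ N, pp X y = 0) → L.IsQuasiLinear → L'.IsQuasiLinear) :=
  have hk := hnf.smooth_k.mono hN₀
  hc.exists_mapsPair hD P hzD hnf.mem_sol hzN (h.smooth_flux hk) ha hx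
    (h.eventually_tdx_flux hc hnf hk hzN)
    ((smoothAt_comp_toJ1 h.isOpen h.smooth_Φ hzN).add hnf.smooth_Ψ)
    (h.conservedVector_eq hnf hzN)

end DarbouxOn

/-! ### Lagrangians affine in `u_x` -/

theorem eq_of_fderiv_eq_zero {E : Type*} [NormedAddCommGroup E] [NormedSpace ℝ E] {B : Set E}
    (hB : Convex ℝ B) {f : E → ℝ} (hf : ∀ y ∈ B, DifferentiableAt ℝ f y) {y y' : E} (hy : y ∈ B)
    (hy' : y' ∈ B) (h : ∀ x ∈ B, fderiv ℝ f x (y' - y) = 0) : f y' = f y := by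
  have hmem : ∀ s ∈ Set.Icc (0 : ℝ) 1, y + s • (y' - y) ∈ B := fun s hs =>
    hB.add_smul_sub_mem hy hy' hs
  have hd : ∀ s ∈ Set.Icc (0 : ℝ) 1, HasDerivAt (fun s : ℝ => f (y + s • (y' - y))) 0 s := by
    intro s hs
    have h1 : HasDerivAt (fun s : ℝ => y + s • (y' - y)) ((1 : ℝ) • (y' - y)) s :=
      ((hasDerivAt_id s).smul_const (y' - y)).const_add y
    have h2 := (hf _ (hmem s hs)).hasFDerivAt.comp_hasDerivAt s h1
    rw [one_smul, h _ (hmem s hs)] at h2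
    exact h2
  have := constant_of_has_deriv_right_zero
    (fun s hs => (hd s hs).continuousAt.continuousWithinAt)
    (fun s hs => (hd s (Set.Ico_subset_Icc_self hs)).hasDerivWithinAt) 1 (by simp)
  simpa using this

/-- A function which is constant along the kernel of a projection `π` has a primitive, in a
direction `e` of the range, with the same property. -/
theorem exists_primitive_of_projection {N : Set J1} (hN : IsOpen N) {y₀ : J1} (hy₀ : y₀ ∈ N)
    {f : J1 → ℝ} (hf : ContDiffOn ℝ ∞ f N) {π : J1 →L[ℝ] J1} (hπ : ∀ v, π (π v) = π v)
    (hfπ : ∀ᶠ y in 𝓝 y₀, ∀ v, π v = 0 → pd v f y = 0) {e : J1} (he : π e = e)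
    {φ : J1 →L[ℝ] ℝ} (hφ : φ e = 1) :
    ∃ Φ : J1 → ℝ, ContDiff ℝ ∞ Φ ∧ (∀ᶠ y in 𝓝 y₀, pd e Φ y = f y) ∧
      ∀ v, π v = 0 → ∀ y, pd v Φ y = 0 := by
  obtain ⟨Φ, hΦ, hΦf⟩ := exists_smooth_primitive hN hy₀ hf hφ
  let r : J1 → J1 := fun y => y₀ + π (y - y₀)
  have hr : ContDiff ℝ ∞ r := by
    have := π.contDiff (n := ∞)
    fun_prop
  have hr0 : r y₀ = y₀ := by simp [r]
  have hrd : ∀ y, HasFDerivAt r π y := fun y =>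
    (π.hasFDerivAt.comp y ((hasFDerivAt_id y).sub_const y₀)).const_add y₀
  have hd : ∀ v y, pd v (fun y => Φ (r y)) y = pd (π v) Φ (r y) := by
    intro v y
    have h1 : HasFDerivAt (fun y => Φ (r y)) _ y :=
      HasFDerivAt.comp y ((hΦ.differentiable (by simp)) (r y)).hasFDerivAt (hrd y)
    rw [pd, h1.fderiv]
    rfl
  refine ⟨fun y => Φ (r y), hΦ.comp hr, ?_, fun v hv y => ?_⟩
  · have hmem : ∀ᶠ y in 𝓝 y₀, y ∈ N := hN.mem_nhds hy₀
    obtain ⟨ε, hε, hball⟩ := Metric.eventually_nhds_iff_ball.1 (hfπ.and hmem)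
    have hrt : Filter.Tendsto r (𝓝 y₀) (𝓝 y₀) := by
      have := hr.continuous.tendsto y₀
      rwa [hr0] at this
    filter_upwards [hrt.eventually hΦf, Metric.ball_mem_nhds y₀ hε,
      hrt.eventually (Metric.ball_mem_nhds y₀ hε)] with y h1 h2 h3
    rw [hd, he]
    refine h1.trans (eq_of_fderiv_eq_zero (convex_ball y₀ ε) (fun x hx =>
      differentiableAt_of_contDiffOn hN hf (hball x hx).2) h2 h3 fun x hx => ?_)
    refine (hball x hx).1 _ ?_
    have : r y - y = π (y - y₀) - (y - y₀) := by
      simp only [r]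
      abel
    rw [this, map_sub, hπ, sub_self]
  · rw [hd, hv, pd, map_zero]

/-- The projection to the variables `t`, `x`, `u`. -/
def projTXU : J1 →L[ℝ] J1 where
  toFun y := (y.1, y.2.1, y.2.2.1, 0)
  map_add' _ _ := by simp
  map_smul' _ _ := by simp
  cont := by fun_prop

/-- The projection to the variables `t`, `x`. -/
def projTX : J1 →L[ℝ] J1 where
  toFun y := (y.1, y.2.1, 0, 0)
  map_add' _ _ := by simp
  map_smul' _ _ := by simp
  cont := by fun_prop

/-- The projection to the variable `t`. -/
def projT : J1 →L[ℝ] J1 where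
  toFun y := (y.1, 0, 0, 0)
  map_add' _ _ := by simp
  map_smul' _ _ := by simp
  cont := by fun_prop

theorem projTXU_apply (y : J1) : projTXU y = (y.1, y.2.1, y.2.2.1, 0) := rfl

theorem projTX_apply (y : J1) : projTX y = (y.1, y.2.1, 0, 0) := rfl

theorem projT_apply (y : J1) : projT y = (y.1, 0, 0, 0) := rfl

theorem pd_eq_zero_of_projTXU {f : J1 → ℝ} {y v : J1} (h : pp f y = 0) (hv : projTXU v = 0) :
    pd v f y = 0 := by
  simp only [projTXU_apply, Prod.mk_eq_zero] at hv
  rw [pd, fderiv_J1_apply, h, hv.1, hv.2.1, hv.2.2.1]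
  ring

theorem pd_eq_zero_of_projTX {f : J1 → ℝ} {y v : J1} (h : pp f y = 0) (h' : pu f y = 0)
    (hv : projTX v = 0) : pd v f y = 0 := by
  simp only [projTX_apply, Prod.mk_eq_zero] at hv
  rw [pd, fderiv_J1_apply, h, h', hv.1, hv.2.1]
  ring

theorem pd_eq_zero_of_projT {f : J1 → ℝ} {y v : J1} (h : pp f y = 0) (h' : pu f y = 0)
    (h'' : px f y = 0) (hv : projT v = 0) : pd v f y = 0 := by
  simp only [projT_apply, Prod.mk_eq_zero] at hv
  rw [pd, fderiv_J1_apply, h, h', h'', hv.1]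
  ring

/-- For `f` affine in `u_x`, the Darboux relation holds with `X = x`, and `U`, `Φ` do not depend
on `u_x`. -/
theorem exists_darboux_of_affine {N : Set J1} (hN : IsOpen N) {y₀ : J1} (hy₀ : y₀ ∈ N)
    {f : J1 → ℝ} (hf : ContDiffOn ℝ ∞ f N) (hpp : ∀ᶠ y in 𝓝 y₀, pp (pp f) y = 0) :
    ∃ (U Φ : J1 → ℝ) (N' : Set J1), y₀ ∈ N' ∧ N' ⊆ N ∧ DarbouxOn f (fun y => y.2.1) U Φ N' ∧
      (∀ y ∈ N', pp Φ y = 0) ∧ (∀ y ∈ N', pp U y = 0) ∧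
      ∃ U₀ : ℝ × ℝ × ℝ → ℝ, ∀ y ∈ N', U y = U₀ (y.1, y.2.1, y.2.2.1) := by
  obtain ⟨Φ, hΦ, hΦu, hΦp⟩ := exists_primitive_of_projection hN hy₀
    (contDiffOn_pd hN hf (0, 0, 0, 1)) (π := projTXU) (fun v => rfl)
    (hpp.mono fun y hy v hv => pd_eq_zero_of_projTXU hy hv) (e := (0, 0, 1, 0)) rfl
    (φ := (ContinuousLinearMap.fst ℝ ℝ ℝ).comp ((ContinuousLinearMap.snd ℝ ℝ (ℝ × ℝ)).comp
      (ContinuousLinearMap.snd ℝ ℝ (ℝ × ℝ × ℝ)))) rfl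
  have hpΦ : ∀ y, pp Φ y = 0 := hΦp (0, 0, 0, 1) rfl
  have hmem : ∀ᶠ y in 𝓝 y₀, y ∈ N := hN.mem_nhds hy₀
  obtain ⟨ε, hε, hball⟩ := Metric.eventually_nhds_iff_ball.1 ((hpp.and hΦu).and hmem)
  have hp : ContDiff ℝ ∞ fun y : J1 => y.2.2.2 := by fun_prop
  have hx : ContDiff ℝ ∞ fun y : J1 => y.2.1 := by fun_prop
  have hsub : Metric.ball y₀ ε ⊆ N := fun y hy => (hball y hy).2
  set U : J1 → ℝ := fun y => f y - y.2.2.2 * pp f y - px Φ y with hU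
  have hUs : ContDiffOn ℝ ∞ U (Metric.ball y₀ ε) :=
    ((hf.sub (hp.contDiffOn.mul (contDiffOn_pd hN hf (0, 0, 0, 1)))).mono hsub).sub
      (contDiffOn_pd Metric.isOpen_ball hΦ.contDiffOn (0, 1, 0, 0))
  have hUp : ∀ y ∈ Metric.ball y₀ ε, pp U y = 0 := by
    intro y hy
    have df := differentiableAt_of_contDiffOn hN hf (hsub hy)
    have dfp := differentiableAt_of_contDiffOn hN (contDiffOn_pd hN hf (0, 0, 0, 1)) (hsub hy)
    have dΦ := differentiableAt_of_contDiffOn Metric.isOpen_ball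
      (contDiffOn_pd Metric.isOpen_ball hΦ.contDiffOn (0, 1, 0, 0)) hy
    have dp : DifferentiableAt ℝ (fun y : J1 => y.2.2.2) y := by fun_prop
    have e1 := (hball y hy).1.1
    have e2 : pd (0, 0, 0, 1) (pd (0, 1, 0, 0) Φ) y = 0 := by
      rw [pd_comm Metric.isOpen_ball hΦ.contDiffOn hy,
        pd_congr_on (f := pd (0, 0, 0, 1) Φ) (g := fun _ => 0) Metric.isOpen_ball hy
          fun y _ => hpΦ y, pd_const]
    simp only [hU, pp_eq, px_eq] at e1 ⊢
    rw [pd_sub (df.fun_sub (dp.fun_mul dfp)) dΦ, pd_sub df (dp.fun_mul dfp), pd_mul dp dfp,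
      pd_coord_p, e1, e2]
    ring
  refine ⟨U, Φ, Metric.ball y₀ ε, Metric.mem_ball_self hε, hsub, ?_, fun y _ => hpΦ y, hUp,
    fun a => U (a.1, a.2.1, a.2.2, y₀.2.2.2), fun y hy => ?_⟩
  · refine ⟨Metric.isOpen_ball, hf.mono hsub, hx.contDiffOn, hUs, hΦ.contDiffOn, ?_, ?_, ?_⟩
    · intro y hy
      rw [hpΦ, pp_eq, pd_coord_x]
      ring
    · intro y hy
      have := (hball y hy).1.2
      rw [pu_eq Φ, this, pu_eq, pd_coord_x]
      change pp f y = _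
      ring
    · intro y hy
      rw [px_eq (fun y : J1 => y.2.1), pd_coord_x]
      simp only [hU]
      ring
  · have hy' : ((y.1, y.2.1, y.2.2.1, y₀.2.2.2) : J1) ∈ Metric.ball y₀ ε := by
      simp only [Metric.mem_ball, Prod.dist_eq, max_lt_iff] at hy ⊢
      exact ⟨hy.1, hy.2.1, hy.2.2.1, by simpa using hε⟩
    refine eq_of_fderiv_eq_zero (convex_ball y₀ ε)
      (fun x hx => differentiableAt_of_contDiffOn Metric.isOpen_ball hUs hx) hy' hy fun x hx => ?_
    exact pd_eq_zero_of_projTXU (hUp x hx) (by simp [projTXU_apply])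

theorem DarbouxOn.contactOn_of_affine {f U Φ : J1 → ℝ} {N : Set J1}
    (h : DarbouxOn f (fun y => y.2.1) U Φ N) (hU : ∀ y ∈ N, pp U y = 0) :
    ContactOn (fun y => y.2.1) U (fun y => px U y + y.2.2.2 * pu U y) N := by
  have hp : ContDiff ℝ ∞ fun y : J1 => y.2.2.2 := by fun_prop
  refine ⟨h.isOpen, h.smooth_X, h.smooth_U, (contDiffOn_pd h.isOpen h.smooth_U _).add
    (hp.contDiffOn.mul (contDiffOn_pd h.isOpen h.smooth_U _)), fun y hy => ?_, fun y hy => ?_⟩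
  · rw [hU y hy, EvolCL.pp_eq, pd_coord_x]
    ring
  · rw [EvolCL.px_eq (fun y : J1 => y.2.1), EvolCL.pu_eq (fun y : J1 => y.2.1), pd_coord_x,
      pd_coord_x]
    ring

/-- The kernel of `D_x` consists of the functions of `t`. -/
theorem eventually_eq_zero_of_tdx_eq_zero {g : J1 → ℝ} {N : Set J1} (hN : IsOpen N) (hg : ContDiffOn ℝ ∞ g N)
    {y₀ : J2} (hy₀ : y₀.toJ1 ∈ N) (h : ∀ᶠ y in 𝓝 y₀, tdx g y = 0) :
    ∀ᶠ y in 𝓝 y₀.toJ1, px g y = 0 ∧ pu g y = 0 ∧ pp g y = 0 := by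
  have hmem : ∀ᶠ y in 𝓝 y₀.toJ1, y ∈ N := hN.mem_nhds hy₀
  let ins : J1 → J2 := fun y => (y.1, y.2.1, y.2.2.1, y.2.2.2, y₀.2.2.2.2)
  have hins : Filter.Tendsto ins (𝓝 y₀.toJ1) (𝓝 y₀) := by
    have : Continuous ins := by fun_prop
    exact this.tendsto _
  have hp : ∀ᶠ y in 𝓝 y₀.toJ1, pp g y = 0 := by
    filter_upwards [hins.eventually h.eventually_nhds, hmem] with y h1 h2
    have h3 := pq_tdx (y := ins y) hN hg h2
    rw [pq_congr (g := fun _ => 0) h1] at h3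
    rw [show (ins y).toJ1 = y from rfl] at h3
    rw [← h3]
    simp [pq]
  have hxu : ∀ᶠ y in 𝓝 y₀.toJ1, px g y + y.2.2.2 * pu g y = 0 := by
    filter_upwards [hins.eventually h, hp] with y h1 h2
    simp only [tdx] at h1
    rw [show (ins y).toJ1 = y from rfl, h2, mul_zero, add_zero] at h1
    exact h1
  filter_upwards [hxu, hp, hxu.eventually_nhds, hp.eventually_nhds, hmem] with y h1 h2 h3 h4 h5
  have dg := fun v => differentiableAt_of_contDiffOn hN (contDiffOn_pd hN hg v) h5
  have dp : DifferentiableAt ℝ (fun y : J1 => y.2.2.2) y := by fun_prop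
  have e := pd_congr (g := fun _ => 0) h3 (0, 0, 0, 1)
  have e' := fun v => pd_congr (g := fun _ => 0) h4 v
  simp only [px_eq, pu_eq, pp_eq] at e e'
  rw [pd_add (dg _) (dp.fun_mul (dg _)), pd_mul dp (dg _), pd_coord_p,
    pd_comm hN hg h5 _ (0, 1, 0, 0), pd_comm hN hg h5 _ (0, 0, 1, 0), e', e'] at e
  simp only [pd_const] at e
  have hu : pu g y = 0 := by
    rw [pu_eq]
    linarith
  rw [hu, mul_zero, add_zero] at h1
  exact ⟨h1, hu, h2⟩

/-- Generic conditions on `(t, x, u, u_x, u_xx)` hold at some solution jet near a given one. -/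
theorem exists_sol_of_frequently {L : Equation} {z : Jet} (hz : z ∈ L.sol) {p : J2 → Prop}
    {r : Jet → Prop} (hp : ∃ᶠ y in 𝓝 (toJ2 z), p y) (hr : ∀ᶠ w in 𝓝 z, w ∈ L.sol → r w) :
    ∃ w ∈ L.sol, r w ∧ p (toJ2 w) := by
  have hc : Filter.Tendsto (fun y => L.solMap (insJ2 z y)) (𝓝 (toJ2 z)) (𝓝 z) := by
    have h1 : ContinuousAt L.solMap (insJ2 z (toJ2 z)) := by
      rw [insJ2_toJ2]
      exact Equation.continuousAt_solMap hz.1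
    have h2 := h1.comp (continuous_insJ2 z).continuousAt
    rw [ContinuousAt, Function.comp_apply, insJ2_toJ2, Equation.solMap_eq_self hz] at h2
    exact h2
  have hdom : ∀ᶠ y in 𝓝 (toJ2 z), y ∈ L.dom := L.isOpen_dom.mem_nhds hz.1
  obtain ⟨y, h1, h2, h3⟩ := (hp.and_eventually ((hc.eventually hr).and hdom)).exists
  have h4 : toJ2 (insJ2 z y) = y := toJ2_insJ2 z y
  have h5 : L.solMap (insJ2 z y) ∈ L.sol := by
    refine Equation.solMap_mem_sol ?_
    change toJ2 (insJ2 z y) ∈ L.dom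
    rwa [h4]
  refine ⟨_, h5, h2 h5, ?_⟩
  have h6 : toJ2 (L.solMap (insJ2 z y)) = y := h4
  rwa [h6]

theorem frequently_toJ1 {y₀ : J2} {p : J1 → Prop} (h : ∃ᶠ y in 𝓝 y₀.toJ1, p y) :
    ∃ᶠ y in 𝓝 y₀, p y.toJ1 := by
  intro hcon
  refine h ?_
  let ins : J1 → J2 := fun y => (y.1, y.2.1, y.2.2.1, y.2.2.2, y₀.2.2.2.2)
  have hins : Filter.Tendsto ins (𝓝 y₀.toJ1) (𝓝 y₀) := by
    have : Continuous ins := by fun_prop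
    exact this.tendsto _
  exact hins.eventually hcon

/-- If `U` is a function of `t` and `x`, the conserved vector is a null divergence on the
solution jets. -/
theorem DarbouxOn.exists_potential {f U Φ : J1 → ℝ} {N : Set J1}
    (h : DarbouxOn f (fun y => y.2.1) U Φ N) (hUp : ∀ y ∈ N, pp U y = 0) {L : Equation}
    {P : (Jet → ℝ) × (Jet → ℝ)} {z : Jet} {k : J1 → ℝ} {N₀ : Set J1} {Ψ : Jet → ℝ}
    (hnf : NormalFormAt L P f k N₀ Ψ z) (hN₀ : N ⊆ N₀) (hzN : toJ1 z ∈ N)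
    (hUu : ∀ᶠ y in 𝓝 (toJ1 z), pu U y = 0) :
    ∃ Ψ' : Jet → ℝ, SmoothAt Ψ' z ∧
      ∀ᶠ w in 𝓝 z, w ∈ L.sol → P.1 w = Dx Ψ' w ∧ P.2 w = -Dt Ψ' w := by
  have hk := hnf.smooth_k.mono hN₀
  have hflux := h.eventually_tdx_flux (h.contactOn_of_affine hUp) hnf hk hzN
  have hmem : ∀ᶠ y in 𝓝 (toJ1 z), y ∈ N := h.isOpen.mem_nhds hzN
  have htoJ1 : Filter.Tendsto J2.toJ1 (𝓝 (toJ2 z)) (𝓝 (toJ1 z)) :=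
    contDiff_J2_toJ1.continuous.tendsto _
  -- `U = D_x A` with a function `A` of `t` and `x`.
  obtain ⟨A, hA, hAx, hAv⟩ := exists_primitive_of_projection h.isOpen hzN h.smooth_U
    (π := projTX) (fun v => rfl)
    (by filter_upwards [hUu, hmem] with y h1 h2 v hv using pd_eq_zero_of_projTX (hUp y h2) h1 hv)
    (e := (0, 1, 0, 0)) rfl (φ := (ContinuousLinearMap.fst ℝ ℝ (ℝ × ℝ)).comp
      (ContinuousLinearMap.snd ℝ ℝ (ℝ × ℝ × ℝ))) rfl
  have hAu : ∀ y, pu A y = 0 := hAv (0, 0, 1, 0) rfl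
  have hAp : ∀ y, pp A y = 0 := hAv (0, 0, 0, 1) rfl
  -- The flux `g + A_t` is a function of `t` only.
  set g : J1 → ℝ := fun y => k y + (pt Φ y + U y * pt (fun y : J1 => y.2.1) y) with hg
  have hgs : ContDiffOn ℝ ∞ g N := h.smooth_flux hk
  have hAt := contDiffOn_pd isOpen_univ hA.contDiffOn (1, 0, 0, 0)
  have hg's : ContDiffOn ℝ ∞ (fun y => g y + pt A y) N := hgs.add (hAt.mono (Set.subset_univ N))
  have hg' : ∀ᶠ y in 𝓝 (toJ2 z), tdx (fun y => g y + pt A y) y = 0 := by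
    filter_upwards [hflux, htoJ1.eventually hAx.eventually_nhds, htoJ1.eventually hUu,
      htoJ1.eventually hmem] with y h1 h2 h3 h4
    have dA : DifferentiableAt ℝ (pt A) y.toJ1 :=
      differentiableAt_of_contDiffOn isOpen_univ hAt trivial
    have c := fun v => pd_comm isOpen_univ hA.contDiffOn (Set.mem_univ y.toJ1) v (1, 0, 0, 0)
    have e1 : pd (1, 0, 0, 0) (pd (0, 1, 0, 0) A) y.toJ1 = pt U y.toJ1 := pd_congr h2 _
    have e2 : pd (1, 0, 0, 0) (pd (0, 0, 1, 0) A) y.toJ1 = 0 := by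
      rw [pd_congr_on (f := pd (0, 0, 1, 0) A) (g := fun _ => 0) isOpen_univ trivial
        fun y _ => hAu y, pd_const]
    have e3 : pd (1, 0, 0, 0) (pd (0, 0, 0, 1) A) y.toJ1 = 0 := by
      rw [pd_congr_on (f := pd (0, 0, 0, 1) A) (g := fun _ => 0) isOpen_univ trivial
        fun y _ => hAp y, pd_const]
    have e4 : tdx (pt A) y = pt U y.toJ1 := by
      simp only [tdx, EvolCL.px_eq, EvolCL.pu_eq, EvolCL.pp_eq, pt_eq, c] at e1 e2 e3 ⊢
      rw [e1, e2, e3]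
      ring
    rw [tdx_add (differentiableAt_of_contDiffOn h.isOpen hgs h4) dA, h1, e4,
      ContactOn.newRhs, contactFactor, h3]
    simp only [tdx, EvolCL.px_eq, EvolCL.pu_eq, EvolCL.pp_eq, pt_eq, pd_coord_x]
    ring
  have hgt := eventually_eq_zero_of_tdx_eq_zero (y₀ := toJ2 z) h.isOpen hg's hzN hg'
  obtain ⟨B, hB, hBt, hBv⟩ := exists_primitive_of_projection h.isOpen hzN hg's
    (π := projT) (fun v => rfl)
    (by
      filter_upwards [hgt] with y h1 v hv
      exact pd_eq_zero_of_projT h1.2.2 h1.2.1 h1.1 hv)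
    (e := (1, 0, 0, 0)) rfl (φ := ContinuousLinearMap.fst ℝ ℝ (ℝ × ℝ × ℝ)) rfl
  have hBx : ∀ y, px B y = 0 := hBv (0, 1, 0, 0) rfl
  have hBu : ∀ y, pu B y = 0 := hBv (0, 0, 1, 0) rfl
  have hBp : ∀ y, pp B y = 0 := hBv (0, 0, 0, 1) rfl
  have sA : ∀ w, SmoothAt (fun w => A (toJ1 w)) w := fun w =>
    smoothAt_comp_toJ1 isOpen_univ hA.contDiffOn trivial
  have sB : ∀ w, SmoothAt (fun w => B (toJ1 w)) w := fun w =>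
    smoothAt_comp_toJ1 isOpen_univ hB.contDiffOn trivial
  have sΦ := (smoothAt_comp_toJ1 h.isOpen h.smooth_Φ hzN).add hnf.smooth_Ψ
  refine ⟨fun w => (Φ (toJ1 w) + Ψ w) + (A (toJ1 w) - B (toJ1 w)), sΦ.add ((sA z).sub (sB z)), ?_⟩
  have ht : Filter.Tendsto toJ1 (𝓝 z) (𝓝 (toJ1 z)) := Equation.continuous_toJ1.tendsto z
  filter_upwards [h.conservedVector_eq hnf hzN, ht.eventually hAx, ht.eventually hBt,
    sΦ.eventually] with w h1 h2 h3 h4 hw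
  have hdx : DifferentiableAt ℝ (fun y : J1 => y.2.1) (toJ1 w) := by fun_prop
  have dA := (hA.differentiable (by simp)) (toJ1 w)
  have dB := (hB.differentiable (by simp)) (toJ1 w)
  have e : ∀ v, lineDeriv ℝ (fun w => (Φ (toJ1 w) + Ψ w) + (A (toJ1 w) - B (toJ1 w))) w v =
      lineDeriv ℝ (fun w => Φ (toJ1 w) + Ψ w) w v + (lineDeriv ℝ (fun w => A (toJ1 w)) w v -
        lineDeriv ℝ (fun w => B (toJ1 w)) w v) := fun v => by
    rw [h4.lineDeriv_add ((sA w).sub (sB w)), (sA w).lineDeriv_sub (sB w)]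
  have ex : Dx (fun w => (Φ (toJ1 w) + Ψ w) + (A (toJ1 w) - B (toJ1 w))) w =
      Dx (fun w => Φ (toJ1 w) + Ψ w) w + (Dx (fun w => A (toJ1 w)) w -
        Dx (fun w => B (toJ1 w)) w) := e _
  have et : Dt (fun w => (Φ (toJ1 w) + Ψ w) + (A (toJ1 w) - B (toJ1 w))) w =
      Dt (fun w => Φ (toJ1 w) + Ψ w) w + (Dt (fun w => A (toJ1 w)) w -
        Dt (fun w => B (toJ1 w)) w) := e _
  have ex1 : Dx (fun w => (toJ1 w).2.1) w = 1 := lineDeriv_x w _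
  have et1 : Dt (fun w => (toJ1 w).2.1) w = 0 := lineDeriv_x w _
  have hA1 : px A (toJ1 w) = U (toJ1 w) := h2
  have hB1 : pt B (toJ1 w) = g (toJ1 w) + pt A (toJ1 w) := h3
  rw [ex, et, (h1 hw).1, (h1 hw).2, ex1, et1, Dx_comp_toJ1 dA, Dx_comp_toJ1 dB,
    Dt_comp_toJ1 dA, Dt_comp_toJ1 dB]
  simp only [tdx, toJ1_toJ2, hAu, hAp, hBx, hBu, hBp, hA1, hB1, hg]
  constructor <;> ring

/-! ### Regular Lagrangians -/

/-- The projection to the hyperplane `x = x₀`. -/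
def slice (x₀ : ℝ) (y : J1) : J1 := (y.1, x₀, y.2.2.1, y.2.2.2)

theorem contDiff_slice (x₀ : ℝ) : ContDiff ℝ ∞ (slice x₀) := by
  unfold slice
  fun_prop

theorem slice_mem_ball {y₀ y : J1} {r : ℝ} (hy : y ∈ Metric.ball y₀ r) :
    slice y₀.2.1 y ∈ Metric.ball y₀ r := by
  simp only [slice, Metric.mem_ball, Prod.dist_eq, max_lt_iff] at hy ⊢
  exact ⟨hy.1, by simpa using dist_nonneg.trans_lt hy.1, hy.2.2⟩

/-- Functions with the same `x`-derivative and the same values at `x = x₀` coincide. -/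
theorem eq_of_px_eq {y₀ : J1} {r : ℝ} {f g : J1 → ℝ}
    (hf : ∀ y ∈ Metric.ball y₀ r, DifferentiableAt ℝ f y)
    (hg : ∀ y ∈ Metric.ball y₀ r, DifferentiableAt ℝ g y)
    (hx : ∀ y ∈ Metric.ball y₀ r, px f y = px g y)
    (h0 : ∀ y ∈ Metric.ball y₀ r, y.2.1 = y₀.2.1 → f y = g y)
    {y : J1} (hy : y ∈ Metric.ball y₀ r) : f y = g y := by
  have h1 := eq_of_fderiv_eq_zero (convex_ball y₀ r) (f := fun y => f y - g y)
    (fun x hx => (hf x hx).fun_sub (hg x hx)) (slice_mem_ball hy) hy (fun x hxB => by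
      have e : y - slice y₀.2.1 y = (y.2.1 - y₀.2.1) • ((0, 1, 0, 0) : J1) := by
        simp [slice, Prod.ext_iff]
      have e2 := hx x hxB
      have e3 : fderiv ℝ (fun y => f y - g y) x (0, 1, 0, 0) = px f x - px g x :=
        pd_sub (hf x hxB) (hg x hxB) (0, 1, 0, 0)
      rw [e, map_smul, e3, e2, sub_self, smul_zero])
  have h2 := h0 _ (slice_mem_ball hy) rfl
  linarith

/-- Derivatives in directions tangent to the hyperplane `x = x₀` are determined on it. -/
theorem pd_congr_slice {y₀ : J1} {r : ℝ} {f g : J1 → ℝ}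
    (h0 : ∀ y ∈ Metric.ball y₀ r, y.2.1 = y₀.2.1 → f y = g y)
    {y : J1} (hy : y ∈ Metric.ball y₀ r) (hyx : y.2.1 = y₀.2.1)
    (hf : DifferentiableAt ℝ f y) (hg : DifferentiableAt ℝ g y) {v : J1} (hv : v.2.1 = 0) :
    pd v f y = pd v g y := by
  have h1 : HasDerivAt (fun s : ℝ => f (y + s • v)) (pd v f y) 0 :=
    hf.hasFDerivAt.hasLineDerivAt v
  have h2 : HasDerivAt (fun s : ℝ => g (y + s • v)) (pd v g y) 0 :=
    hg.hasFDerivAt.hasLineDerivAt v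
  refine h1.unique (h2.congr_of_eventuallyEq ?_)
  have hc : Filter.Tendsto (fun s : ℝ => y + s • v) (𝓝 0) (𝓝 y) := by
    have : Continuous fun s : ℝ => y + s • v := by fun_prop
    simpa using this.tendsto 0
  filter_upwards [hc.eventually (Metric.isOpen_ball.mem_nhds hy)] with s hs
  refine h0 _ hs ?_
  simp [hv, hyx]

/-- The extremals of a regular Lagrangian `f`, parametrised by their initial data at `x = x₀`. The
last two properties are `du/dx = u_x` and the Euler–Lagrange equation `d f_{u_x}/dx = f_u`. -/
theorem exists_extremals {N : Set J1} (hN : IsOpen N) {y₀ : J1} (hy₀ : y₀ ∈ N)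
    {f : J1 → ℝ} (hf : ContDiffOn ℝ ∞ f N) (hpp : pp (pp f) y₀ ≠ 0) :
    ∃ (E : J1 → J1) (r : ℝ), 0 < r ∧ ContDiffOn ℝ ∞ E (Metric.ball y₀ r) ∧
      (∀ y ∈ Metric.ball y₀ r, E y ∈ N) ∧
      (∀ y ∈ Metric.ball y₀ r, y.2.1 = y₀.2.1 → E y = y) ∧
      (∀ y ∈ Metric.ball y₀ r, (E y).1 = y.1 ∧ (E y).2.1 = y.2.1) ∧
      (∀ y ∈ Metric.ball y₀ r, px (fun y => (E y).2.2.1) y = (E y).2.2.2) ∧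
      ∀ y ∈ Metric.ball y₀ r, px (fun y => pp f (E y)) y = pu f (E y) := by
  have hfp := contDiffOn_pd hN hf (0, 0, 0, 1)
  have hpps : ContDiffOn ℝ ∞ (pp (pp f)) N := contDiffOn_pd hN hfp (0, 0, 0, 1)
  set N₁ : Set J1 := N ∩ pp (pp f) ⁻¹' {0}ᶜ
  have hN₁ : IsOpen N₁ := hpps.continuousOn.isOpen_inter_preimage hN isOpen_compl_singleton
  -- the Euler–Lagrange equation, solved for `u_xx`
  set c : J1 → ℝ := fun y =>
    (pu f y - px (pp f) y - y.2.2.2 * pu (pp f) y) / pp (pp f) y with hc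
  have hp : ContDiff ℝ ∞ fun y : J1 => y.2.2.2 := by fun_prop
  have hcs : ContDiffOn ℝ ∞ c N₁ := by
    refine ContDiffOn.div ((((contDiffOn_pd hN hf _).sub (contDiffOn_pd hN hfp _)).sub
      (hp.contDiffOn.mul (contDiffOn_pd hN hfp _))).mono Set.inter_subset_left)
      (hpps.mono Set.inter_subset_left) fun y hy => hy.2
  obtain ⟨φ, W, hW, h0W, hφ, hφU, hφ0, hφd⟩ := exists_smooth_flow hN₁
    (v := fun y : J1 => ((0, 1, y.2.2.2, c y) : J1)) ⟨hy₀, hpp⟩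
    (contDiffOn_const.prodMk (contDiffOn_const.prodMk (hp.contDiffOn.prodMk hcs)))
  let j : J1 → ℝ × J1 := fun y => (y.2.1 - y₀.2.1, slice y₀.2.1 y)
  have hj : ContDiff ℝ ∞ j := by
    have := contDiff_slice y₀.2.1
    refine ContDiff.prodMk ?_ this
    fun_prop
  have hj0 : ∀ y : J1, y.2.1 = y₀.2.1 → j y = (0, y) := by
    intro y hy
    simp only [j, slice, hy, sub_self, Prod.ext_iff]
    simp
  have hΩ : ∀ᶠ y in 𝓝 y₀, j y ∈ W := hj.continuous.continuousAt.eventually (hW.mem_nhds (by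
    rw [hj0 y₀ rfl]
    exact h0W))
  obtain ⟨r, hr, hball⟩ := Metric.eventually_nhds_iff_ball.1 hΩ
  have hEs : ContDiffOn ℝ ∞ (fun y => φ (j y)) (Metric.ball y₀ r) :=
    hφ.comp hj.contDiffOn hball
  have hEN : ∀ y ∈ Metric.ball y₀ r, φ (j y) ∈ N₁ := fun y hy => hφU _ (hball y hy)
  have hEd : ∀ y ∈ Metric.ball y₀ r, DifferentiableAt ℝ (fun y => φ (j y)) y := fun y hy =>
    differentiableAt_of_contDiffOn Metric.isOpen_ball hEs hy
  have hEx : ∀ y ∈ Metric.ball y₀ r, fderiv ℝ (fun y => φ (j y)) y (0, 1, 0, 0) =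
      (0, 1, (φ (j y)).2.2.2, c (φ (j y))) := by
    intro y hy
    have h1 : HasDerivAt (fun s : ℝ => φ (j (y + s • (0, 1, 0, 0))))
        (fderiv ℝ (fun y => φ (j y)) y (0, 1, 0, 0)) 0 := (hEd y hy).hasFDerivAt.hasLineDerivAt _
    have h2 : HasDerivAt (fun s => φ (y.2.1 - y₀.2.1 + s, slice y₀.2.1 y))
        (0, 1, (φ (j y)).2.2.2, c (φ (j y))) 0 :=
      HasDerivAt.comp_const_add (y.2.1 - y₀.2.1) 0 (by
        rw [add_zero]
        exact hφd _ _ (hball y hy))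
    refine h1.unique ?_
    have h3 : ∀ s : ℝ, j (y + s • (0, 1, 0, 0)) = (y.2.1 - y₀.2.1 + s, slice y₀.2.1 y) := by
      intro s
      simp [j, slice]
      ring
    simp only [h3]
    exact h2
  have hchain : ∀ {m : J1 → ℝ} {y : J1}, y ∈ Metric.ball y₀ r →
      DifferentiableAt ℝ m (φ (j y)) → px (fun y => m (φ (j y))) y =
        px m (φ (j y)) + (φ (j y)).2.2.2 * pu m (φ (j y)) + c (φ (j y)) * pp m (φ (j y)) := by
    intro m y hy hm
    have h1 : HasFDerivAt (fun y => m (φ (j y))) _ y :=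
      HasFDerivAt.comp y hm.hasFDerivAt (hEd y hy).hasFDerivAt
    rw [px, h1.fderiv, ContinuousLinearMap.comp_apply, hEx y hy, fderiv_J1_apply]
    ring
  have hE0 : ∀ y ∈ Metric.ball y₀ r, y.2.1 = y₀.2.1 → φ (j y) = y := by
    intro y hy hyx
    have h1 := hball y hy
    rw [hj0 y hyx] at h1 ⊢
    exact hφ0 y h1
  refine ⟨fun y => φ (j y), r, hr, hEs, fun y hy => (hEN y hy).1, hE0, fun y hy => ⟨?_, ?_⟩,
    fun y hy => ?_, fun y hy => ?_⟩
  · refine eq_of_px_eq (f := fun y => (φ (j y)).1) (g := fun y => y.1)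
      (fun y hy => (hEd y hy).fst) (fun y _ => by fun_prop) (fun y hy => ?_)
      (fun y hy hyx => by rw [hE0 y hy hyx]) hy
    rw [hchain (m := fun y => y.1) hy (by fun_prop)]
    simp only [px_eq, pu_eq, pp_eq, pd_coord_t]
    ring
  · refine eq_of_px_eq (f := fun y => (φ (j y)).2.1) (g := fun y => y.2.1)
      (fun y hy => (hEd y hy).snd.fst) (fun y _ => by fun_prop) (fun y hy => ?_)
      (fun y hy hyx => by rw [hE0 y hy hyx]) hy
    rw [hchain (m := fun y => y.2.1) hy (by fun_prop)]
    simp only [px_eq, pu_eq, pp_eq, pd_coord_x]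
    ring
  · rw [hchain (m := fun y => y.2.2.1) hy (by fun_prop)]
    simp only [px_eq, pu_eq, pp_eq, pd_coord_u]
    ring
  · change px (fun y => pp f (φ (j y))) y = pu f (φ (j y))
    rw [hchain (m := pp f) hy (differentiableAt_of_contDiffOn hN hfp (hEN y hy).1)]
    have h1 : pp (pp f) (φ (j y)) ≠ 0 := (hEN y hy).2
    have h2 : c (φ (j y)) * pp (pp f) (φ (j y)) = pu f (φ (j y)) - px (pp f) (φ (j y)) -
        (φ (j y)).2.2.2 * pu (pp f) (φ (j y)) := div_mul_cancel₀ _ h1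
    rw [h2]
    ring

/-- For a regular Lagrangian the Darboux relation holds with `X`, `U` the initial values of `u` and
`f_{u_x}` on the extremals, and with `Φ` the action along them. -/
theorem exists_darboux_of_regular {N : Set J1} (hN : IsOpen N) {y₀ : J1} (hy₀ : y₀ ∈ N)
    {f : J1 → ℝ} (hf : ContDiffOn ℝ ∞ f N) (hpp : pp (pp f) y₀ ≠ 0) :
    ∃ (X U Φ : J1 → ℝ) (N' : Set J1), y₀ ∈ N' ∧ N' ⊆ N ∧ DarbouxOn f X U Φ N' := by
  obtain ⟨E, r, hr, hE, hEN, hE0, hEtx, hEu, hEp⟩ := exists_extremals hN hy₀ hf hpp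
  set B := Metric.ball y₀ r with hB
  have hBo : IsOpen B := Metric.isOpen_ball
  have hyB : y₀ ∈ B := Metric.mem_ball_self hr
  have hfp := contDiffOn_pd hN hf (0, 0, 0, 1)
  -- the action
  obtain ⟨A, hA, hAx⟩ := exists_smooth_primitive hBo hyB (hf.comp hE hEN) (e := (0, 1, 0, 0))
    (φ := (ContinuousLinearMap.fst ℝ ℝ (ℝ × ℝ)).comp
      (ContinuousLinearMap.snd ℝ ℝ (ℝ × ℝ × ℝ))) rfl
  obtain ⟨r', hr', hball⟩ := Metric.eventually_nhds_iff_ball.1 (hAx.and (hBo.mem_nhds hyB))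
  set B' := Metric.ball y₀ r' with hB'
  have hB'o : IsOpen B' := Metric.isOpen_ball
  have hsub : B' ⊆ B := fun y hy => (hball y hy).2
  have hyB' : y₀ ∈ B' := Metric.mem_ball_self hr'
  set φ : J1 → ℝ := fun y => A y - A (slice y₀.2.1 y) with hφ
  have hφs : ContDiff ℝ ∞ φ := hA.sub (hA.comp (contDiff_slice _))
  have hφ0 : ∀ y : J1, y.2.1 = y₀.2.1 → φ y = 0 := by
    intro y hy
    have : slice y₀.2.1 y = y := by simp only [slice, ← hy]
    simp only [hφ, this, sub_self]
  have hφx : ∀ y ∈ B', px φ y = f (E y) := by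
    intro y hy
    have d1 := (hA.differentiable (by simp)) y
    have d2 : DifferentiableAt ℝ (fun y => A (slice y₀.2.1 y)) y :=
      ((hA.comp (contDiff_slice y₀.2.1)).differentiable (by simp)) y
    have h1 : px (fun y => A (slice y₀.2.1 y)) y = 0 := by
      have h2 : HasDerivAt (fun s : ℝ => A (slice y₀.2.1 (y + s • (0, 1, 0, 0))))
          (px (fun y => A (slice y₀.2.1 y)) y) 0 := d2.hasFDerivAt.hasLineDerivAt _
      refine h2.unique ?_
      have h3 : ∀ s : ℝ, slice y₀.2.1 (y + s • (0, 1, 0, 0)) = slice y₀.2.1 y := by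
        intro s
        simp [slice]
      simp only [h3]
      exact hasDerivAt_const _ _
    have h4 : pd (0, 1, 0, 0) A y = f (E y) := (hball y hy).1
    rw [px_eq] at h1 ⊢
    rw [hφ, pd_sub d1 d2, h1, h4, sub_zero]
  set Q : J1 → ℝ := fun y => (E y).2.2.1 with hQ
  set R : J1 → ℝ := fun y => (E y).2.2.2 with hR
  set q : J1 → ℝ := fun y => pp f (E y) with hq
  set q₀ : J1 → ℝ := fun y => pp f (slice y₀.2.1 y) with hq₀
  have hQs : ContDiffOn ℝ ∞ Q B := hE.snd.snd.fst
  have hRs : ContDiffOn ℝ ∞ R B := hE.snd.snd.snd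
  have hqs : ContDiffOn ℝ ∞ q B := hfp.comp hE hEN
  have hsl : ∀ y ∈ B, slice y₀.2.1 y ∈ N := fun y hy => by
    have := hEN _ (slice_mem_ball hy)
    rwa [hE0 _ (slice_mem_ball hy) rfl] at this
  have hq₀s : ContDiffOn ℝ ∞ q₀ B := hfp.comp (contDiff_slice _).contDiffOn hsl
  have hqq₀ : ∀ y ∈ B, y.2.1 = y₀.2.1 → q y = q₀ y := by
    intro y hy hyx
    have : slice y₀.2.1 y = y := by simp only [slice, ← hyx]
    simp only [hq, hq₀, hE0 y hy hyx, this]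
  have dQ : ∀ y ∈ B, DifferentiableAt ℝ Q y := fun y hy =>
    differentiableAt_of_contDiffOn hBo hQs hy
  have dR : ∀ y ∈ B, DifferentiableAt ℝ R y := fun y hy =>
    differentiableAt_of_contDiffOn hBo hRs hy
  have dq : ∀ y ∈ B, DifferentiableAt ℝ q y := fun y hy =>
    differentiableAt_of_contDiffOn hBo hqs hy
  have dq₀ : ∀ y ∈ B, DifferentiableAt ℝ q₀ y := fun y hy =>
    differentiableAt_of_contDiffOn hBo hq₀s hy
  have dQ' : ∀ v, ∀ y ∈ B, DifferentiableAt ℝ (pd v Q) y := fun v y hy =>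
    differentiableAt_of_contDiffOn hBo (contDiffOn_pd hBo hQs v) hy
  have dφ' : ∀ v, ∀ y, DifferentiableAt ℝ (pd v φ) y := fun v y =>
    differentiableAt_of_contDiffOn isOpen_univ (contDiffOn_pd isOpen_univ hφs.contDiffOn v) trivial
  have dφ : ∀ y, DifferentiableAt ℝ φ y := hφs.differentiable (by simp)
  have hQ0 : ∀ y ∈ B, y.2.1 = y₀.2.1 → Q y = y.2.2.1 := fun y hy hyx => by
    simp only [hQ, hE0 y hy hyx]
  have hR0 : ∀ y ∈ B, y.2.1 = y₀.2.1 → R y = y.2.2.2 := fun y hy hyx => by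
    simp only [hR, hE0 y hy hyx]
  have dfix : ∀ v : J1, v.1 = 0 → v.2.1 = 0 → ∀ y ∈ B, pd v (fun y => f (E y)) y =
      pu f (E y) * pd v Q y + q y * pd v R y := by
    intro v hvt hvx y hy
    have dE := differentiableAt_of_contDiffOn hBo hE hy
    have h1 : HasFDerivAt (fun y => f (E y)) _ y := HasFDerivAt.comp y
      (differentiableAt_of_contDiffOn hN hf (hEN y hy)).hasFDerivAt dE.hasFDerivAt
    have c1 : (fderiv ℝ E y v).1 = pd v (fun y => (E y).1) y := by
      rw [pd, dE.hasFDerivAt.fst.fderiv]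
      rfl
    have c2 : (fderiv ℝ E y v).2.1 = pd v (fun y => (E y).2.1) y := by
      rw [pd, dE.hasFDerivAt.snd.fst.fderiv]
      rfl
    have c3 : (fderiv ℝ E y v).2.2.1 = pd v Q y := by
      rw [pd, dE.hasFDerivAt.snd.snd.fst.fderiv]
      rfl
    have c4 : (fderiv ℝ E y v).2.2.2 = pd v R y := by
      rw [pd, dE.hasFDerivAt.snd.snd.snd.fderiv]
      rfl
    rw [pd_congr_on hBo hy (fun y hy => (hEtx y hy).1), pd_coord_t, hvt] at c1
    rw [pd_congr_on hBo hy (fun y hy => (hEtx y hy).2), pd_coord_x, hvx] at c2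
    rw [pd, h1.fderiv, ContinuousLinearMap.comp_apply, fderiv_J1_apply, c1, c2, c3, c4]
    simp only [hq]
    ring
  -- The derivatives of the action: both sides have the same `x`-derivative and the same value
  -- at `x = x₀`.
  have hφv : ∀ v : J1, v.1 = 0 → v.2.1 = 0 → ∀ y ∈ B',
      pd v φ y = q y * pd v Q y - v.2.2.1 * q₀ y := by
    intro v hvt hvx y hy
    refine eq_of_px_eq (f := pd v φ) (g := fun y => q y * pd v Q y - v.2.2.1 * q₀ y)
      (fun y _ => dφ' v y) (fun y hy => ((dq y (hsub hy)).fun_mul (dQ' v y (hsub hy))).fun_sub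
        ((dq₀ y (hsub hy)).const_mul _)) (fun y hy => ?_) (fun y hy hyx => ?_) hy
    · have hy' := hsub hy
      have e1 : pd (0, 1, 0, 0) (pd v φ) y = pu f (E y) * pd v Q y + q y * pd v R y := by
        rw [pd_comm isOpen_univ hφs.contDiffOn trivial, ← dfix v hvt hvx y hy']
        exact pd_congr_on hB'o hy hφx v
      have e2 : pd (0, 1, 0, 0) (pd v Q) y = pd v R y := by
        rw [pd_comm hBo hQs hy']
        exact pd_congr_on hBo hy' hEu v
      have e3 : pd (0, 1, 0, 0) q y = pu f (E y) := hEp y hy'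
      have e4 : pd (0, 1, 0, 0) q₀ y = 0 := by
        have h2 : HasDerivAt (fun s : ℝ => q₀ (y + s • (0, 1, 0, 0))) (pd (0, 1, 0, 0) q₀ y) 0 :=
          (dq₀ y hy').hasFDerivAt.hasLineDerivAt _
        refine h2.unique ?_
        have h3 : ∀ s : ℝ, q₀ (y + s • (0, 1, 0, 0)) = q₀ y := by
          intro s
          have h4 : slice y₀.2.1 (y + s • (0, 1, 0, 0)) = slice y₀.2.1 y := by simp [slice]
          simp only [hq₀, h4]
        simp only [h3]
        exact hasDerivAt_const _ _
      have e5 : pd (0, 1, 0, 0) (fun y => v.2.2.1 * q₀ y) y = 0 := by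
        rw [pd_mul (differentiableAt_const _) (dq₀ y hy'), pd_const, e4]
        ring
      rw [px_eq, px_eq, e1, pd_sub ((dq y hy').fun_mul (dQ' v y hy')) ((dq₀ y hy').const_mul _),
        pd_mul (dq y hy') (dQ' v y hy'), e2, e3, e5]
      ring
    · have hy' := hsub hy
      have e1 : pd v φ y = 0 := by
        rw [pd_congr_slice (g := fun _ => 0) (fun y _ hyx => hφ0 y hyx) hy hyx (dφ y)
          (differentiableAt_const _) hvx, pd_const]
      have e2 : pd v Q y = v.2.2.1 := by
        rw [pd_congr_slice hQ0 hy' hyx (dQ y hy') (by fun_prop) hvx, pd_coord_u]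
      rw [e1, e2, hqq₀ y hy' hyx]
      ring
  -- `E` is a local diffeomorphism.
  have dE := differentiableAt_of_contDiffOn hBo hE hyB
  have hinj : ∀ v, fderiv ℝ E y₀ v = 0 → v = 0 := by
    intro v hv
    have c1 : (fderiv ℝ E y₀ v).1 = pd v (fun y => (E y).1) y₀ := by
      rw [pd, dE.hasFDerivAt.fst.fderiv]
      rfl
    have c2 : (fderiv ℝ E y₀ v).2.1 = pd v (fun y => (E y).2.1) y₀ := by
      rw [pd, dE.hasFDerivAt.snd.fst.fderiv]
      rfl
    have c3 : (fderiv ℝ E y₀ v).2.2.1 = pd v Q y₀ := by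
      rw [pd, dE.hasFDerivAt.snd.snd.fst.fderiv]
      rfl
    have c4 : (fderiv ℝ E y₀ v).2.2.2 = pd v R y₀ := by
      rw [pd, dE.hasFDerivAt.snd.snd.snd.fderiv]
      rfl
    rw [pd_congr_on hBo hyB (fun y hy => (hEtx y hy).1), pd_coord_t] at c1
    rw [pd_congr_on hBo hyB (fun y hy => (hEtx y hy).2), pd_coord_x] at c2
    have hx : v.2.1 = 0 := by rw [← c2, hv]; rfl
    rw [pd_congr_slice hQ0 hyB rfl (dQ y₀ hyB) (by fun_prop) hx, pd_coord_u] at c3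
    rw [pd_congr_slice hR0 hyB rfl (dR y₀ hyB) (by fun_prop) hx, pd_coord_p] at c4
    rw [hv] at c1 c3 c4
    exact Prod.ext c1.symm (Prod.ext hx (Prod.ext c3.symm c4.symm))
  obtain ⟨E', hE'⟩ := exists_continuousLinearEquiv_of_injective _ hinj
  obtain ⟨e, hye, hes, heE, hesymm⟩ := exists_local_smooth_inverse hB'o hyB' (hE.mono hsub) E'
    (by
      rw [hE']
      exact dE.hasFDerivAt)
  have hmaps : ∀ y ∈ e.target, e.symm y ∈ B' := fun y hy => hes (e.map_target hy)
  have hmaps' : ∀ y ∈ e.target, e.symm y ∈ B := fun y hy => hsub (hmaps y hy)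
  have hinv : ∀ y ∈ e.target, E (e.symm y) = y := fun y hy => by rw [← heE, e.right_inv hy]
  have hXs : ContDiffOn ℝ ∞ (fun y => (e.symm y).2.2.1) e.target := hesymm.snd.snd.fst
  have hUs : ContDiffOn ℝ ∞ (fun y => q₀ (e.symm y)) e.target := hq₀s.comp hesymm hmaps'
  have hΦs : ContDiffOn ℝ ∞ (fun y => φ (e.symm y)) e.target := hφs.comp_contDiffOn hesymm
  -- The Darboux relation, evaluated on a vector `w` tangent to the fibres of `t`. Its preimage `v`
  -- under the derivative of `E` has the same `x`-component.
  have key : ∀ w : J1, w.1 = 0 → ∀ y ∈ e.target, pd w (fun y => φ (e.symm y)) y +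
      q₀ (e.symm y) * pd w (fun y => (e.symm y).2.2.1) y =
      (f y - y.2.2.2 * pp f y) * w.2.1 + pp f y * w.2.2.1 := by
    intro w hwt y hy
    have dS := differentiableAt_of_contDiffOn e.open_target hesymm hy
    have hy' := hmaps' y hy
    set v := fderiv ℝ e.symm y w with hv
    have hcomp : ∀ m : J1 → ℝ, DifferentiableAt ℝ m (e.symm y) →
        pd w (fun y => m (e.symm y)) y = pd v m (e.symm y) := by
      intro m hm
      have h1 : HasFDerivAt (fun y => m (e.symm y)) _ y :=
        HasFDerivAt.comp y hm.hasFDerivAt dS.hasFDerivAt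
      rw [pd, h1.fderiv]
      rfl
    have c1 : v.1 = 0 := by
      have h1 := hcomp (fun y => y.1) (by fun_prop)
      rw [pd_coord_t, pd_congr_on (g := fun y => y.1) e.open_target hy
        (fun y hy => by rw [← (hEtx _ (hmaps' y hy)).1, hinv y hy]), pd_coord_t] at h1
      rw [← h1, hwt]
    have c2 : v.2.1 = w.2.1 := by
      have h1 := hcomp (fun y => y.2.1) (by fun_prop)
      rw [pd_coord_x, pd_congr_on (g := fun y => y.2.1) e.open_target hy
        (fun y hy => by rw [← (hEtx _ (hmaps' y hy)).2, hinv y hy]), pd_coord_x] at h1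
      exact h1.symm
    have hsplit : v = v.2.1 • ((0, 1, 0, 0) : J1) + (0, 0, v.2.2.1, v.2.2.2) := by
      simp [Prod.ext_iff, c1]
    have hlin : ∀ m : J1 → ℝ, pd v m (e.symm y) =
        w.2.1 * px m (e.symm y) + pd (0, 0, v.2.2.1, v.2.2.2) m (e.symm y) := by
      intro m
      rw [pd]
      nth_rewrite 1 [hsplit]
      rw [map_add, map_smul, c2]
      rfl
    have c3 : w.2.2.1 = w.2.1 * y.2.2.2 + pd (0, 0, v.2.2.1, v.2.2.2) Q (e.symm y) := by
      have h1 := hcomp Q (dQ _ hy')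
      rw [pd_congr_on (g := fun y => y.2.2.1) e.open_target hy
        (fun y hy => by simp only [hQ, hinv y hy]), pd_coord_u, hlin Q, hEu _ hy', hinv y hy] at h1
      exact h1
    have c4 := hcomp φ (dφ _)
    rw [hlin φ, hφx _ (hmaps y hy), hφv _ rfl rfl _ (hmaps y hy), hinv y hy] at c4
    have c5 := hcomp (fun y => y.2.2.1) (by fun_prop)
    rw [pd_coord_u] at c5
    have c6 : q (e.symm y) = pp f y := by simp only [hq, hinv y hy]
    rw [c4, c5, c6, c3]
    ring
  have hE₀ : E y₀ = y₀ := hE0 y₀ hyB rfl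
  have hNsub : e.target ⊆ N := fun y hy => by
    rw [← hinv y hy]
    exact hEN _ (hmaps' y hy)
  refine ⟨fun y => (e.symm y).2.2.1, fun y => q₀ (e.symm y), fun y => φ (e.symm y), e.target, ?_,
    hNsub, e.open_target, hf.mono hNsub, hXs, hUs, hΦs, fun y hy => ?_, fun y hy => ?_,
    fun y hy => ?_⟩
  · have := e.map_source hye
    rwa [heE, hE₀] at this
  · have := key (0, 0, 0, 1) rfl y hy
    rw [pp_eq, pp_eq]
    simp only at this
    linarith
  · have := key (0, 0, 1, 0) rfl y hy
    rw [pu_eq, pu_eq]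
    simp only at this
    linarith
  · have := key (0, 1, 0, 0) rfl y hy
    rw [px_eq, px_eq]
    simp only at this
    linarith

theorem DarbouxOn.contactOn_of_regular {f X U Φ : J1 → ℝ} {N : Set J1}
    (h : DarbouxOn f X U Φ N) (hX : ∀ y ∈ N, pp X y ≠ 0) :
    ContactOn X U (fun y => pp U y / pp X y) N := by
  refine ⟨h.isOpen, h.smooth_X, h.smooth_U, (contDiffOn_pd h.isOpen h.smooth_U _).div
    (contDiffOn_pd h.isOpen h.smooth_X _) hX, fun y hy => ?_, fun y hy => ?_⟩
  · rw [div_mul_cancel₀ _ (hX y hy)]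
  · obtain ⟨e1, e2, -⟩ := h.wedge_eq hy
    have := hX y hy
    field_simp
    linear_combination e2 - y.2.2.2 * e1

theorem DarbouxOn.contactFactor_ne_zero {f X U Φ : J1 → ℝ} {N : Set J1}
    (h : DarbouxOn f X U Φ N) {y : J1} (hy : y ∈ N) (hX : pp X y ≠ 0) (hf : pp (pp f) y ≠ 0) :
    contactFactor X U (fun y => pp U y / pp X y) y ≠ 0 := by
  have e1 := (h.wedge_eq hy).1
  intro h0
  refine hf ?_
  rw [← e1]
  simp only [contactFactor] at h0
  field_simp at h0
  linear_combination -h0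

/-- `D_x X` does not vanish identically, since `dX ∧ dU ≠ 0`, so that generically `X` involves
`u_x`. -/
theorem DarbouxOn.frequently_regular {f X U Φ : J1 → ℝ} {N : Set J1}
    (h : DarbouxOn f X U Φ N) {y₀ : J2} (hy₀ : y₀.toJ1 ∈ N) (hf : pp (pp f) y₀.toJ1 ≠ 0) :
    ∃ᶠ y in 𝓝 y₀, pp X y.toJ1 ≠ 0 ∧ tdx X y ≠ 0 := by
  have hXs := contDiffOn_pd h.isOpen h.smooth_X (0, 0, 0, 1)
  have hmem : ∀ᶠ y in 𝓝 y₀, y.toJ1 ∈ N :=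
    contDiff_J2_toJ1.continuous.continuousAt.eventually (h.isOpen.mem_nhds hy₀)
  have h1 : ∃ᶠ y in 𝓝 y₀, pp X y.toJ1 ≠ 0 := by
    refine frequently_toJ1 (p := fun y => pp X y ≠ 0) fun hcon => ?_
    simp only [not_not] at hcon
    obtain ⟨e1, e2, -⟩ := h.wedge_eq hy₀
    have hp := hcon.self_of_nhds
    rw [hp] at e1 e2
    have htdx : ∀ᶠ y in 𝓝 y₀, tdx X y = 0 := by
      have hU : ∀ᶠ y in 𝓝 y₀, pp (pp f) y.toJ1 ≠ 0 :=
        contDiff_J2_toJ1.continuous.continuousAt.eventually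
          (((contDiffOn_pd h.isOpen (contDiffOn_pd h.isOpen h.smooth_f (0, 0, 0, 1))
            (0, 0, 0, 1)).continuousOn.continuousAt (h.isOpen.mem_nhds hy₀)).eventually_ne hf)
      have hX : ∀ᶠ y in 𝓝 y₀, pp X y.toJ1 = 0 :=
        contDiff_J2_toJ1.continuous.continuousAt.eventually hcon
      filter_upwards [hU, hX, hmem] with y h1 h2 h3
      obtain ⟨e1, e2, -⟩ := h.wedge_eq h3
      rw [h2] at e1 e2
      have hUp : pp U y.toJ1 ≠ 0 := by
        intro h0
        rw [h0] at e1
        exact h1 (by linarith)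
      have e3 : pp U y.toJ1 * (px X y.toJ1 + y.2.2.2.1 * pu X y.toJ1) = 0 := by
        change px U y.toJ1 * 0 - pp U y.toJ1 * px X y.toJ1 = y.2.2.2.1 * pp (pp f) y.toJ1 at e2
        linear_combination -e2 + y.2.2.2.1 * e1
      rw [tdx, h2, (mul_eq_zero.1 e3).resolve_left hUp]
      ring
    have hu := (eventually_eq_zero_of_tdx_eq_zero h.isOpen h.smooth_X hy₀ htdx).self_of_nhds.2.1
    rw [hu] at e1
    exact hf (by linarith)
  intro hcon
  obtain ⟨y, hy1, hy2, hy3⟩ := (h1.and_eventually (hcon.eventually_nhds.and hmem)).exists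
  have hne : ∀ᶠ y' in 𝓝 y, pp X y'.toJ1 ≠ 0 :=
    contDiff_J2_toJ1.continuous.continuousAt.eventually
      ((hXs.continuousOn.continuousAt (h.isOpen.mem_nhds hy3)).eventually_ne hy1)
  refine hy1 (eventually_eq_zero_of_tdx_eq_zero h.isOpen h.smooth_X hy3 ?_).self_of_nhds.2.2
  filter_upwards [hy2, hne] with y' h2 h3
  by_contra h4
  exact h2 ⟨h3, h4⟩

/-! ### Normalisation of the characteristic -/

/-- For a quasi-linear equation the densities of conserved vectors in normal form are affine in
`u_x`. -/
theorem NormalFormAt.affine_of_isQuasiLinear {L : Equation} {P : (Jet → ℝ) × (Jet → ℝ)}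
    {f k : J1 → ℝ} {N : Set J1} {Ψ : Jet → ℝ} {z : Jet} (h : NormalFormAt L P f k N Ψ z)
    (hL : L.IsQuasiLinear) : ∀ᶠ y in 𝓝 (toJ1 z), pp (pp f) y = 0 := by
  by_contra hcon
  have hfreq : ∃ᶠ y in 𝓝 (toJ2 z).toJ1, pp (pp f) y ≠ 0 := Filter.not_eventually.1 hcon
  refine frequently_toJ1 hfreq ?_
  have hmem : ∀ᶠ y in 𝓝 (toJ2 z), y.toJ1 ∈ N :=
    contDiff_J2_toJ1.continuous.continuousAt.eventually (h.isOpen.mem_nhds h.mem)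
  have hdom : ∀ᶠ y in 𝓝 (toJ2 z), y ∈ L.dom := L.isOpen_dom.mem_nhds h.mem_sol.1
  have hfp := contDiffOn_pd h.isOpen h.smooth_f (0, 0, 0, 1)
  have hN := h.isOpen.preimage contDiff_J2_toJ1.continuous
  have hc : ∀ y : J2, DifferentiableAt ℝ J2.toJ1 y := contDiff_J2_toJ1.differentiable (by simp)
  have dcomp : ∀ {m : J1 → ℝ} {y : J2}, DifferentiableAt ℝ m y.toJ1 →
      DifferentiableAt ℝ (fun y : J2 => m y.toJ1) y := fun {m} {y} hm =>
    DifferentiableAt.comp y hm (hc y)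
  have dE : ∀ y : J2, y.toJ1 ∈ N →
      DifferentiableAt ℝ (fun y : J2 => pu f y.toJ1 - tdx (pp f) y) y := fun y hy =>
    (dcomp (differentiableAt_of_contDiffOn h.isOpen (contDiffOn_pd h.isOpen h.smooth_f _)
      hy)).fun_sub (differentiableAt_of_contDiffOn hN (contDiffOn_tdx h.isOpen hfp) hy)
  have pE : ∀ y : J2, y.toJ1 ∈ N →
      pq (fun y : J2 => pu f y.toJ1 - tdx (pp f) y) y = -pp (pp f) y.toJ1 := by
    intro y hy
    have d1 := differentiableAt_of_contDiffOn h.isOpen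
      (contDiffOn_pd h.isOpen h.smooth_f (0, 0, 1, 0)) hy
    have d2 : DifferentiableAt ℝ (tdx (pp f)) y :=
      differentiableAt_of_contDiffOn hN (contDiffOn_tdx h.isOpen hfp) hy
    have e1 : pq (tdx (pp f)) y = pp (pp f) y.toJ1 := pq_tdx h.isOpen hfp hy
    have e2 : pq (fun y : J2 => pu f y.toJ1) y = 0 := pq_comp_toJ1 d1
    have d3 : DifferentiableAt ℝ (fun y : J2 => pu f y.toJ1) y := dcomp d1
    rw [pq, fderiv_fun_sub d3 d2]
    change pq (fun y : J2 => pu f y.toJ1) y - pq (tdx (pp f)) y = _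
    rw [e1, e2, zero_sub]
  -- The first derivative of the identity with respect to `u_xx`.
  have h1 : ∀ᶠ y in 𝓝 (toJ2 z), -pp (pp f) y.toJ1 * L.H y +
      (pu f y.toJ1 - tdx (pp f) y) * pq L.H y + pp k y.toJ1 = 0 := by
    filter_upwards [h.identity.eventually_nhds, hmem, hdom] with y h1 h2 h3
    have d1 : DifferentiableAt ℝ (pt f) y.toJ1 :=
      differentiableAt_of_contDiffOn h.isOpen (contDiffOn_pd h.isOpen h.smooth_f _) h2
    have d2 := Equation.differentiableAt_H h3
    have d3 := differentiableAt_of_contDiffOn hN (contDiffOn_tdx h.isOpen h.smooth_k) h2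
    have e := pq_congr (g := fun _ => 0) h1
    rw [pq_add ((dcomp d1).fun_add ((dE y h2).fun_mul d2)) d3,
      pq_add (dcomp d1) ((dE y h2).fun_mul d2), pq_comp_toJ1 d1, pq_mul (dE y h2) d2, pE y h2,
      pq_tdx h.isOpen h.smooth_k h2] at e
    have e0 : pq (fun _ : J2 => (0 : ℝ)) y = 0 := by simp [pq]
    rw [e0, zero_add] at e
    exact e
  filter_upwards [h1.eventually_nhds, hmem, hdom] with y h1 h2 h3
  rw [not_not]
  have d1 : DifferentiableAt ℝ (pp (pp f)) y.toJ1 :=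
    differentiableAt_of_contDiffOn h.isOpen (contDiffOn_pd h.isOpen hfp _) h2
  have d2 := Equation.differentiableAt_H h3
  have d3 : DifferentiableAt ℝ (pq L.H) y := differentiableAt_of_contDiffOn L.isOpen_dom
    ((L.smooth.fderiv_of_isOpen L.isOpen_dom (by simp)).clm_apply contDiffOn_const) h3
  have d4 : DifferentiableAt ℝ (pp k) y.toJ1 :=
    differentiableAt_of_contDiffOn h.isOpen (contDiffOn_pd h.isOpen h.smooth_k _) h2
  have d5 : DifferentiableAt ℝ (fun y => -pp (pp f) y) y.toJ1 := d1.fun_neg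
  have e := pq_congr (g := fun _ => 0) h1
  have e1 : pq (fun y : J2 => -pp (pp f) y.toJ1) y = 0 := pq_comp_toJ1 d5
  have e2 : pq (pq L.H) y = 0 := hL y h3
  have d6 : DifferentiableAt ℝ (fun y : J2 => -pp (pp f) y.toJ1) y := dcomp d5
  rw [pq_add ((d6.fun_mul d2).fun_add ((dE y h2).fun_mul d3)) (dcomp d4),
    pq_add (d6.fun_mul d2) ((dE y h2).fun_mul d3), pq_mul d6 d2, pq_mul (dE y h2) d3, e1, e2,
    pE y h2, pq_comp_toJ1 d4] at e
  have e0 : pq (fun _ : J2 => (0 : ℝ)) y = 0 := by simp [pq]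
  rw [e0] at e
  have e3 : pp (pp f) y.toJ1 * pq L.H y = 0 := by linarith
  exact (mul_eq_zero.1 e3).resolve_right (L.nondeg y h3)

/-- A conserved vector which is not trivial is mapped, over some open set, to one with the
characteristic `1`; for quasi-linear equations a point transformation does it. -/
theorem exists_mapsPair_of_not_mem_CV0 {L : Equation} {D : Set Jet} (hD : IsOpen D) (P : CV L D)
    (hP : P.1 ∉ CV0 L D) :
    ∃ (D₁ : Set Jet) (hD₁ : D₁ ⊆ D) (𝒯 : ContactTransformation)
      (L' : Equation) (D' : Set Jet) (ℱ' : CL L' D'),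
      IsOpen D₁ ∧ (D₁ ∩ L.sol).Nonempty ∧ IsOpen D' ∧
      𝒯.MapsPair (CL.restrict hD₁ (CL.mk P)) ℱ' ∧ ℱ'.HasCharacteristic (fun _ => 1) ∧
      (L.IsQuasiLinear → 𝒯.IsPoint ∧ L'.IsQuasiLinear) := by
  obtain ⟨z, ⟨hzD, hz⟩, hnt⟩ : ∃ z ∈ D ∩ L.sol, ¬∃ Ψ : Jet → ℝ, SmoothAt Ψ z ∧
      ∀ᶠ w in 𝓝 z, w ∈ L.sol → P.1.1 w = Dx Ψ w ∧ P.1.2 w = -Dt Ψ w := by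
    by_contra! hcon
    refine hP fun z hz => ?_
    obtain ⟨Ψ, hΨ, h⟩ := hcon z hz
    obtain ⟨W, hW, hWo, hzW⟩ := eventually_nhds_iff.1 (hΨ.eventually.and h)
    exact ⟨W, Ψ, hWo, hzW, fun w hw => (hW w hw).1, fun w hw => (hW w hw.1).2 hw.2⟩
  obtain ⟨f, k, N, Ψ, hN, hzN, hf, hk, hΨ, heq, hid⟩ := Equation.exists_normal_form hz
    (P.2.1.smoothAt hzD) (P.2.2.1.smoothAt hzD)
    (Filter.eventually_of_mem (hD.mem_nhds hzD) fun w hw hw' => P.2.2.2 w ⟨hw, hw'⟩)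
  have hnf : NormalFormAt L P.1 f k N Ψ z := ⟨hz, hN, hzN, hf, hk, hΨ, heq, hid⟩
  have hnear : ∀ {z : Jet} {N' : Set J1}, NormalFormAt L P.1 f k N Ψ z → z ∈ D → IsOpen N' →
      toJ1 z ∈ N' → ∀ᶠ w in 𝓝 z, w ∈ L.sol →
        NormalFormAt L P.1 f k N Ψ w ∧ w ∈ D ∧ toJ1 w ∈ N' := by
    intro z N' h1 h2 h3 h4
    filter_upwards [h1.eventually, hD.mem_nhds h2,
      Equation.continuous_toJ1.continuousAt.eventually (h3.mem_nhds h4)] with w e1 e2 e3 hw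
    exact ⟨e1 hw, e2, e3⟩
  by_cases hpp : ∀ᶠ y in 𝓝 (toJ1 z), pp (pp f) y = 0
  · obtain ⟨U, Φ, N', hzN', hsub, hDx, -, hUp, U₀, hU₀⟩ := exists_darboux_of_affine hN hzN hf hpp
    have hU : ∃ᶠ y in 𝓝 (toJ2 z).toJ1, pu U y ≠ 0 := fun hcon =>
      hnt (hDx.exists_potential hUp hnf hsub hzN' (hcon.mono fun y hy => not_not.1 hy))
    obtain ⟨w, -, ⟨h1, h2, h3⟩, h4⟩ := exists_sol_of_frequently hz (frequently_toJ1 hU)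
      (hnear hnf hzD hDx.isOpen hzN')
    have ha : contactFactor (fun y => y.2.1) U (fun y => px U y + y.2.2.2 * pu U y) (toJ1 w) ≠ 0 := by
      rw [contactFactor, pu_eq (fun y : J1 => y.2.1), pd_coord_x, mul_zero, sub_zero]
      exact h4
    have hx : tdx (fun y => y.2.1) (toJ2 w) ≠ 0 := by
      simp only [tdx, px_eq, pu_eq, pp_eq, pd_coord_x]
      norm_num
    obtain ⟨D₁, hD₁, 𝒯, L', D', ℱ', a1, a2, a3, a4, a5, a6, a7⟩ :=
      hDx.exists_mapsPair (hDx.contactOn_of_affine hUp) hD P h2 h1 hsub h3 ha hx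
    exact ⟨D₁, hD₁, 𝒯, L', D', ℱ', a1, a2, a3, a4, a5, fun hL =>
      ⟨a6 ⟨fun a => a.2.1, U₀, fun y hy => ⟨rfl, hU₀ y hy⟩⟩,
        a7 (fun y _ => by rw [pp_eq, pd_coord_x]) hL⟩⟩
  · have hpp' : ∃ᶠ y in 𝓝 (toJ2 z).toJ1, pp (pp f) y ≠ 0 := Filter.not_eventually.1 hpp
    obtain ⟨w, hw, ⟨h1, h2, -⟩, h4⟩ := exists_sol_of_frequently hz (frequently_toJ1 hpp')
      (hnear hnf hzD hN hzN)
    obtain ⟨X, U, Φ, N', hwN', hsub, hDb⟩ := exists_darboux_of_regular hN h1.mem hf h4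
    have hf2 := contDiffOn_pd hN (contDiffOn_pd hN hf (0, 0, 0, 1)) (0, 0, 0, 1)
    have hfo : IsOpen (N ∩ pp (pp f) ⁻¹' {0}ᶜ) :=
      hf2.continuousOn.isOpen_inter_preimage hN isOpen_compl_singleton
    obtain ⟨w', -, ⟨b1, b2, b3⟩, b4, b5⟩ := exists_sol_of_frequently hw
      (hDb.frequently_regular hwN' h4)
      (hnear h1 h2 (hDb.isOpen.inter hfo) ⟨hwN', h1.mem, h4⟩)
    have hXo : IsOpen (N' ∩ pp X ⁻¹' {0}ᶜ) :=
      (contDiffOn_pd hDb.isOpen hDb.smooth_X (0, 0, 0, 1)).continuousOn.isOpen_inter_preimage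
        hDb.isOpen isOpen_compl_singleton
    have hDb' := hDb.mono hXo Set.inter_subset_left
    have hmem : toJ1 w' ∈ N' ∩ pp X ⁻¹' {0}ᶜ := ⟨b3.1, b4⟩
    obtain ⟨D₁, hD₁, 𝒯, L', D', ℱ', a1, a2, a3, a4, a5, -, -⟩ :=
      hDb'.exists_mapsPair (hDb'.contactOn_of_regular fun y hy => hy.2) hD P b2 b1
        (Set.inter_subset_left.trans hsub) hmem (hDb.contactFactor_ne_zero b3.1 b4 b3.2.2) b5
    exact ⟨D₁, hD₁, 𝒯, L', D', ℱ', a1, a2, a3, a4, a5,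
      fun hL => absurd (hnf.affine_of_isQuasiLinear hL) hpp⟩

end EvolCL

theorem mainTheorem6 (L : EvolCL.Equation) (D : Set EvolCL.Jet) (hD : IsOpen D)
    (ℱ : EvolCL.CL L D) (hℱ : ℱ ≠ 0) :
    (∃ (D₁ : Set EvolCL.Jet) (hD₁ : D₁ ⊆ D) (𝒯 : EvolCL.ContactTransformation)
      (L' : EvolCL.Equation) (D' : Set EvolCL.Jet) (ℱ' : EvolCL.CL L' D'),
      IsOpen D₁ ∧ (D₁ ∩ L.sol).Nonempty ∧ IsOpen D' ∧
      𝒯.MapsPair (EvolCL.CL.restrict hD₁ ℱ) ℱ' ∧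
      ℱ'.HasCharacteristic (fun _ => 1)) ∧
    (L.IsQuasiLinear →
      ∃ (D₁ : Set EvolCL.Jet) (hD₁ : D₁ ⊆ D) (𝒯 : EvolCL.ContactTransformation)
      (L' : EvolCL.Equation) (D' : Set EvolCL.Jet) (ℱ' : EvolCL.CL L' D'),
      IsOpen D₁ ∧ (D₁ ∩ L.sol).Nonempty ∧ IsOpen D' ∧
      𝒯.IsPoint ∧ L'.IsQuasiLinear ∧
      𝒯.MapsPair (EvolCL.CL.restrict hD₁ ℱ) ℱ' ∧
      ℱ'.HasCharacteristic (fun _ => 1)) := by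
  obtain ⟨P, rfl⟩ := Submodule.Quotient.mk_surjective _ ℱ
  have hP : P.1 ∉ EvolCL.CV0 L D := fun h => hℱ ((Submodule.Quotient.mk_eq_zero _).2 h)
  obtain ⟨D₁, hD₁, 𝒯, L', D', ℱ', a1, a2, a3, a4, a5, a6⟩ :=
    EvolCL.exists_mapsPair_of_not_mem_CV0 hD P hP
  exact ⟨⟨D₁, hD₁, 𝒯, L', D', ℱ', a1, a2, a3, a4, a5⟩, fun hL =>
    ⟨D₁, hD₁, 𝒯, L', D', ℱ', a1, a2, a3, (a6 hL).1, (a6 hL).2, a4, a5⟩⟩
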